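/- Let $k$ be a field and let $A$ be a unital associative $k$-algebra which is Noetherian in the sense that its enveloping algebra $A^e=A\otimes_k A^{\mathrm{op}}$ is Noetherian (this implies that $A$ is left and right Noetherian, and it holds e.g. for finite-dimensional and for finitely generated commutative algebras). **Singular Hochschild cohomology.** Put $\overline A=A/(k\cdot 1)$ and $\Omega^p(A)=A\otimes\overline A^{\otimes p}$, an $A$-bimodule with left multiplication on the factor $A$ and with the right action $$(a_0\otimes\overline a_1\otimes\cdots\otimes\overline a_p)\blacktriangleleft a_{p+1}=\sum_{i=0}^{p}(-1)^{p-i}a_0\otimes\overline a_1\otimes\cdots\otimes\overline{a_ia_{i+1}}\otimes\cdots\otimes\overline a_{p+1},$$ where for $i=0$ the summand is $a_0a_1\otimes\overline a_2\otimes\cdots\otimes\overline a_{p+1}$. For $m\in\mathbb Z$ and $p\ge 0$ with $n=m+p\ge 0$ let $C^m(A,\Omega^p(A))=\mathrm{Hom}_k(\overline A^{\otimes n},\Omega^p(A))$, with the normalized Hochschild differential $$\delta(f)(\overline a_1,\dots,\overline a_{n+1})=(-1)^{m+1}\Big(a_1f(\overline a_2,\dots,\overline a_{n+1})+\sum_{i=1}^{n}(-1)^if(\overline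 a_1,\dots,\overline{a_ia_{i+1}},\dots,\overline a_{n+1})+(-1)^{n+1}f(\overline a_1,\dots,\overline a_n)\blacktriangleleft a_{n+1}\Big).$$ The maps $\theta_p\colon C^m(A,\Omega^p(A))\to C^m(A,\Omega^{p+1}(A))$, $f\mapsto f\otimes\mathrm{id}_{\overline A}$, commute with $\delta$; let $C^m_{\mathrm{sg}}(A,A)=\varinjlim_{p}C^m(A,\Omega^p(A))$, with the induced differential, and let $\mathrm{HH}^m_{\mathrm{sg}}(A,A)$ be the $m$-th cohomology of this complex. The cup product is induced by $$f\cup g=(\mu\otimes\mathrm{id}^{\otimes(p+q)})(\mathrm{id}_A\otimes f\otimes\mathrm{id}^{\otimes q})(g\otimes\mathrm{id}^{\otimes m})\in\mathrm{Hom}_k(\overline A^{\otimes(n+m)},\Omega^{p+q}(A))$$ for $f\colon\overline A^{\otimes m}\to\Omega^p(A)$ and $g\colon\overline A^{\otimes n}\to\Omega^q(A)$, where $\mu$ is the multiplication of $A$; its unit is the class of $1\in A=C^0(A,A)$. **Tate–Hochschild cohomology.** Let $\mathcal D_{\mathrm{sg}}(A^e)=\mathcal D^b(A^e)/\mathrm{Perf}(A^e)$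 be the singularity category: the Verdier quotient of the bounded derived category of finitely generated left $A^e$-modules by the complexes quasi-isomorphic to bounded complexes of finitely generated projective modules. Put $\underline{\mathrm{Ext}}^m_{A^e}(A,A)=\mathrm{Hom}_{\mathcal D_{\mathrm{sg}}(A^e)}(A,A[m])$, $m\in\mathbb Z$, with the Yoneda product $\varphi\cdot\psi=\varphi[b]\circ\psi$ for $\varphi$ of degree $a$ and $\psi$ of degree $b$. **The map $\Phi$.** Let $\mathrm{Bar}_n(A)=A\otimes\overline A^{\otimes n}\otimes A$ be the normalized bar resolution of $A$. A cocycle $f\in C^m(A,\Omega^p(A))$, $n=m+p$, defines the map of complexes of bimodules $\mathrm{Bar}_*(A)\to\Omega^p(A)[n]$, $a\otimes x\otimes b\mapsto a f(x)\blacktriangleleft b$, hence a morphism $\kappa_f\colon A\to\Omega^p(A)[n]$ in the derived category of bimodules. For $f$ the inclusion $x\mapsto 1\otimes x$ of $\overline A^{\otimes p}$ in $\Omega^p(A)$ this is a morphism $\nu_p\colon A\to\Omega^p(A)[p]$, which identifies $\Omega^p(A)$ with the $p$-th syzygy of $A$ in the bar resolution and becomes invertible modulo bounded complexes of projective bimodules.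 Then $\Phi_m(f)\colon A\to A[m]$ is the morphism of $\mathcal D_{\mathrm{sg}}(A^e)$ with $\nu_p[m]\circ\Phi_m(f)=\kappa_f$ modulo bounded complexes of projective bimodules; explicitly, $\Phi_m(f)=t\,s^{-1}$ for some morphisms $s\colon X\to A$ with perfect cone and $t\colon X\to A[m]$ in $\mathcal D^b(A^e)$ such that $\nu_p[m]\circ t=\kappa_f\circ s$. **Claim.** There are well-defined $k$-linear isomorphisms $\Phi_m\colon\mathrm{HH}^m_{\mathrm{sg}}(A,A)\to\underline{\mathrm{Ext}}^m_{A^e}(A,A)$, $m\in\mathbb Z$, which are given by this rule on the class of every cocycle $f\in C^m(A,\Omega^p(A))$ for all $p\ge 0$ with $m+p\ge 0$, and they form an isomorphism of graded algebras: $\Phi_0(1)=\mathrm{id}_A$, and for all $a,b\in\mathbb Z$, $x\in\mathrm{HH}^a_{\mathrm{sg}}(A,A)$, $y\in\mathrm{HH}^b_{\mathrm{sg}}(A,A)$, $$\Phi_{a+b}(x\cup y)=\Phi_a(x)[b]\circ\Phi_b(y).$$ -/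

import Mathlib

open TensorProduct CategoryTheory

universe u

noncomputable section

namespace TateHH

/-! ### Noncommutative differential forms -/

section Forms

variable (k A : Type u) [Field k] [Ring A] [Algebra k A]

/-- The reduced algebra `Ā = A / (k · 1)`. -/
abbrev Red : Type u := A ⧸ Submodule.span k {(1 : A)}

/-- The tensor power `Ā^{⊗ n}` (over `k`). -/
abbrev Tens (n : ℕ) : Type u := ⨂[k]^n (Red k A)

variable {k A} in
/-- The class `ā ∈ Ā` of an element `a ∈ A`. -/
abbrev bar : A →ₗ[k] Red k A := Submodule.mkQ _

/-- `Ā^{⊗ n} ⊗ Ā ≅ Ā^{⊗ (n + 1)}`, `(ā₁ ⊗ ⋯ ⊗ āₙ) ⊗ b̄ ↦ ā₁ ⊗ ⋯ ⊗ āₙ ⊗ b̄`. -/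
def Tens.snoc (n : ℕ) : Tens k A n ⊗[k] Red k A ≃ₗ[k] Tens k A (n + 1) :=
  (TensorProduct.congr (LinearEquiv.refl k _)
    (PiTensorProduct.subsingletonEquiv (R := k) (0 : Fin 1)).symm).trans TensorPower.mulEquiv

/-- The noncommutative differential `p`-forms `Ω^p(A) = A ⊗ Ā^{⊗ p}`. -/
def Forms (p : ℕ) : Type u := A ⊗[k] Tens k A p

namespace Forms

instance (p : ℕ) : AddCommGroup (Forms k A p) :=
  inferInstanceAs (AddCommGroup (A ⊗[k] Tens k A p))

instance (p : ℕ) : Module k (Forms k A p) :=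
  inferInstanceAs (Module k (A ⊗[k] Tens k A p))

/-- The left action `a (a₀ ⊗ ā₁ ⊗ ⋯ ⊗ āₚ) = a a₀ ⊗ ā₁ ⊗ ⋯ ⊗ āₚ`. -/
instance (p : ℕ) : Module A (Forms k A p) :=
  inferInstanceAs (Module A (A ⊗[k] Tens k A p))

instance (p : ℕ) : IsScalarTower k A (Forms k A p) :=
  inferInstanceAs (IsScalarTower k A (A ⊗[k] Tens k A p))

variable {k A}

/-- The form `a ⊗ x` with `a ∈ A` and `x ∈ Ā^{⊗ p}`. -/
def mk (p : ℕ) : A →ₗ[k] Tens k A p →ₗ[k] Forms k A p := TensorProduct.mk k A (Tens k A p)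

lemma smul_mk (p : ℕ) (a b : A) (x : Tens k A p) : a • mk p b x = mk p (a * b) x := rfl

/-- `Ω^p(A) ⊗ Ā ≅ Ω^{p+1}(A)`, `(a₀ ⊗ ā₁ ⊗ ⋯ ⊗ āₚ) ⊗ b̄ ↦ a₀ ⊗ ā₁ ⊗ ⋯ ⊗ āₚ ⊗ b̄`. -/
def snoc (p : ℕ) : Forms k A p ⊗[k] Red k A ≃ₗ[k] Forms k A (p + 1) :=
  (TensorProduct.assoc k A (Tens k A p) (Red k A)).trans
    (TensorProduct.congr (LinearEquiv.refl k A) (Tens.snoc k A p))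

lemma snoc_mk (p : ℕ) (a : A) (x : Tens k A p) (b : Red k A) :
    snoc p (mk p a x ⊗ₜ b) = mk (p + 1) a (Tens.snoc k A p (x ⊗ₜ b)) := rfl

lemma induction {p : ℕ} {C : Forms k A p → Prop} (y : Forms k A p)
    (hmk : ∀ a x, C (mk p a x)) (hadd : ∀ y z, C y → C z → C (y + z)) : C y :=
  TensorProduct.induction_on (motive := C) y
    (by have h := hmk 0 0; rw [map_zero] at h; exact h) hmk hadd

lemma smul_snoc (p : ℕ) (a : A) (y : Forms k A p) (b : Red k A) :
    a • snoc p (y ⊗ₜ b) = snoc p ((a • y) ⊗ₜ b) := by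
  induction y using Forms.induction with
  | hmk c x => simp only [snoc_mk, smul_mk]
  | hadd y z hy hz => simp only [add_tmul, map_add, smul_add, hy, hz]

/-- A linear map out of `Ω^{p+1}(A)`, given by a bilinear expression `C y c` in
`y ∈ Ω^p(A)` and `c ∈ A` which vanishes for `c = 1`: it sends `y ⊗ c̄` to `C y c`. -/
def liftSnoc {M : Type u} [AddCommGroup M] [Module k M] (p : ℕ)
    (C : Forms k A p →ₗ[k] A →ₗ[k] M) (hC : ∀ y, C y 1 = 0) : Forms k A (p + 1) →ₗ[k] M :=
  TensorProduct.lift ((Submodule.span k {(1 : A)}).liftQ C.flip (by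
    rw [Submodule.span_le, Set.singleton_subset_iff]
    exact LinearMap.ext hC)).flip ∘ₗ (snoc p).symm.toLinearMap

@[simp]
lemma liftSnoc_snoc {M : Type u} [AddCommGroup M] [Module k M] (p : ℕ)
    (C : Forms k A p →ₗ[k] A →ₗ[k] M) (hC : ∀ y, C y 1 = 0) (y : Forms k A p) (c : A) :
    liftSnoc p C hC (snoc p (y ⊗ₜ bar c)) = C y c := by
  simp [liftSnoc]

lemma induction_snoc {p : ℕ} {C : Forms k A (p + 1) → Prop} (y : Forms k A (p + 1))
    (hmk : ∀ y c, C (snoc p (y ⊗ₜ bar c))) (hadd : ∀ y z, C y → C z → C (y + z)) : C y := by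
  obtain ⟨y, rfl⟩ := (snoc p).surjective y
  induction y using TensorProduct.induction_on with
  | zero => simpa using hmk 0 0
  | tmul y c =>
    obtain ⟨c, rfl⟩ := Submodule.mkQ_surjective _ c
    exact hmk y c
  | add y z hy hz => rw [map_add]; exact hadd _ _ hy hz

/-- The trilinear expression `(y, c, a) ↦ y ⊗ (c a)‾ - (y ◂ c) ⊗ ā`, for a given right
multiplication `R y c = y ◂ c` on `Ω^p(A)`. -/
def rightActStep (p : ℕ) (R : Forms k A p →ₗ[k] A →ₗ[k] Forms k A p) :
    Forms k A p →ₗ[k] A →ₗ[k] A →ₗ[k] Forms k A (p + 1) :=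
  LinearMap.mk₂ k
    (fun y c =>
      (snoc p).toLinearMap ∘ₗ TensorProduct.mk k _ _ y ∘ₗ bar ∘ₗ LinearMap.mulLeft k c -
        (snoc p).toLinearMap ∘ₗ TensorProduct.mk k _ _ (R y c) ∘ₗ bar)
    (fun y z c => by
      ext a; simp only [LinearMap.sub_apply, LinearMap.add_apply, LinearMap.comp_apply,
        TensorProduct.mk_apply, map_add, LinearEquiv.coe_coe]; abel)
    (fun r y c => by
      ext a; simp only [LinearMap.sub_apply, LinearMap.smul_apply, LinearMap.comp_apply,
        TensorProduct.mk_apply, map_smul, LinearEquiv.coe_coe, smul_sub])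
    (fun y c d => by
      ext a; simp only [LinearMap.sub_apply, LinearMap.add_apply, LinearMap.comp_apply,
        TensorProduct.mk_apply, map_add, add_mul, LinearEquiv.coe_coe,
        LinearMap.mulLeft_apply]; abel)
    (fun r y c => by
      ext a; simp only [LinearMap.sub_apply, LinearMap.smul_apply, LinearMap.comp_apply,
        TensorProduct.mk_apply, map_smul, smul_mul_assoc,
        LinearEquiv.coe_coe, LinearMap.mulLeft_apply, smul_sub])

lemma rightActStep_apply (p : ℕ) (R : Forms k A p →ₗ[k] A →ₗ[k] Forms k A p)
    (y : Forms k A p) (c a : A) :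
    rightActStep p R y c a = snoc p (y ⊗ₜ bar (c * a)) - snoc p (R y c ⊗ₜ bar a) := rfl

lemma bar_one : (bar (1 : A) : Red k A) = 0 :=
  (Submodule.Quotient.mk_eq_zero _).2 (Submodule.mem_span_singleton_self _)

/-- The right action on `Ω⁰(A) = A ⊗ k` by multiplication on the factor `A`. -/
def rightActZero : Forms k A 0 →ₗ[k] A →ₗ[k] Forms k A 0 :=
  (LinearMap.rTensorHom (Tens k A 0) ∘ₗ (LinearMap.mul k A).flip).flip

lemma rightActZero_mk (a₀ a : A) (x : Tens k A 0) :
    rightActZero (mk 0 a₀ x) a = mk 0 (a₀ * a) x := rfl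

/-- The recursion behind the right action of `A` on `Ω^p(A)`, together with the fact that
`1` acts as the identity, which makes the recursion meaningful. -/
def rightActAux : ∀ p : ℕ, {R : Forms k A p →ₗ[k] A →ₗ[k] Forms k A p // ∀ y, R y 1 = y}
  | 0 => ⟨rightActZero, fun y => by
      induction y using Forms.induction with
      | hmk a x => rw [rightActZero_mk, mul_one]
      | hadd y z hy hz => rw [map_add, LinearMap.add_apply, hy, hz]⟩
  | p + 1 => ⟨liftSnoc p (rightActStep p (rightActAux p).1) (fun y => by
        ext a
        rw [rightActStep_apply, one_mul, (rightActAux p).2, sub_self, LinearMap.zero_apply]),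
      fun y => by
        induction y using Forms.induction_snoc with
        | hmk y c =>
          rw [liftSnoc_snoc, rightActStep_apply, mul_one, bar_one, tmul_zero, map_zero, sub_zero]
        | hadd y z hy hz => rw [map_add, LinearMap.add_apply, hy, hz]⟩

/-- The right action `y ◂ a` of `A` on `Ω^p(A)`:
`(a₀ ⊗ ā₁ ⊗ ⋯ ⊗ āₚ) ◂ a =
  ∑ᵢ (-1)^{p-i} a₀ ⊗ ā₁ ⊗ ⋯ ⊗ (aᵢ aᵢ₊₁)‾ ⊗ ⋯ ⊗ āₚ₊₁` with `aₚ₊₁ = a`.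
Isolating the term `i = p`, this is the recursion
`(y ⊗ c̄) ◂ a = y ⊗ (c a)‾ - (y ◂ c) ⊗ ā` with initial value `a₀ ◂ a = a₀ a`. -/
def rightAct (p : ℕ) : Forms k A p →ₗ[k] A →ₗ[k] Forms k A p := (rightActAux p).1

lemma rightAct_one (p : ℕ) (y : Forms k A p) : rightAct p y 1 = y := (rightActAux p).2 y

lemma rightAct_zero (a₀ a : A) (x : Tens k A 0) :
    rightAct 0 (mk 0 a₀ x) a = mk 0 (a₀ * a) x := rfl

lemma rightAct_snoc (p : ℕ) (y : Forms k A p) (c a : A) :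
    rightAct (p + 1) (snoc p (y ⊗ₜ bar c)) a =
      snoc p (y ⊗ₜ bar (c * a)) - snoc p (rightAct p y c ⊗ₜ bar a) := by
  change (rightActAux (p + 1)).1 _ _ = _
  rw [rightActAux, liftSnoc_snoc, rightActStep_apply]
  rfl

lemma rightAct_mul (p : ℕ) (y : Forms k A p) (a b : A) :
    rightAct p y (a * b) = rightAct p (rightAct p y a) b := by
  induction p generalizing a b with
  | zero =>
    induction y using Forms.induction with
    | hmk c x => simp only [rightAct_zero, mul_assoc]
    | hadd y z hy hz => simp only [map_add, LinearMap.add_apply, hy, hz]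
  | succ p ih =>
    induction y using Forms.induction_snoc with
    | hmk y c =>
      simp only [rightAct_snoc, map_sub, LinearMap.sub_apply, mul_assoc, ← ih]
      abel
    | hadd y z hy hz => simp only [map_add, LinearMap.add_apply, hy, hz]

lemma rightAct_smul (p : ℕ) (y : Forms k A p) (a b : A) :
    rightAct p (a • y) b = a • rightAct p y b := by
  induction p generalizing b with
  | zero =>
    induction y using Forms.induction with
    | hmk c x => simp only [rightAct_zero, smul_mk, mul_assoc]
    | hadd y z hy hz => simp only [map_add, LinearMap.add_apply, smul_add, hy, hz]
  | succ p ih =>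
    induction y using Forms.induction_snoc with
    | hmk y c => simp only [smul_snoc, rightAct_snoc, smul_sub, ih]
    | hadd y z hy hz => simp only [map_add, LinearMap.add_apply, smul_add, hy, hz]

instance (p : ℕ) : Module Aᵐᵒᵖ (Forms k A p) where
  smul a y := rightAct p y a.unop
  one_smul y := rightAct_one p y
  mul_smul a b y := by
    change rightAct p y (a * b).unop = rightAct p (rightAct p y b.unop) a.unop
    rw [MulOpposite.unop_mul, rightAct_mul]
  smul_zero a := by change rightAct p 0 a.unop = 0; simp
  smul_add a y z := by
    change rightAct p (y + z) a.unop = rightAct p y a.unop + rightAct p z a.unop; simp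
  add_smul a b y := by
    change rightAct p y (a + b).unop = rightAct p y a.unop + rightAct p y b.unop; simp
  zero_smul y := by change rightAct p y (0 : Aᵐᵒᵖ).unop = 0; simp

lemma op_smul_def (p : ℕ) (a : Aᵐᵒᵖ) (y : Forms k A p) : a • y = rightAct p y a.unop := rfl

instance (p : ℕ) : IsScalarTower k Aᵐᵒᵖ (Forms k A p) where
  smul_assoc r a y := by
    simp only [op_smul_def, MulOpposite.unop_smul, map_smul]

instance (p : ℕ) : SMulCommClass A Aᵐᵒᵖ (Forms k A p) where
  smul_comm a b y := (rightAct_smul p y a b.unop).symm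

/-- The identification `Ω^p(A) = Ω^q(A)` for `p = q`. -/
def castEq {p q : ℕ} (h : p = q) : Forms k A p ≃ₗ[k] Forms k A q :=
  TensorProduct.congr (LinearEquiv.refl k A) (TensorPower.cast k (Red k A) h)

@[simp]
lemma castEq_rfl {p : ℕ} (h : p = p) : castEq (k := k) (A := A) h = LinearEquiv.refl k _ := by
  ext y
  simp only [castEq, TensorPower.cast_refl, TensorProduct.congr_refl_refl]
  rfl

end Forms
end Forms

/-! ### Hochschild cochains with values in noncommutative differential forms -/

section Cochain

variable (k A : Type u) [Field k] [Ring A] [Algebra k A]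

/-- The `k`-linear maps `Ā^{⊗ n} → Ω^p(A)`: the Hochschild cochains of degree `n - p` with
coefficients in the graded bimodule `Ω^p(A)`, which is concentrated in degree `-p`. -/
abbrev Cochain (n p : ℕ) : Type u := Tens k A n →ₗ[k] Forms k A p

variable {k A}

namespace Cochain

/-- The left `A`-linear extension `A ⊗ Ā^{⊗ n} → Ω^p(A)`, `a ⊗ x ↦ a f(x)`, of a cochain. -/
def ext {n p : ℕ} (f : Cochain k A n p) : Forms k A n →ₗ[k] Forms k A p :=
  TensorProduct.lift ((Algebra.lsmul k k (Forms k A p)).toLinearMap.compl₂ f)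

lemma ext_mk {n p : ℕ} (f : Cochain k A n p) (a : A) (x : Tens k A n) :
    ext f (Forms.mk n a x) = a • f x := rfl

lemma ext_smul {n p : ℕ} (f : Cochain k A n p) (a : A) (y : Forms k A n) :
    ext f (a • y) = a • ext f y := by
  induction y using Forms.induction with
  | hmk b x => simp only [Forms.smul_mk, ext_mk, mul_smul]
  | hadd y z hy hz => simp only [smul_add, map_add, hy, hz]

lemma ext_unique {n p : ℕ} (f : Cochain k A n p) (g : Forms k A n →ₗ[k] Forms k A p)
    (hg : ∀ (a : A) y, g (a • y) = a • g y) (h : ∀ x, g (Forms.mk n 1 x) = f x) :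
    g = ext f := by
  refine LinearMap.ext fun y => ?_
  induction y using Forms.induction with
  | hmk b x => rw [ext_mk, ← h, ← hg, Forms.smul_mk, mul_one]
  | hadd y z hy hz => simp only [map_add, hy, hz]

lemma ext_one {n p : ℕ} (f : Cochain k A n p) (x : Tens k A n) :
    ext f (Forms.mk n 1 x) = f x := by rw [ext_mk, one_smul]

lemma ext_inj {n p : ℕ} {f g : Cochain k A n p} (h : ∀ y, ext f y = ext g y) : f = g :=
  LinearMap.ext fun x => by rw [← ext_one f, ← ext_one g, h]

@[simp]
lemma ext_add {n p : ℕ} (f g : Cochain k A n p) : ext (f + g) = ext f + ext g :=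
  (ext_unique _ _ (fun a y => by simp only [LinearMap.add_apply, ext_smul, smul_add])
    (fun x => by simp only [LinearMap.add_apply, ext_one])).symm

@[simp]
lemma ext_ksmul {n p : ℕ} (r : k) (f : Cochain k A n p) : ext (r • f) = r • ext f :=
  (ext_unique _ _ (fun a y => by rw [LinearMap.smul_apply, LinearMap.smul_apply, ext_smul, smul_comm])
    (fun x => by simp only [LinearMap.smul_apply, ext_one])).symm

/-- The inclusion `x ↦ 1 ⊗ x` of `Ā^{⊗ p}` in `Ω^p(A)`, a cochain of degree `0`. -/
def unit (p : ℕ) : Cochain k A p p := Forms.mk p 1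

@[simp]
lemma ext_unit (p : ℕ) : ext (unit (k := k) (A := A) p) = LinearMap.id :=
  (ext_unique _ _ (fun _ _ => rfl) (fun _ => rfl)).symm

/-- The map `(y, c) ↦ F(y) ◂ c - F(y ◂ c)`, where `F` is the left `A`-linear extension
of the cochain `f`. -/
def defect {n p : ℕ} (f : Cochain k A n p) : Forms k A n →ₗ[k] A →ₗ[k] Forms k A p :=
  Forms.rightAct p ∘ₗ ext f - (Forms.rightAct n).compr₂ (ext f)

lemma defect_apply {n p : ℕ} (f : Cochain k A n p) (y : Forms k A n) (c : A) :
    defect f y c = Forms.rightAct p (ext f y) c - ext f (Forms.rightAct n y c) := rfl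

lemma defect_one {n p : ℕ} (f : Cochain k A n p) (y : Forms k A n) : defect f y 1 = 0 := by
  rw [defect_apply, Forms.rightAct_one, Forms.rightAct_one, sub_self]

/-- The Hochschild differential of a cochain `f : Ā^{⊗ n} → Ω^p(A)` of degree `m = n - p`:
`(-1)^{m+1} δ(f)(ā₁, …, āₙ₊₁) = a₁ f(ā₂, …, āₙ₊₁)
  + ∑ᵢ (-1)^i f(ā₁, …, (aᵢ aᵢ₊₁)‾, …, āₙ₊₁) + (-1)^{n+1} f(ā₁, …, āₙ) ◂ aₙ₊₁`.
Since `∑_{i=0}^{n} (-1)^i a₀ ⊗ ⋯ ⊗ (aᵢ aᵢ₊₁)‾ ⊗ ⋯ ⊗ āₙ₊₁ = (-1)^n (a₀ ⊗ ⋯ ⊗ āₙ) ◂ aₙ₊₁`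
for `a₀ = 1`, and `(-1)^{m+1} (-1)^{n+1} = (-1)^p`, this says that
`δ(f)(x ⊗ c̄) = (-1)^p (f(x) ◂ c - F((1 ⊗ x) ◂ c))`, where `F` is the left `A`-linear
extension of `f`. -/
def delta {n p : ℕ} (f : Cochain k A n p) : Cochain k A (n + 1) p :=
  (-1 : k) ^ p • Forms.liftSnoc n (defect f) (defect_one f) ∘ₗ Forms.mk (n + 1) 1

lemma ext_delta {n p : ℕ} (f : Cochain k A n p) :
    ext (delta f) = (-1 : k) ^ p • Forms.liftSnoc n (defect f) (defect_one f) := by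
  refine (ext_unique _ _ (fun a y => ?_) fun _ => rfl).symm
  simp only [LinearMap.smul_apply]
  rw [smul_comm a]
  congr 1
  induction y using Forms.induction_snoc with
  | hmk y c =>
    simp only [Forms.smul_snoc, Forms.liftSnoc_snoc, defect_apply, ext_smul,
      Forms.rightAct_smul, smul_sub]
  | hadd y z hy hz => simp only [smul_add, map_add, hy, hz]

lemma ext_delta_snoc {n p : ℕ} (f : Cochain k A n p) (y : Forms k A n) (c : A) :
    ext (delta f) (Forms.snoc n (y ⊗ₜ bar c)) =
      (-1 : k) ^ p • (Forms.rightAct p (ext f y) c - ext f (Forms.rightAct n y c)) := by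
  rw [ext_delta, LinearMap.smul_apply, Forms.liftSnoc_snoc, defect_apply]

/-- Two cochains agree if their extensions agree on the forms `y ⊗ c̄`. -/
lemma ext_inj_snoc {n p : ℕ} {f g : Cochain k A (n + 1) p}
    (h : ∀ y c, ext f (Forms.snoc n (y ⊗ₜ bar c)) = ext g (Forms.snoc n (y ⊗ₜ bar c))) :
    f = g := by
  refine ext_inj fun y => ?_
  induction y using Forms.induction_snoc with
  | hmk y c => exact h y c
  | hadd y z hy hz => simp only [map_add, hy, hz]

lemma delta_add {n p : ℕ} (f g : Cochain k A n p) : delta (f + g) = delta f + delta g := by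
  refine ext_inj_snoc fun y c => ?_
  simp only [ext_add, LinearMap.add_apply, ext_delta_snoc, map_add, ← smul_add]
  congr 1
  abel

lemma delta_smul {n p : ℕ} (r : k) (f : Cochain k A n p) : delta (r • f) = r • delta f := by
  refine ext_inj_snoc fun y c => ?_
  simp only [ext_ksmul, LinearMap.smul_apply, ext_delta_snoc, map_smul, ← smul_sub]
  rw [smul_comm]

/-- The stabilization map `θ(f) = f ⊗ id : Ā^{⊗ n} ⊗ Ā → Ω^p(A) ⊗ Ā = Ω^{p+1}(A)`. -/
def theta {n p : ℕ} (f : Cochain k A n p) : Cochain k A (n + 1) (p + 1) :=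
  (Forms.snoc p).toLinearMap ∘ₗ f.rTensor (Red k A) ∘ₗ (Tens.snoc k A n).symm.toLinearMap

lemma theta_snoc {n p : ℕ} (f : Cochain k A n p) (x : Tens k A n) (b : Red k A) :
    theta f (Tens.snoc k A n (x ⊗ₜ b)) = Forms.snoc p (f x ⊗ₜ b) := by
  simp [theta]

lemma ext_theta_snoc {n p : ℕ} (f : Cochain k A n p) (y : Forms k A n) (b : Red k A) :
    ext (theta f) (Forms.snoc n (y ⊗ₜ b)) = Forms.snoc p (ext f y ⊗ₜ b) := by
  induction y using Forms.induction with
  | hmk a x => simp only [Forms.snoc_mk, ext_mk, theta_snoc, Forms.smul_snoc]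
  | hadd y z hy hz => simp only [add_tmul, map_add, hy, hz]

lemma theta_add {n p : ℕ} (f g : Cochain k A n p) : theta (f + g) = theta f + theta g := by
  simp only [theta, LinearMap.rTensor_add, LinearMap.add_comp, LinearMap.comp_add]

lemma theta_smul {n p : ℕ} (r : k) (f : Cochain k A n p) : theta (r • f) = r • theta f := by
  simp only [theta, LinearMap.rTensor_smul, LinearMap.smul_comp, LinearMap.comp_smul]

lemma delta_theta {n p : ℕ} (f : Cochain k A n p) : delta (theta f) = theta (delta f) := by
  refine ext_inj_snoc fun y c => ?_
  induction y using Forms.induction_snoc with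
  | hmk y b =>
    simp only [ext_delta_snoc, ext_theta_snoc, Forms.rightAct_snoc, map_sub, pow_succ,
      ← smul_tmul', map_smul, sub_tmul]
    rw [mul_neg_one, neg_smul, ← smul_neg]
    congr 1
    abel
  | hadd y z hy hz => simp only [map_add, add_tmul, hy, hz]

/-- The iterated stabilization map `θ^j(f) = f ⊗ id^{⊗ j}`. -/
def stab {n p : ℕ} (f : Cochain k A n p) : ∀ j : ℕ, Cochain k A (n + j) (p + j)
  | 0 => f
  | j + 1 => theta (stab f j)

lemma stab_zero {n p : ℕ} (f : Cochain k A n p) : stab f 0 = f := rfl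

lemma stab_succ {n p : ℕ} (f : Cochain k A n p) (j : ℕ) : stab f (j + 1) = theta (stab f j) := rfl

lemma stab_add {n p : ℕ} (f g : Cochain k A n p) (j : ℕ) :
    stab (f + g) j = stab f j + stab g j := by
  induction j with
  | zero => rfl
  | succ j ih => rw [stab_succ, ih, theta_add]; rfl

lemma stab_smul {n p : ℕ} (r : k) (f : Cochain k A n p) (j : ℕ) :
    stab (r • f) j = r • stab f j := by
  induction j with
  | zero => rfl
  | succ j ih => rw [stab_succ, ih, theta_smul]; rfl

/-- The identification `Hom(Ā^{⊗ n}, Ω^p(A)) = Hom(Ā^{⊗ n'}, Ω^{p'}(A))` for `n = n'`, `p = p'`. -/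
def castEq {n p n' p' : ℕ} (hn : n = n') (hp : p = p') :
    Cochain k A n p ≃ₗ[k] Cochain k A n' p' :=
  LinearEquiv.arrowCongr (TensorPower.cast k (Red k A) hn) (Forms.castEq hp)

@[simp]
lemma castEq_rfl {n p : ℕ} (hn : n = n) (hp : p = p) (f : Cochain k A n p) :
    castEq hn hp f = f := by
  refine LinearMap.ext fun x => ?_
  simp [castEq, LinearEquiv.arrowCongr_apply]

/-- The composition of the left `A`-linear extensions of two cochains. -/
def comp {l n n' p : ℕ} (h : n' = n) (f : Cochain k A n p) (g : Cochain k A l n') :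
    Cochain k A l p :=
  ext f ∘ₗ (Forms.castEq h).toLinearMap ∘ₗ g

/-- The cup product of `f : Ā^{⊗ m} → Ω^p(A)` and `g : Ā^{⊗ n} → Ω^q(A)`,
`f ∪ g = (μ ⊗ id^{⊗ (p+q)}) (id_A ⊗ f ⊗ id^{⊗ q}) (g ⊗ id^{⊗ m})`. -/
def cup {m n p q : ℕ} (f : Cochain k A m p) (g : Cochain k A n q) :
    Cochain k A (n + m) (p + q) :=
  comp (Nat.add_comm q m) (stab f q) (stab g m)

/-! Elementary properties of these operations. -/

lemma theta_castEq {n p n' p' : ℕ} (hn : n = n') (hp : p = p') (f : Cochain k A n p) :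
    theta (castEq hn hp f) = castEq (by rw [hn]) (by rw [hp]) (theta f) := by
  subst hn hp; simp

lemma stab_theta {n p : ℕ} (f : Cochain k A n p) (j : ℕ) :
    stab (theta f) j = castEq (by lia) (by lia) (theta (stab f j)) := by
  induction j with
  | zero => simp [stab_zero]
  | succ j ih => rw [stab_succ, ih, theta_castEq, stab_succ]

lemma delta_castEq {n p n' p' : ℕ} (hn : n = n') (hp : p = p') (f : Cochain k A n p) :
    delta (castEq hn hp f) = castEq (by rw [hn]) hp (delta f) := by
  subst hn hp; simp

lemma delta_stab {n p : ℕ} (f : Cochain k A n p) (j : ℕ) :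
    delta (stab f j) = castEq (by lia) rfl (stab (delta f) j) := by
  induction j with
  | zero => simp [stab_zero]
  | succ j ih => rw [stab_succ, delta_theta, ih, theta_castEq, stab_succ]

lemma ext_comp {l n p : ℕ} (f : Cochain k A n p) (g : Cochain k A l n) (y : Forms k A l) :
    ext (comp rfl f g) y = ext f (ext g y) := by
  have : ext f ∘ₗ ext g = ext (comp rfl f g) :=
    ext_unique _ _ (fun a y => by simp only [LinearMap.comp_apply, ext_smul])
      (fun x => by simp [comp, ext_one])
  rw [← this, LinearMap.comp_apply]

lemma comp_theta {l n n' p : ℕ} (h : n' = n) (f : Cochain k A n p) (g : Cochain k A l n')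
    (h' : n' + 1 = n + 1) : comp h' (theta f) (theta g) = theta (comp h f g) := by
  subst h
  refine ext_inj_snoc fun y c => ?_
  simp only [ext_comp, ext_theta_snoc]

lemma comp_castEq {l n n' p l₁ n₁ n₁' p₁ : ℕ} (hn : n = n₁) (hn' : n' = n₁') (hp : p = p₁)
    (hl : l = l₁) (h : n' = n) (h₁ : n₁' = n₁) (f : Cochain k A n p) (g : Cochain k A l n') :
    comp h₁ (castEq hn hp f) (castEq hl hn' g) = castEq hl hp (comp h f g) := by
  subst hn hn' hp hl; simp

lemma comp_castEq_left {l n n' p n₁ p₁ : ℕ} (hn : n = n₁) (hp : p = p₁)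
    (h₁ : n' = n₁) (f : Cochain k A n p) (g : Cochain k A l n') :
    comp h₁ (castEq hn hp f) g = castEq rfl hp (comp (h₁.trans hn.symm) f g) := by
  subst hn hp; simp

lemma comp_castEq_right {l n n' p l₁ n₁' : ℕ} (hn' : n' = n₁')
    (hl : l = l₁) (h₁ : n₁' = n) (f : Cochain k A n p) (g : Cochain k A l n') :
    comp h₁ f (castEq hl hn' g) = castEq hl rfl (comp (hn'.trans h₁) f g) := by
  subst hn' hl; simp

lemma delta_comp {l n n' p : ℕ} (h : n' = n) (f : Cochain k A n p) (g : Cochain k A l n')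
    (h' : n' + 1 = n + 1) :
    delta (comp h f g) = comp h' (delta f) (theta g) +
      (-1 : k) ^ (p + n) • comp h f (delta g) := by
  subst h
  refine ext_inj_snoc fun y c => ?_
  simp only [ext_add, ext_ksmul, LinearMap.add_apply, LinearMap.smul_apply, ext_comp,
    ext_theta_snoc, ext_delta_snoc, map_smul, map_sub, smul_smul]
  rw [pow_add, mul_assoc, ← mul_pow, neg_one_mul, neg_neg, one_pow, mul_one, ← smul_add]
  congr 1
  abel

lemma comp_add_left {l n n' p : ℕ} (h : n' = n) (f f' : Cochain k A n p)
    (g : Cochain k A l n') : comp h (f + f') g = comp h f g + comp h f' g := by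
  simp only [comp, ext_add, LinearMap.add_comp]

lemma comp_add_right {l n n' p : ℕ} (h : n' = n) (f : Cochain k A n p)
    (g g' : Cochain k A l n') : comp h f (g + g') = comp h f g + comp h f g' := by
  simp only [comp, LinearMap.comp_add]

lemma comp_smul_left {l n n' p : ℕ} (h : n' = n) (r : k) (f : Cochain k A n p)
    (g : Cochain k A l n') : comp h (r • f) g = r • comp h f g := by
  simp only [comp, ext_ksmul, LinearMap.smul_comp]

lemma comp_smul_right {l n n' p : ℕ} (h : n' = n) (r : k) (f : Cochain k A n p)
    (g : Cochain k A l n') : comp h f (r • g) = r • comp h f g := by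
  simp only [comp, LinearMap.comp_smul]

lemma cup_theta_left {m n p q : ℕ} (f : Cochain k A m p) (g : Cochain k A n q) :
    cup (theta f) g = castEq rfl (by lia) (theta (cup f g)) := by
  rw [cup, stab_theta, stab_succ, comp_castEq_left,
    comp_theta (Nat.add_comm q m)]
  rfl

lemma cup_theta_right {m n p q : ℕ} (f : Cochain k A m p) (g : Cochain k A n q) :
    cup f (theta g) = castEq (by lia) rfl (theta (cup f g)) := by
  rw [cup, stab_theta, stab_succ, comp_castEq_right,
    comp_theta (Nat.add_comm q m)]
  rfl

/-- The Leibniz rule `δ(f ∪ g) = δ(f) ∪ g + (-1)^{m-p} f ∪ δ(g)`. -/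
lemma delta_cup {m n p q : ℕ} (f : Cochain k A m p) (g : Cochain k A n q) :
    delta (cup f g) = cup (delta f) g +
      (-1 : k) ^ (m + p) • castEq (by lia) rfl (cup f (delta g)) := by
  rw [cup, delta_comp _ _ _ (by lia), delta_stab f, delta_stab g, comp_castEq_left,
    comp_castEq_right, castEq_rfl]
  have : (-1 : k) ^ (p + q + (m + q)) = (-1 : k) ^ (m + p) := by
    rw [show p + q + (m + q) = m + p + (q + q) by ring, pow_add, ← two_mul q, pow_mul]
    simp
  rw [this]
  rfl

end Cochain
end Cochain

/-! ### The singular Hochschild cochain complex -/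

section Singular

variable (k A : Type u) [Field k] [Ring A] [Algebra k A]

/-- The pairs `(n, p)` with `n = m + p`, indexing the non-zero terms
`C^m(A, Ω^p(A)) = Hom(Ā^{⊗ n}, Ω^p(A))` of the inductive system defining `C_sg^m(A, A)`.
They are ordered by `p` (equivalently, by `n`). -/
abbrev Idx (m : ℤ) : Type := {x : ℕ × ℕ // (x.1 : ℤ) = m + x.2}

instance (m : ℤ) : Nonempty (Idx m) :=
  ⟨⟨(m.toNat, (-m).toNat), by dsimp only; lia⟩⟩

instance (m : ℤ) : IsDirectedOrder (Idx m) where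
  directed := by
    rintro ⟨⟨n, p⟩, h⟩ ⟨⟨n', p'⟩, h'⟩
    dsimp only at h h'
    rcases le_total p p' with hp | hp
    · exact ⟨⟨(n', p'), h'⟩, Prod.mk_le_mk.2 ⟨by lia, hp⟩, le_refl _⟩
    · exact ⟨⟨(n, p), h⟩, le_refl _, Prod.mk_le_mk.2 ⟨by lia, hp⟩⟩

variable {k A} in
/-- The transition maps of the inductive system: the iterated stabilization maps. -/
def transition (m : ℤ) (i j : Idx m) (hij : i ≤ j) :
    Cochain k A i.1.1 i.1.2 →ₗ[k] Cochain k A j.1.1 j.1.2 where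
  toFun f := Cochain.castEq
    (by have := i.2; have := j.2; have h : i.1.2 ≤ j.1.2 := hij.2; lia)
    (by have h : i.1.2 ≤ j.1.2 := hij.2; lia)
    (Cochain.stab f (j.1.2 - i.1.2))
  map_add' f g := by rw [Cochain.stab_add, map_add]
  map_smul' r f := by rw [Cochain.stab_smul, map_smul, RingHom.id_apply]

/-- The degree `m` part `C_sg^m(A, A) = colim_p C^m(A, Ω^p(A))` of the singular Hochschild
cochain complex. -/
def Csg (m : ℤ) : Type u :=
  Module.DirectLimit (fun i : Idx m => Cochain k A i.1.1 i.1.2) (transition m)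

instance (m : ℤ) : AddCommGroup (Csg k A m) :=
  inferInstanceAs (AddCommGroup
    (Module.DirectLimit (fun i : Idx m => Cochain k A i.1.1 i.1.2) (transition m)))

instance (m : ℤ) : Module k (Csg k A m) :=
  inferInstanceAs (Module k
    (Module.DirectLimit (fun i : Idx m => Cochain k A i.1.1 i.1.2) (transition m)))

namespace Csg

variable {k A}

/-- The canonical map `C^m(A, Ω^p(A)) → C_sg^m(A, A)`. -/
def of {m : ℤ} {n p : ℕ} (h : (n : ℤ) = m + p) : Cochain k A n p →ₗ[k] Csg k A m :=
  Module.DirectLimit.of k (Idx m) (fun i : Idx m => Cochain k A i.1.1 i.1.2) (transition m)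
    ⟨(n, p), h⟩

lemma of_castEq {m : ℤ} {n p n' p' : ℕ} (hn : n = n') (hp : p = p') (h : (n' : ℤ) = m + p')
    (h' : (n : ℤ) = m + p) (f : Cochain k A n p) :
    of h (Cochain.castEq hn hp f) = of h' f := by
  subst hn hp; simp

lemma of_transition {m : ℤ} {i j : Idx m} (hij : i ≤ j) (f : Cochain k A i.1.1 i.1.2) :
    of (m := m) j.2 (transition m i j hij f) = of i.2 f :=
  Module.DirectLimit.of_f

lemma of_theta {m : ℤ} {n p : ℕ} (h : (n : ℤ) = m + p) (h' : ((n + 1 : ℕ) : ℤ) = m + (p + 1 : ℕ))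
    (f : Cochain k A n p) : of h' (Cochain.theta f) = of h f := by
  have hij : (⟨(n, p), h⟩ : Idx m) ≤ ⟨(n + 1, p + 1), h'⟩ :=
    Prod.mk_le_mk.2 ⟨Nat.le_succ _, Nat.le_succ _⟩
  rw [← of_transition hij f]
  have key : ∀ (d : ℕ) (hd : d = 1) (h₁ : n + d = n + 1) (h₂ : p + d = p + 1),
      Cochain.castEq h₁ h₂ (Cochain.stab f d) = Cochain.theta f := by
    rintro d rfl h₁ h₂
    rw [Cochain.castEq_rfl]
    rfl
  exact congrArg _ (key (p + 1 - p) (by lia) (by lia) (by lia)).symm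

lemma induction {m : ℤ} {C : Csg k A m → Prop} (x : Csg k A m)
    (hof : ∀ (n p : ℕ) (h : (n : ℤ) = m + p) (f : Cochain k A n p), C (of h f)) : C x :=
  Module.DirectLimit.induction_on x fun i f => hof i.1.1 i.1.2 i.2 f

/-- Maps out of `C_sg^m(A, A)`: linear maps on cochains which are compatible with the
identifications of indices and with the stabilization maps. -/
def lift {m : ℤ} {M : Type u} [AddCommGroup M] [Module k M]
    (F : ∀ (n p : ℕ), (n : ℤ) = m + p → (Cochain k A n p →ₗ[k] M))
    (hF : ∀ (n p : ℕ) (h : (n : ℤ) = m + p) (h' : ((n + 1 : ℕ) : ℤ) = m + (p + 1 : ℕ))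
      (f : Cochain k A n p), F (n + 1) (p + 1) h' (Cochain.theta f) = F n p h f) :
    Csg k A m →ₗ[k] M :=
  Module.DirectLimit.lift k (Idx m) _ (transition m) (fun i => F i.1.1 i.1.2 i.2) (by
    rintro ⟨⟨n, p⟩, h⟩ ⟨⟨n', p'⟩, h'⟩ hij f
    have key : ∀ (j : ℕ) (hn : n + j = n') (hp : p + j = p'),
        F n' p' h' (Cochain.castEq hn hp (Cochain.stab f j)) = F n p h f := by
      rintro j rfl rfl
      rw [Cochain.castEq_rfl]
      clear hij
      induction j with
      | zero => rfl
      | succ j ih =>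
        dsimp only at h h'
        rw [Cochain.stab_succ]
        exact (hF _ _ (by push_cast at h' ⊢; lia) h' _).trans (ih _)
    exact key _ _ _)

@[simp]
lemma lift_of {m : ℤ} {M : Type u} [AddCommGroup M] [Module k M]
    (F : ∀ (n p : ℕ), (n : ℤ) = m + p → (Cochain k A n p →ₗ[k] M))
    (hF : ∀ (n p : ℕ) (h : (n : ℤ) = m + p) (h' : ((n + 1 : ℕ) : ℤ) = m + (p + 1 : ℕ))
      (f : Cochain k A n p), F (n + 1) (p + 1) h' (Cochain.theta f) = F n p h f)
    {n p : ℕ} (h : (n : ℤ) = m + p) (f : Cochain k A n p) :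
    lift F hF (of h f) = F n p h f :=
  Module.DirectLimit.lift_of (f := transition m) (fun i : Idx m => F i.1.1 i.1.2 i.2) _ _

/-- The differential `C_sg^m(A, A) → C_sg^{m+1}(A, A)`, induced by the Hochschild
differentials. -/
def delta {m m' : ℤ} (hm : m + 1 = m') : Csg k A m →ₗ[k] Csg k A m' :=
  lift (fun n p h =>
    { toFun := fun f => of (m := m') (by push_cast; lia) (Cochain.delta f)
      map_add' := fun f g => by rw [Cochain.delta_add, map_add]
      map_smul' := fun r f => by rw [Cochain.delta_smul, map_smul, RingHom.id_apply] })
    (fun n p h h' f => by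
      change of _ (Cochain.delta (Cochain.theta f)) = of _ (Cochain.delta f)
      rw [Cochain.delta_theta, of_theta])

lemma delta_of {m m' : ℤ} (hm : m + 1 = m') {n p : ℕ} (h : (n : ℤ) = m + p)
    (h' : ((n + 1 : ℕ) : ℤ) = m' + p) (f : Cochain k A n p) :
    delta hm (of h f) = of h' (Cochain.delta f) := by
  rw [delta, lift_of]; rfl

/-- The cup product of a cochain with an element of `C_sg^b(A, A)`. -/
def cupAux {a b c : ℤ} (hc : a + b = c) {n p : ℕ} (h : (n : ℤ) = a + p) :
    Cochain k A n p →ₗ[k] Csg k A b →ₗ[k] Csg k A c :=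
  (lift (m := b) (M := Cochain k A n p →ₗ[k] Csg k A c) (fun n' q h' =>
    LinearMap.mk₂ k (fun (g : Cochain k A n' q) (f : Cochain k A n p) =>
        of (m := c) (by push_cast; lia) (Cochain.cup f g))
      (fun g g' f => by
        rw [Cochain.cup, Cochain.stab_add, Cochain.comp_add_right, map_add]; rfl)
      (fun r g f => by
        rw [Cochain.cup, Cochain.stab_smul, Cochain.comp_smul_right, map_smul]; rfl)
      (fun g f f' => by
        rw [Cochain.cup, Cochain.stab_add, Cochain.comp_add_left, map_add]; rfl)
      (fun r g f => by
        rw [Cochain.cup, Cochain.stab_smul, Cochain.comp_smul_left, map_smul]; rfl))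
    (fun n' q h₁ h₂ g => by
      refine LinearMap.ext fun f => ?_
      change of _ (Cochain.cup f (Cochain.theta g)) = of _ (Cochain.cup f g)
      rw [Cochain.cup_theta_right, of_castEq _ _ _ (by push_cast at h₂ ⊢; lia), of_theta])).flip

/-- The cup product `C_sg^a(A, A) ⊗ C_sg^b(A, A) → C_sg^{a+b}(A, A)`, induced by the cup
products of cochains. -/
def cup {a b c : ℤ} (hc : a + b = c) : Csg k A a →ₗ[k] Csg k A b →ₗ[k] Csg k A c :=
  lift (m := a) (M := Csg k A b →ₗ[k] Csg k A c) (fun n p h => cupAux hc h) (fun n p h h' f => by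
    refine LinearMap.ext fun y => ?_
    induction y using Csg.induction with
    | hof n' q h₁ g =>
      simp only [cupAux, LinearMap.flip_apply, lift_of, LinearMap.mk₂_apply]
      rw [Cochain.cup_theta_left, of_castEq _ _ _ (by push_cast at h' ⊢; lia), of_theta])

lemma cup_of {a b c : ℤ} (hc : a + b = c) {n p n' q : ℕ} (h : (n : ℤ) = a + p)
    (h' : (n' : ℤ) = b + q) (h'' : ((n' + n : ℕ) : ℤ) = c + (p + q : ℕ))
    (f : Cochain k A n p) (g : Cochain k A n' q) :
    cup hc (of h f) (of h' g) = of h'' (Cochain.cup f g) := by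
  simp only [cup, cupAux, LinearMap.flip_apply, lift_of, LinearMap.mk₂_apply]

/-- The Leibniz rule in `C_sg^*(A, A)`. -/
lemma delta_cup {a b c a' b' c' : ℤ} (hc : a + b = c) (ha : a + 1 = a') (hb : b + 1 = b')
    (hc' : c + 1 = c') (h₁ : a' + b = c') (h₂ : a + b' = c')
    (x : Csg k A a) (y : Csg k A b) :
    delta hc' (cup hc x y) =
      cup h₁ (delta ha x) y + ((a.negOnePow : ℤ) : k) • cup h₂ x (delta hb y) := by
  induction x using Csg.induction with
  | hof n p h f =>
  induction y using Csg.induction with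
  | hof n' q h' g =>
    have hs : (-1 : k) ^ (n + p) = ((a.negOnePow : ℤ) : k) := by
      have : a.negOnePow = ((n + p : ℕ) : ℤ).negOnePow := by
        rw [Int.negOnePow_eq_iff]
        exact ⟨-p, by push_cast; lia⟩
      rw [this, Int.negOnePow_def, zpow_natCast]
      push_cast
      rfl
    rw [cup_of hc h h' (by push_cast; lia), delta_of _ _ (by push_cast; lia), Cochain.delta_cup,
      map_add, map_smul, hs, of_castEq _ _ _ (by push_cast; lia),
      delta_of ha h (by push_cast; lia), delta_of hb h' (by push_cast; lia),
      cup_of h₁ _ _ (by push_cast; lia), cup_of h₂ _ _ (by push_cast; lia)]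

end Csg

end Singular

/-! ### Singular Hochschild cohomology -/

section Cohomology

variable (k A : Type u) [Field k] [Ring A] [Algebra k A]

/-- The cocycles of degree `m` of the singular Hochschild cochain complex. -/
def cocycles (m : ℤ) : Submodule k (Csg k A m) := LinearMap.ker (Csg.delta (m' := m + 1) rfl)

/-- The coboundaries of degree `m` of the singular Hochschild cochain complex. -/
def coboundaries (m : ℤ) : Submodule k (Csg k A m) :=
  LinearMap.range (Csg.delta (k := k) (A := A) (sub_add_cancel m 1))

/-- The singular Hochschild cohomology `HH_sg^m(A, A)`. -/
abbrev HHsg (m : ℤ) : Type u :=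
  cocycles k A m ⧸ (coboundaries k A m).comap (cocycles k A m).subtype

variable {k A}

lemma mem_cocycles {m m' : ℤ} (h : m + 1 = m') (x : Csg k A m) :
    x ∈ cocycles k A m ↔ Csg.delta h x = 0 := by
  subst h; rfl

lemma mem_coboundaries {m m' : ℤ} (h : m' + 1 = m) (x : Csg k A m) :
    x ∈ coboundaries k A m ↔ ∃ y : Csg k A m', Csg.delta h y = x := by
  obtain rfl : m' = m - 1 := by lia
  rfl

lemma Cochain.delta_unit (p : ℕ) : Cochain.delta (Cochain.unit (k := k) (A := A) p) = 0 := by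
  refine Cochain.ext_inj_snoc fun y c => ?_
  rw [Cochain.ext_delta_snoc, Cochain.ext_unit,
    show (0 : Cochain k A (p + 1) p) = (0 : k) • 0 by simp, Cochain.ext_ksmul]
  simp

namespace HHsg

/-- The class in `HH_sg^m(A, A)` of a Hochschild cocycle `f ∈ C^m(A, Ω^p(A))`. -/
def cls {m : ℤ} {n p : ℕ} (h : (n : ℤ) = m + p) (f : Cochain k A n p)
    (hf : Cochain.delta f = 0) : HHsg k A m :=
  Submodule.Quotient.mk ⟨Csg.of h f, by
    rw [mem_cocycles rfl, Csg.delta_of _ h (by push_cast; lia), hf, map_zero]⟩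

/-- The unit of singular Hochschild cohomology: the class of `1 ∈ A = C^0(A, A)`. -/
def one : HHsg k A 0 :=
  cls (n := 0) (p := 0) (by simp) (Cochain.unit 0) (Cochain.delta_unit 0)

lemma cup_mem_cocycles {a b c : ℤ} (hc : a + b = c) {x : Csg k A a} {y : Csg k A b}
    (hx : x ∈ cocycles k A a) (hy : y ∈ cocycles k A b) : Csg.cup hc x y ∈ cocycles k A c := by
  rw [mem_cocycles rfl] at hx hy ⊢
  rw [Csg.delta_cup hc rfl rfl rfl (by lia) (by lia), hx, hy]
  simp

/-- The cup product of cocycles. -/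
def cupCocycles {a b c : ℤ} (hc : a + b = c) :
    cocycles k A a →ₗ[k] cocycles k A b →ₗ[k] HHsg k A c :=
  LinearMap.mk₂ k
    (fun x y => Submodule.Quotient.mk ⟨Csg.cup hc x.1 y.1, cup_mem_cocycles hc x.2 y.2⟩)
    (fun x x' y => by
      rw [← Submodule.Quotient.mk_add]; congr 1; ext1
      simp only [Submodule.coe_add, map_add, LinearMap.add_apply])
    (fun r x y => by
      rw [← Submodule.Quotient.mk_smul]; congr 1; ext1
      simp only [Submodule.coe_smul, map_smul, LinearMap.smul_apply])
    (fun x y y' => by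
      rw [← Submodule.Quotient.mk_add]; congr 1; ext1
      simp only [Submodule.coe_add, map_add])
    (fun r x y => by
      rw [← Submodule.Quotient.mk_smul]; congr 1; ext1
      simp only [Submodule.coe_smul, map_smul])

/-- The cup product on singular Hochschild cohomology, `[x] ∪ [y] = [x ∪ y]`. -/
def cup {a b c : ℤ} (hc : a + b = c) : HHsg k A a →ₗ[k] HHsg k A b →ₗ[k] HHsg k A c :=
  Submodule.liftQ _
    (Submodule.liftQ _ (cupCocycles hc).flip (by
      rintro ⟨y, hy⟩ hy'
      obtain ⟨z, rfl⟩ := (mem_coboundaries (m' := b - 1) (by lia) y).1 hy'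
      refine LinearMap.ext fun x => (Submodule.Quotient.mk_eq_zero _).2 ?_
      refine (mem_coboundaries (m' := c - 1) (by lia) _).2
        ⟨((a.negOnePow : ℤ) : k) • Csg.cup (by lia) x.1 z, ?_⟩
      have hx := (mem_cocycles (m' := a + 1) rfl _).1 x.2
      rw [map_smul, Csg.delta_cup (a' := a + 1) (b' := b) (by lia) rfl (by lia) (by lia) (by lia)
        hc, hx, map_zero, LinearMap.zero_apply, zero_add, smul_smul, ← Int.cast_mul,
        ← Units.val_mul, Int.units_mul_self]
      simp)).flip (by
    rintro ⟨x, hx⟩ hx'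
    obtain ⟨z, rfl⟩ := (mem_coboundaries (m' := a - 1) (by lia) x).1 hx'
    refine LinearMap.ext fun y => ?_
    induction y using Submodule.Quotient.induction_on with
    | H y =>
    refine (Submodule.Quotient.mk_eq_zero _).2 ?_
    refine (mem_coboundaries (m' := c - 1) (by lia) _).2 ⟨Csg.cup (by lia) z y.1, ?_⟩
    have hy := (mem_cocycles (m' := b + 1) rfl _).1 y.2
    rw [Csg.delta_cup (a' := a) (b' := b + 1) (by lia) (by lia) rfl (by lia) hc (by lia), hy,
      map_zero, smul_zero, add_zero]
    rfl)

lemma cup_mk {a b c : ℤ} (hc : a + b = c) (x : cocycles k A a) (y : cocycles k A b) :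
    cup hc (Submodule.Quotient.mk x) (Submodule.Quotient.mk y) =
      Submodule.Quotient.mk ⟨Csg.cup hc x.1 y.1, cup_mem_cocycles hc x.2 y.2⟩ := rfl

end HHsg

end Cohomology

/-! ### The normalized bar resolution -/

section Bar

variable (k A : Type u) [Field k] [Ring A] [Algebra k A]

/-- The enveloping algebra `Aᵉ = A ⊗ A^op`. -/
abbrev Env : Type u := A ⊗[k] Aᵐᵒᵖ

/-- A bimodule on which `k` acts centrally is a left module over the enveloping algebra,
`(a ⊗ b) x = a x b`. -/
@[reducible]
def envModule (M : Type u) [AddCommGroup M] [Module k M] [Module A M] [Module Aᵐᵒᵖ M]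
    [IsScalarTower k A M] [IsScalarTower k Aᵐᵒᵖ M] [SMulCommClass A Aᵐᵒᵖ M] :
    Module (Env k A) M := TensorProduct.Algebra.module

section

attribute [local instance] envModule

variable {k A} in
lemma tmul_smul' {M : Type u} [AddCommGroup M] [Module k M] [Module A M] [Module Aᵐᵒᵖ M]
    [IsScalarTower k A M] [IsScalarTower k Aᵐᵒᵖ M] [SMulCommClass A Aᵐᵒᵖ M]
    (a : A) (b : Aᵐᵒᵖ) (x : M) : ((a ⊗ₜ b : Env k A) • x) = a • b • x := rfl

variable {k A} in
/-- A bimodule map between `A`-bimodules, as a map of left modules over the enveloping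
algebra. -/
def bimodMap {M N : Type u} [AddCommGroup M] [AddCommGroup N] [Module k M] [Module k N]
    [Module A M] [Module A N] [Module Aᵐᵒᵖ M] [Module Aᵐᵒᵖ N]
    [IsScalarTower k A M] [IsScalarTower k A N] [IsScalarTower k Aᵐᵒᵖ M] [IsScalarTower k Aᵐᵒᵖ N]
    [SMulCommClass A Aᵐᵒᵖ M] [SMulCommClass A Aᵐᵒᵖ N] (f : M →ₗ[k] N)
    (hl : ∀ (a : A) y, f (a • y) = a • f y) (hr : ∀ (a : Aᵐᵒᵖ) y, f (a • y) = a • f y) :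
    M →ₗ[Env k A] N where
  toFun := f
  map_add' := f.map_add
  map_smul' x y := by
    induction x using TensorProduct.induction_on with
    | zero =>
      exact ((congrArg f (zero_smul (Env k A) y)).trans f.map_zero).trans
        (zero_smul (Env k A) (f y)).symm
    | tmul a b => rw [RingHom.id_apply, tmul_smul', tmul_smul', hl, hr]
    | add x x' hx hx' => simp only [add_smul, map_add, hx, hx', RingHom.id_apply]

end

instance : Module (Env k A) A := envModule k A A

instance (p : ℕ) : Module (Env k A) (Forms k A p) := envModule k A _

/-- The terms `Bar_n(A) = A ⊗ Ā^{⊗ n} ⊗ A` of the normalized bar resolution. -/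
def BarTerm (n : ℕ) : Type u := Forms k A n ⊗[k] A

namespace BarTerm

instance (n : ℕ) : AddCommGroup (BarTerm k A n) :=
  inferInstanceAs (AddCommGroup (Forms k A n ⊗[k] A))

instance (n : ℕ) : Module k (BarTerm k A n) :=
  inferInstanceAs (Module k (Forms k A n ⊗[k] A))

/-- The left action `a (y ⊗ b) = a y ⊗ b`. -/
instance (n : ℕ) : Module A (BarTerm k A n) :=
  inferInstanceAs (Module A (Forms k A n ⊗[k] A))

instance (n : ℕ) : IsScalarTower k A (BarTerm k A n) :=
  inferInstanceAs (IsScalarTower k A (Forms k A n ⊗[k] A))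

variable {k A}

/-- The element `y ⊗ b` with `y ∈ A ⊗ Ā^{⊗ n} = Ω^n(A)` and `b ∈ A`. -/
def mk (n : ℕ) : Forms k A n →ₗ[k] A →ₗ[k] BarTerm k A n := TensorProduct.mk k (Forms k A n) A

lemma induction {n : ℕ} {C : BarTerm k A n → Prop} (y : BarTerm k A n)
    (hmk : ∀ x b, C (mk n x b)) (hadd : ∀ y z, C y → C z → C (y + z)) : C y :=
  TensorProduct.induction_on (motive := C) y
    (by have h := hmk 0 0; rw [map_zero] at h; exact h) hmk hadd

lemma smul_mk (n : ℕ) (a : A) (y : Forms k A n) (b : A) : a • mk n y b = mk n (a • y) b := rfl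

/-- The linear map out of `Bar_n(A)` given by a bilinear expression. -/
def lift {M : Type u} [AddCommGroup M] [Module k M] {n : ℕ}
    (F : Forms k A n →ₗ[k] A →ₗ[k] M) : BarTerm k A n →ₗ[k] M := TensorProduct.lift F

@[simp]
lemma lift_mk {M : Type u} [AddCommGroup M] [Module k M] {n : ℕ}
    (F : Forms k A n →ₗ[k] A →ₗ[k] M) (y : Forms k A n) (b : A) : lift F (mk n y b) = F y b := rfl

/-- The right multiplication `(y ⊗ b) a = y ⊗ b a`. -/
def rightMul (n : ℕ) : A →ₗ[k] BarTerm k A n →ₗ[k] BarTerm k A n :=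
  LinearMap.lTensorHom (Forms k A n) ∘ₗ (LinearMap.mul k A).flip

lemma rightMul_mk (n : ℕ) (a : A) (y : Forms k A n) (b : A) :
    rightMul n a (mk n y b) = mk n y (b * a) := rfl

/-- The right action `(y ⊗ b) a = y ⊗ b a`. -/
instance (n : ℕ) : Module Aᵐᵒᵖ (BarTerm k A n) where
  smul a y := rightMul n a.unop y
  one_smul y := by
    change rightMul n 1 y = y
    induction y using BarTerm.induction with
    | hmk y b => rw [rightMul_mk, mul_one]
    | hadd y z hy hz => rw [map_add, hy, hz]
  mul_smul a a' y := by
    change rightMul n (a'.unop * a.unop) y = rightMul n a.unop (rightMul n a'.unop y)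
    induction y using BarTerm.induction with
    | hmk y b => simp only [rightMul_mk, mul_assoc]
    | hadd y z hy hz => simp only [map_add, hy, hz]
  smul_zero a := map_zero _
  smul_add a y z := map_add _ _ _
  add_smul a b y := by
    change rightMul n (a.unop + b.unop) y = rightMul n a.unop y + rightMul n b.unop y; simp
  zero_smul y := by change rightMul n 0 y = 0; simp

lemma op_smul_def (n : ℕ) (a : Aᵐᵒᵖ) (y : BarTerm k A n) : a • y = rightMul n a.unop y := rfl

lemma op_smul_mk (n : ℕ) (a : Aᵐᵒᵖ) (y : Forms k A n) (b : A) :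
    a • mk n y b = mk n y (b * a.unop) := rfl

instance (n : ℕ) : IsScalarTower k Aᵐᵒᵖ (BarTerm k A n) where
  smul_assoc r a y := by
    simp only [op_smul_def, MulOpposite.unop_smul, map_smul, LinearMap.smul_apply]

instance (n : ℕ) : SMulCommClass A Aᵐᵒᵖ (BarTerm k A n) where
  smul_comm a b y := by
    induction y using BarTerm.induction with
    | hmk y c => simp only [smul_mk, op_smul_mk]
    | hadd y z hy hz => simp only [smul_add, hy, hz]

/-- The differential `Bar_{n+1}(A) → Bar_n(A)`,
`a₀ ⊗ ā₁ ⊗ ⋯ ⊗ āₙ₊₁ ⊗ aₙ₊₂ ↦ ∑ᵢ (-1)^i a₀ ⊗ ⋯ ⊗ (aᵢ aᵢ₊₁)‾ ⊗ ⋯ ⊗ aₙ₊₂`. Isolating the term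
`i = n + 1`, this says
`(y ⊗ c̄) ⊗ a ↦ (-1)^{n+1} (y ⊗ c a - (y ◂ c) ⊗ a)` for `y ∈ A ⊗ Ā^{⊗ n}`. -/
def d (n : ℕ) : BarTerm k A (n + 1) →ₗ[k] BarTerm k A n :=
  (-1 : k) ^ (n + 1) • lift (Forms.liftSnoc n
    (LinearMap.mk₂ k (fun y c => mk n y ∘ₗ LinearMap.mulLeft k c - mk n (Forms.rightAct n y c))
      (fun y z c => by
        ext a; simp only [LinearMap.sub_apply, LinearMap.add_apply, LinearMap.comp_apply,
          map_add]; abel)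
      (fun r y c => by
        ext a; simp only [LinearMap.sub_apply, LinearMap.smul_apply, LinearMap.comp_apply,
          map_smul, smul_sub])
      (fun y c d => by
        ext a; simp only [LinearMap.sub_apply, LinearMap.add_apply, LinearMap.comp_apply,
          map_add, add_mul, LinearMap.mulLeft_apply]; abel)
      (fun r y c => by
        ext a; simp only [LinearMap.sub_apply, LinearMap.smul_apply, LinearMap.comp_apply,
          map_smul, smul_mul_assoc, LinearMap.mulLeft_apply, smul_sub]))
    (fun y => by
      ext a
      simp [Forms.rightAct_one]))

lemma d_mk (n : ℕ) (y : Forms k A n) (c a : A) :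
    d n (mk (n + 1) (Forms.snoc n (y ⊗ₜ bar c)) a) =
      (-1 : k) ^ (n + 1) • (mk n y (c * a) - mk n (Forms.rightAct n y c) a) := by
  rw [d, LinearMap.smul_apply, lift_mk, Forms.liftSnoc_snoc]
  rfl

lemma induction_snoc {n : ℕ} {C : BarTerm k A (n + 1) → Prop} (y : BarTerm k A (n + 1))
    (hmk : ∀ y c b, C (mk (n + 1) (Forms.snoc n (y ⊗ₜ bar c)) b))
    (hadd : ∀ y z, C y → C z → C (y + z)) : C y := by
  induction y using BarTerm.induction with
  | hmk y b =>
    induction y using Forms.induction_snoc with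
    | hmk y c => exact hmk y c b
    | hadd y z hy hz => rw [map_add, LinearMap.add_apply]; exact hadd _ _ hy hz
  | hadd y z hy hz => exact hadd _ _ hy hz

lemma d_d (n : ℕ) (y : BarTerm k A (n + 1 + 1)) : d n (d (n + 1) y) = 0 := by
  induction y using BarTerm.induction_snoc with
  | hmk y c b =>
    induction y using Forms.induction_snoc with
    | hmk y c' =>
      rw [d_mk, map_smul, map_sub, d_mk, Forms.rightAct_snoc, map_sub, LinearMap.sub_apply,
        map_sub, d_mk, d_mk]
      simp only [Forms.rightAct_mul, mul_assoc, ← smul_sub]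
      simp
    | hadd y z hy hz =>
      rw [add_tmul, map_add, map_add, LinearMap.add_apply, map_add, map_add, hy, hz, add_zero]
  | hadd y z hy hz => rw [map_add, map_add, hy, hz, add_zero]

lemma d_smul (n : ℕ) (a : A) (y : BarTerm k A (n + 1)) : d n (a • y) = a • d n y := by
  induction y using BarTerm.induction_snoc with
  | hmk y c b =>
    rw [smul_mk, Forms.smul_snoc, d_mk, d_mk, smul_comm a, smul_sub a, smul_mk, smul_mk,
      Forms.rightAct_smul]
  | hadd y z hy hz => simp only [smul_add, map_add, hy, hz]

lemma d_op_smul (n : ℕ) (a : Aᵐᵒᵖ) (y : BarTerm k A (n + 1)) : d n (a • y) = a • d n y := by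
  induction y using BarTerm.induction_snoc with
  | hmk y c b =>
    rw [op_smul_mk, d_mk, d_mk, smul_comm a, smul_sub a, op_smul_mk, op_smul_mk, mul_assoc]
  | hadd y z hy hz => simp only [smul_add, map_add, hy, hz]

instance (n : ℕ) : Module (Env k A) (BarTerm k A n) := envModule k A _

/-- The augmentation `Bar_0(A) = A ⊗ A → A`, the multiplication of `A`. -/
def aug : BarTerm k A 0 →ₗ[k] A :=
  lift (LinearMap.mul k A ∘ₗ (TensorProduct.rid k A).toLinearMap ∘ₗ
    (TensorPower.algebraMap₀ (R := k) (M := Red k A)).symm.toLinearMap.lTensor A)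

lemma aug_mk (a b : A) (r : k) :
    aug (mk 0 (Forms.mk 0 a (TensorPower.algebraMap₀ r)) b) = r • (a * b) := by
  rw [aug, lift_mk]
  change (TensorProduct.rid k A) (a ⊗ₜ (TensorPower.algebraMap₀ (R := k) (M := Red k A)).symm
    (TensorPower.algebraMap₀ r)) * b = _
  rw [LinearEquiv.symm_apply_apply, TensorProduct.rid_tmul, smul_mul_assoc]

lemma induction_zero {C : BarTerm k A 0 → Prop} (y : BarTerm k A 0)
    (hmk : ∀ (a b : A), C (mk 0 (Forms.mk 0 a (TensorPower.algebraMap₀ (1 : k))) b))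
    (hadd : ∀ y z, C y → C z → C (y + z)) : C y := by
  induction y using BarTerm.induction with
  | hmk y b =>
    induction y using Forms.induction with
    | hmk a x =>
      obtain ⟨r, rfl⟩ := (TensorPower.algebraMap₀ (R := k) (M := Red k A)).surjective x
      have : (TensorPower.algebraMap₀ r : Tens k A 0) =
          r • (TensorPower.algebraMap₀ (1 : k) : Tens k A 0) := by
        rw [← map_smul, smul_eq_mul, mul_one]
      rw [this, map_smul, ← LinearMap.smul_apply, ← map_smul]
      exact hmk (r • a) b
    | hadd y z hy hz => rw [map_add, LinearMap.add_apply]; exact hadd _ _ hy hz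
  | hadd y z hy hz => exact hadd _ _ hy hz

lemma aug_one (a b : A) :
    aug (mk 0 (Forms.mk 0 a (TensorPower.algebraMap₀ (1 : k))) b) = a * b := by
  rw [aug_mk, one_smul]

lemma aug_smul (a : A) (y : BarTerm k A 0) : aug (a • y) = a • aug y := by
  induction y using BarTerm.induction_zero with
  | hmk c b => rw [smul_mk, Forms.smul_mk, aug_one, aug_one, smul_eq_mul, mul_assoc]
  | hadd y z hy hz => simp only [smul_add, map_add, hy, hz]

lemma aug_op_smul (a : Aᵐᵒᵖ) (y : BarTerm k A 0) : aug (a • y) = a • aug y := by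
  induction y using BarTerm.induction_zero with
  | hmk c b => rw [op_smul_mk, aug_one, aug_one, MulOpposite.smul_eq_mul_unop, mul_assoc]
  | hadd y z hy hz => simp only [smul_add, map_add, hy, hz]

lemma aug_d (y : BarTerm k A 1) : aug (d 0 y) = 0 := by
  induction y using BarTerm.induction_snoc with
  | hmk y c b =>
    induction y using Forms.induction with
    | hmk a x =>
      obtain ⟨r, rfl⟩ := (TensorPower.algebraMap₀ (R := k) (M := Red k A)).surjective x
      rw [d_mk, map_smul, map_sub, Forms.rightAct_zero, aug_mk, aug_mk, mul_assoc, sub_self,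
        smul_zero]
    | hadd y z hy hz =>
      rw [add_tmul, map_add, map_add, LinearMap.add_apply, map_add, map_add, hy, hz, add_zero]
  | hadd y z hy hz => rw [map_add, map_add, hy, hz, add_zero]

/-- For a cochain `f : Ā^{⊗ n} → Ω^p(A)`, the map
`Bar_n(A) = A ⊗ Ā^{⊗ n} ⊗ A → Ω^p(A)`, `a ⊗ x ⊗ b ↦ a f(x) ◂ b`. -/
def ofCochain {n p : ℕ} (f : Cochain k A n p) : BarTerm k A n →ₗ[k] Forms k A p :=
  lift (Forms.rightAct p ∘ₗ Cochain.ext f)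

lemma ofCochain_mk {n p : ℕ} (f : Cochain k A n p) (y : Forms k A n) (b : A) :
    ofCochain f (mk n y b) = Forms.rightAct p (Cochain.ext f y) b := rfl

lemma ofCochain_smul {n p : ℕ} (f : Cochain k A n p) (a : A) (y : BarTerm k A n) :
    ofCochain f (a • y) = a • ofCochain f y := by
  induction y using BarTerm.induction with
  | hmk y b => rw [smul_mk, ofCochain_mk, ofCochain_mk, Cochain.ext_smul, Forms.rightAct_smul]
  | hadd y z hy hz => simp only [smul_add, map_add, hy, hz]

lemma ofCochain_op_smul {n p : ℕ} (f : Cochain k A n p) (a : Aᵐᵒᵖ) (y : BarTerm k A n) :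
    ofCochain f (a • y) = a • ofCochain f y := by
  induction y using BarTerm.induction with
  | hmk y b =>
    rw [op_smul_mk, ofCochain_mk, ofCochain_mk, Forms.op_smul_def, Forms.rightAct_mul]
  | hadd y z hy hz => simp only [smul_add, map_add, hy, hz]

lemma ofCochain_d {n p : ℕ} (f : Cochain k A n p) (hf : Cochain.delta f = 0)
    (y : BarTerm k A (n + 1)) : ofCochain f (d n y) = 0 := by
  induction y using BarTerm.induction_snoc with
  | hmk y c b =>
    have h := Cochain.ext_delta_snoc f y c
    have h0 : Cochain.ext (Cochain.delta f) = 0 :=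
      (Cochain.ext_unique _ _ (by simp) (by simp [hf])).symm
    rw [h0, LinearMap.zero_apply, eq_comm, smul_eq_zero_iff_right (by simp), sub_eq_zero] at h
    rw [d_mk, map_smul, map_sub, ofCochain_mk, ofCochain_mk, Forms.rightAct_mul, h, sub_self,
      smul_zero]
  | hadd y z hy hz => rw [map_add, map_add, hy, hz, add_zero]

end BarTerm

/-- The normalized bar resolution of `A`, in non-negative homological degrees. -/
def barChain : ChainComplex (ModuleCat.{u} (Env k A)) ℕ :=
  ChainComplex.of (fun n => ModuleCat.of (Env k A) (BarTerm k A n))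
    (fun n => ModuleCat.ofHom (bimodMap (BarTerm.d n) (BarTerm.d_smul n) (BarTerm.d_op_smul n)))
    (fun n => by
      ext y
      exact BarTerm.d_d n y)

lemma barChain_d (n : ℕ) : (barChain k A).d (n + 1) n =
    ModuleCat.ofHom (bimodMap (BarTerm.d n) (BarTerm.d_smul n) (BarTerm.d_op_smul n)) :=
  ChainComplex.of_d (fun n => ModuleCat.of (Env k A) (BarTerm k A n))
    (fun n => ModuleCat.ofHom (bimodMap (BarTerm.d n) (BarTerm.d_smul n) (BarTerm.d_op_smul n))) n

/-- The normalized bar resolution of `A`, as a cochain complex in non-positive degrees: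
`Bar_n(A)` sits in degree `-n`. -/
def barCochain : CochainComplex (ModuleCat.{u} (Env k A)) ℤ :=
  (barChain k A).extend ComplexShape.embeddingDownNat

/-- The terms of `barCochain k A`. -/
def barCochainXIso (n : ℕ) (i : ℤ) (h : i = -n) :
    (barCochain k A).X i ≅ ModuleCat.of (Env k A) (BarTerm k A n) :=
  (barChain k A).extendXIso _ (by simp [h])

lemma barCochain_d (n : ℕ) (i j : ℤ) (hi : i = -(n + 1 : ℕ)) (hj : j = -n) :
    (barCochain k A).d i j = (barCochainXIso k A (n + 1) i hi).hom ≫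
      ModuleCat.ofHom (bimodMap (BarTerm.d n) (BarTerm.d_smul n) (BarTerm.d_op_smul n)) ≫
        (barCochainXIso k A n j hj).inv := by
  have := (barChain k A).extend_d_eq ComplexShape.embeddingDownNat (i := n + 1) (j := n)
    (i' := i) (j' := j) (by simp [hi]) (by simp [hj])
  rw [barChain_d] at this
  exact this

variable {k A}

/-- For a cocycle `f : Ā^{⊗ n} → Ω^p(A)`, the map of complexes from the normalized bar
resolution to `Ω^p(A)`, placed in degree `-n`, given by
`Bar_n(A) → Ω^p(A)`, `a ⊗ x ⊗ b ↦ a f(x) ◂ b`. -/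
def barMap {n p : ℕ} (f : Cochain k A n p) (hf : Cochain.delta f = 0) :
    barCochain k A ⟶ (CochainComplex.singleFunctor (ModuleCat.{u} (Env k A)) (-n)).obj
      (ModuleCat.of (Env k A) (Forms k A p)) :=
  HomologicalComplex.mkHomToSingle ((barCochainXIso k A n (-n) rfl).hom ≫
    ModuleCat.ofHom (bimodMap (BarTerm.ofCochain f) (BarTerm.ofCochain_smul f)
      (BarTerm.ofCochain_op_smul f))) (by
    intro i hi
    rw [barCochain_d k A n i (-n) (by simp at hi; lia) rfl]
    simp only [Category.assoc, Iso.inv_hom_id_assoc]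
    rw [Preadditive.IsIso.comp_left_eq_zero]
    ext y
    exact BarTerm.ofCochain_d f hf y)

variable (k A)

/-- The augmentation of the normalized bar resolution, given by the multiplication
`Bar_0(A) = A ⊗ A → A`. -/
def barAug : barCochain k A ⟶ (CochainComplex.singleFunctor (ModuleCat.{u} (Env k A)) 0).obj
      (ModuleCat.of (Env k A) A) :=
  HomologicalComplex.mkHomToSingle ((barCochainXIso k A 0 0 (by simp)).hom ≫
    ModuleCat.ofHom (bimodMap BarTerm.aug BarTerm.aug_smul BarTerm.aug_op_smul)) (by
    intro i hi
    rw [barCochain_d k A 0 i 0 (by simp at hi; lia) (by simp)]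
    simp only [Category.assoc, Iso.inv_hom_id_assoc]
    rw [Preadditive.IsIso.comp_left_eq_zero]
    ext y
    exact BarTerm.aug_d y)

end Bar
/-! ### Singularity categories -/

section Dsg

attribute [local instance] HasDerivedCategory.standard

open DerivedCategory Pretriangulated ZeroObject

variable (R : Type u) [Ring R] [IsNoetherianRing R]

/-- The perfect complexes: the objects of the derived category of finitely generated
`R`-modules which are isomorphic to a bounded complex of finitely generated projective
modules. -/
def perf : ObjectProperty (DerivedCategory (FGModuleCat.{u} R)) := fun X =>
  ∃ (K : CochainComplex (FGModuleCat.{u} R) ℤ) (a b : ℤ), K.IsStrictlyGE a ∧ K.IsStrictlyLE b ∧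
    (∀ i, Module.Projective R (K.X i)) ∧ Nonempty (X ≅ Q.obj K)

variable {R}

lemma projective_of_module_projective (P : FGModuleCat.{u} R) [Module.Projective R P] :
    Projective P where
  factors {E X} f e _ := by
    have he : Function.Surjective e.hom.hom := by
      have : Epi ((forget₂ (FGModuleCat.{u} R) (ModuleCat.{u} R)).map e) := inferInstance
      exact (ModuleCat.epi_iff_surjective _).1 this
    obtain ⟨g, hg⟩ := Module.projective_lifting_property e.hom.hom f.hom.hom he
    exact ⟨FGModuleCat.ofHom g, FGModuleCat.hom_ext hg⟩

instance : (perf R).IsClosedUnderIsomorphisms where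
  of_iso := by
    rintro X Y e ⟨K, a, b, ha, hb, hK, ⟨e'⟩⟩
    exact ⟨K, a, b, ha, hb, hK, ⟨e.symm ≪≫ e'⟩⟩

instance : (perf R).ContainsZero where
  exists_zero := by
    refine ⟨Q.obj 0, Q.map_isZero (Limits.isZero_zero _), 0, 0, 0, ?_, ?_, ?_, ⟨Iso.refl _⟩⟩
    · rw [CochainComplex.isStrictlyGE_iff]
      exact fun i _ => (HomologicalComplex.eval _ _ i).map_isZero (Limits.isZero_zero _)
    · rw [CochainComplex.isStrictlyLE_iff]
      exact fun i _ => (HomologicalComplex.eval _ _ i).map_isZero (Limits.isZero_zero _)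
    · intro i
      have h : Limits.IsZero ((0 : CochainComplex (FGModuleCat.{u} R) ℤ).X i) :=
        (HomologicalComplex.eval _ _ i).map_isZero (Limits.isZero_zero _)
      have : Subsingleton ((0 : CochainComplex (FGModuleCat.{u} R) ℤ).X i) :=
        ModuleCat.subsingleton_of_isZero
          ((forget₂ (FGModuleCat.{u} R) (ModuleCat.{u} R)).map_isZero h)
      infer_instance

instance : (perf R).IsStableUnderShift ℤ where
  isStableUnderShiftBy n :=
    { le_shift := by
        rintro X ⟨K, a, b, ha, hb, hK, ⟨e⟩⟩
        exact ⟨(shiftFunctor _ n).obj K, a - n, b - n,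
          K.isStrictlyGE_shift a n _ (by lia), K.isStrictlyLE_shift b n _ (by lia),
          fun i => hK _, ⟨(shiftFunctor _ n).mapIso e ≪≫ (Q.commShiftIso n).symm.app K⟩⟩ }

lemma mappingCone_projective {K L : CochainComplex (FGModuleCat.{u} R) ℤ} (f : K ⟶ L)
    (hK : ∀ i, Module.Projective R (K.X i)) (hL : ∀ i, Module.Projective R (L.X i)) (i : ℤ) :
    Module.Projective R ((CochainComplex.mappingCone f).X i) := by
  have := hK (i + 1)
  have := hL i
  have h := CochainComplex.mappingCone.id_X f i (i + 1) rfl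
  let F := ((CochainComplex.mappingCone.fst f).1.v i (i + 1) rfl).hom.hom
  let G := ((CochainComplex.mappingCone.snd f).v i i (add_zero i)).hom.hom
  let I := ((CochainComplex.mappingCone.inl f).v (i + 1) i (by lia)).hom.hom
  let J := ((CochainComplex.mappingCone.inr f).f i).hom.hom
  refine Module.Projective.of_split (M := K.X (i + 1) × L.X i) (F.prod G) (I.coprod J) ?_
  refine LinearMap.ext fun x => ?_
  exact congrArg (fun (t : (CochainComplex.mappingCone f).X i ⟶ _) => t.hom.hom x) h

instance : (perf R).IsTriangulatedClosed₃ := .mk' (by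
  rintro T hT ⟨K, a, b, ha, hb, hK, ⟨e⟩⟩ ⟨L, a', b', ha', hb', hL, ⟨e'⟩⟩
  have hK' (i : ℤ) : Projective (K.X i) := by
    have := hK i
    exact projective_of_module_projective _
  have := K.isKProjective_of_projective b
  obtain ⟨f, hf⟩ := (CochainComplex.IsKProjective.Qh_map_bijective K
    ((HomotopyCategory.quotient _ _).obj L)).2 (e.inv ≫ T.mor₁ ≫ e'.hom)
  obtain ⟨f, rfl⟩ := (HomotopyCategory.quotient _ _).map_surjective f
  have hf' : Q.map f = e.inv ≫ T.mor₁ ≫ e'.hom := hf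
  refine ⟨CochainComplex.mappingCone f, min (a - 1) a', max b b', ?_, ?_,
    mappingCone_projective f hK hL, ?_⟩
  · exact CochainComplex.isStrictlyGE_mappingCone f a a' _
  · rw [CochainComplex.isStrictlyLE_iff]
    intro i hi
    rw [CochainComplex.mappingCone.isZero_X_iff]
    exact ⟨K.isZero_of_isStrictlyLE b _ (by lia), L.isZero_of_isStrictlyLE b' _ (by lia)⟩
  · refine ⟨Triangle.π₃.mapIso (isoTriangleOfIso₁₂ _ _ hT
      (mappingCone_triangle_distinguished f) e e' ?_)⟩
    change T.mor₁ ≫ e'.hom = e.hom ≫ Q.map f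
    rw [hf']
    simp)

instance : (perf R).IsTriangulatedClosed₂ := .of_isTriangulatedClosed₃

instance : (perf R).IsTriangulated where

variable (R)

/-- The bounded derived category of finitely generated `R`-modules. -/
abbrev DbMod : Type (u + 1) := DerivedCategory.Bounded (FGModuleCat.{u} R)

/-- The perfect complexes, as objects of the bounded derived category. -/
abbrev perfBounded : ObjectProperty (DbMod R) := (perf R).inverseImage (Bounded.ι)

/-- The singularity category `D_sg(R) = D^b(R-mod) / Perf(R)`: the Verdier quotient of the bounded
derived category of finitely generated `R`-modules by the perfect complexes, i.e. the localization
at the morphisms whose cone is perfect. -/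
abbrev Dsg : Type (u + 1) := (perfBounded R).trW.Localization

/-- The quotient functor from the bounded derived category to the singularity category. -/
abbrev Dsg.quot : DbMod R ⥤ Dsg R := (perfBounded R).trW.Q

variable (M : Type u) [AddCommGroup M] [Module R M] [Module.Finite R M]

/-- A finitely generated module, as an object of the bounded derived category, in degree `0`. -/
abbrev toDb : DbMod R :=
  ⟨(DerivedCategory.singleFunctor (FGModuleCat.{u} R) 0).obj (FGModuleCat.of R M),
    ⟨0, inferInstance⟩, ⟨0, inferInstance⟩⟩

instance : (forget₂ (FGModuleCat.{u} R) (ModuleCat.{u} R)).Additive where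
  map_add := rfl

/-- The functor from the bounded derived category of finitely generated modules to the derived
category of all modules. -/
abbrev toBig : DbMod R ⥤ DerivedCategory (ModuleCat.{u} R) :=
  Bounded.ι ⋙ (forget₂ (FGModuleCat.{u} R) (ModuleCat.{u} R)).mapDerivedCategory

/-- The functor `toBig` sends a finitely generated module to itself. -/
def toBigIso : (toBig R).obj (toDb R M) ≅
    (DerivedCategory.singleFunctor (ModuleCat.{u} R) 0).obj (ModuleCat.of R M) :=
  ((forget₂ (FGModuleCat.{u} R) (ModuleCat.{u} R)).mapDerivedCategorySingleFunctor 0).app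
    (FGModuleCat.of R M)

end Dsg

/-! ### Tate-Hochschild cohomology -/

section Tate

attribute [local instance] HasDerivedCategory.standard

open DerivedCategory

variable (k A : Type u) [Field k] [Ring A] [Algebra k A]

instance : Module.Finite (Env k A) A := by
  refine ⟨⟨{1}, eq_top_iff.2 fun a _ => ?_⟩⟩
  have h : ((a ⊗ₜ 1 : Env k A) • (1 : A)) = a := by
    change a • (1 : Aᵐᵒᵖ) • (1 : A) = a
    simp
  rw [← h]
  exact Submodule.smul_mem _ _ (Submodule.subset_span (by simp))

variable [IsNoetherianRing (Env k A)]

/-- The algebra `A`, as an object of the singularity category of its enveloping algebra. -/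
abbrev objA : Dsg (Env k A) := (Dsg.quot (Env k A)).obj (toDb (Env k A) A)

/-- The Tate-Hochschild cohomology `Hom(A, A[m])`, where the morphisms are taken in the
singularity category of the enveloping algebra of `A`. -/
abbrev TateHochschild (m : ℤ) : Type (u + 1) := ShiftedHom (objA k A) (objA k A) m

/-- The identification of `Q` of a module placed in degree `i` with the module in degree `i`. -/
def singleIso (R : Type u) [Ring R] (i : ℤ) (M : ModuleCat.{u} R) :
    Q.obj ((CochainComplex.singleFunctor (ModuleCat.{u} R) i).obj M) ≅
      (DerivedCategory.singleFunctor (ModuleCat.{u} R) i).obj M :=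
  ((DerivedCategory.singleFunctorIsoCompQ (ModuleCat.{u} R) i).app M).symm

variable {k A}

/-- A morphism `κ : A → Ω^p(A)[n]` in the derived category of bimodules is the class of the
cocycle `f : Ā^{⊗ n} → Ω^p(A)` if its composition with the quasi-isomorphism `Bar(A) → A` is
the map of complexes `Bar(A) → Ω^p(A)[n]` defined by `f`. -/
def IsClassOf {n p : ℕ} (f : Cochain k A n p) (hf : Cochain.delta f = 0)
    (κ : (singleFunctor (ModuleCat.{u} (Env k A)) 0).obj (ModuleCat.of (Env k A) A) ⟶
      (singleFunctor (ModuleCat.{u} (Env k A)) (-n)).obj (ModuleCat.of (Env k A) (Forms k A p))) :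
    Prop :=
  Q.map (barAug k A) ≫ (singleIso (Env k A) 0 _).hom ≫ κ =
    Q.map (barMap f hf) ≫ (singleIso (Env k A) (-n) _).hom

/-- The morphism `φ : A → A[m]` of the singularity category is the one defined by the cocycle
`f ∈ C^m(A, Ω^p(A))`, `n = m + p`. By definition `φ` is the composite of `κ : A → Ω^p(A)[n]`,
the class of `f`, with the inverse of `ν[m] : A[m] → Ω^p(A)[p][m] = Ω^p(A)[n]`, where
`ν : A → Ω^p(A)[p]` is the class of the inclusion `Ā^{⊗ p} → Ω^p(A)`, i.e. of the projection
of the bar resolution to its `p`-th syzygy `Ω^p(A)`; `ν` is invertible up to perfect complexes.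
Explicitly, `φ` is the fraction `t s⁻¹` of morphisms `s : X → A` and `t : X → A[m]` of the
bounded derived category of finitely generated bimodules, such that `s` has a perfect cone and
`κ s = ν[m] t`. The last equality takes place in the derived category of all bimodules, since
`Ω^p(A)` need not be a finitely generated bimodule. -/
def Represents {m : ℤ} {n p : ℕ} (h : (n : ℤ) = m + p) (f : Cochain k A n p)
    (hf : Cochain.delta f = 0) (φ : TateHochschild k A m) : Prop :=
  ∃ (X : DbMod (Env k A)) (s : X ⟶ toDb (Env k A) A) (t : X ⟶ (toDb (Env k A) A)⟦m⟧)
    (κ : (singleFunctor (ModuleCat.{u} (Env k A)) 0).obj (ModuleCat.of (Env k A) A) ⟶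
      (singleFunctor (ModuleCat.{u} (Env k A)) (-n)).obj (ModuleCat.of (Env k A) (Forms k A p)))
    (ν : (singleFunctor (ModuleCat.{u} (Env k A)) 0).obj (ModuleCat.of (Env k A) A) ⟶
      (singleFunctor (ModuleCat.{u} (Env k A)) (-p)).obj (ModuleCat.of (Env k A) (Forms k A p))),
    (perfBounded (Env k A)).trW s ∧
    (Dsg.quot (Env k A)).map s ≫ φ = (Dsg.quot (Env k A)).map t ≫
      ((Dsg.quot (Env k A)).commShiftIso m).hom.app (toDb (Env k A) A) ∧
    IsClassOf f hf κ ∧ IsClassOf (Cochain.unit p) (Cochain.delta_unit p) ν ∧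
    (toBig (Env k A)).map s ≫ (toBigIso (Env k A) A).hom ≫ κ =
      (toBig (Env k A)).map t ≫ ((toBig (Env k A)).commShiftIso m).hom.app (toDb (Env k A) A) ≫
        ((toBigIso (Env k A) A).hom ≫ ν)⟦m⟧' ≫
        ((singleFunctors (ModuleCat.{u} (Env k A))).shiftIso m (-n) (-p) (by lia)).hom.app _

end Tate
end TateHH

end

/-! A Hochschild cocycle `f : Ā^{⊗ n} → Ω^p(A)` is the same thing as a bimodule map `F : Ω^n(A) →
Ω^p(A)`: the cocycle condition says exactly that the left linear extension of `f` is right linear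
(`Cochain.ext_rightAct`). Since the bar complex is a projective resolution, `f ↦ κ_f` identifies
cocycles modulo coboundaries with the morphisms `A → Ω^p(A)[n]` in the derived category of bimodules
(`exists_kappa_eq`, `exists_delta_eq_of_kappa_eq_zero`, `kappa_delta`). The sequences `0 →
Ω^{p+1}(A) → Bar_p(A) → Ω^p(A) → 0` have connecting morphisms `χ_p : Ω^p(A) → Ω^{p+1}(A)[1]`.
Stabilization of `f` is composition of `κ_f` with `χ_p` (`kappa_theta`), and `ν_p` is the composite
of the isomorphism `ν_0` with `χ_0, …, χ_{p-1}` (`kappa_unit_succ`). So `HH_sg^m` is the colimit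
over `p` of the groups of morphisms `A → Ω^p(A)[m+p]` along the `χ_p`, and the claim is that this
colimit computes `Hom(A, A[m])` in the singularity category.

The bimodules `Ω^p(A)` and `Bar_p(A)` need not be finitely generated, so `ν_p` cannot simply be
inverted in the singularity category of finitely generated bimodules. All statements about `χ_p` and
`ν_p` are therefore made about morphisms from bounded complexes of finitely generated bimodules, up
to precomposition with morphisms of perfect cone. A morphism from such a complex to a shifted
projective module factors through a finitely generated free module, hence dies on the fibre of a map
to a perfect complex (`locallyZero_of_projective`). By the long exact sequence, `χ_p`, and then
`ν_p`, is injective and surjective up to denominators (`LocallyMono`, `LocallyEpi`). As the bounded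
derived category of finitely generated modules embeds fully faithfully in the derived category of
all modules (`toBig_bijective`), every cocycle has a fraction `t s⁻¹` with `s ≫ κ_f = t ≫ ν_p[m]`,
and its class in the singularity category is unique.

Bijectivity rests on one vanishing statement: a perfect complex has no non-zero morphism to `M[n]`
for `n` large, uniformly in the module `M`. Hence precomposition with a denominator `s` is bijective
on morphisms to `M[n]` for large `n` (`trW_precomp_bijective`). Given `t s⁻¹`, the morphism `t ≫
ν_p[m]` thus equals `s ≫ κ` for some `κ` once `p` is large, and `κ` is the class of a cocycle. If
`f` represents `0`, some `s` kills `κ_f` and all its stabilizations, so a high stabilization of `f`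
is a coboundary.

For products, `f ∪ g` is the composite `F ∘ g` of stabilized cocycles. If `s' ≫ κ_g = t' ≫ ν_n`,
composing with `F` gives `s' ≫ κ_{f ∪ g} = t' ≫ κ_f`, because `κ_f = F ∘ ν_n`; this roof is then
composed with the one for `f` by the Ore condition (`RepRel.comp`). -/

noncomputable section

namespace TateHH

/-! ### Roofs and a functor out of a category with a class of denominators -/

section Roofs

variable {C D E : Type*} [Category* C] [Category* D] [Category* E]
  [HasShift C ℤ] [HasShift D ℤ] [HasShift E ℤ]
  (W : MorphismProperty C) (T : C ⥤ D) (Q : C ⥤ E) [T.CommShift ℤ] [Q.CommShift ℤ]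

/-- The morphism `φ : Q(X) → Q(Y)[m]` is a fraction `t s⁻¹` such that `s ≫ α = t ≫ β` after
application of the functor `T`. -/
def RoofRel {X Y : C} {V : D} {m n p : ℤ} (h : p + m = n) (φ : ShiftedHom (Q.obj X) (Q.obj Y) m)
    (α : ShiftedHom (T.obj X) V n) (β : ShiftedHom (T.obj Y) V p) : Prop :=
  ∃ (X' : C) (s : X' ⟶ X) (t : ShiftedHom X' Y m), W s ∧ Q.map s ≫ φ = t.map Q ∧
    T.map s ≫ α = (t.map T).comp β h

variable {W T Q}

lemma ShiftedHom.comp_assoc' {X Y Z U : C} {a b c d e f : ℤ} (α : ShiftedHom X Y a)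
    (β : ShiftedHom Y Z b) (γ : ShiftedHom Z U c) (h : b + a = d) (h' : c + d = f)
    (h₂ : c + b = e) (h₃ : e + a = f) :
    (α.comp β h).comp γ h' = α.comp (β.comp γ h₂) h₃ := by
  subst h h₂
  exact ShiftedHom.comp_assoc α β γ rfl rfl (by lia)

lemma ShiftedHom.precomp_comp {X' X Y Z : C} {a b c : ℤ} (s : X' ⟶ X) (α : ShiftedHom X Y a)
    (β : ShiftedHom Y Z b) (h : b + a = c) :
    ShiftedHom.comp (s ≫ α : X' ⟶ Y⟦a⟧) β h = s ≫ α.comp β h := by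
  simp [ShiftedHom.comp]

lemma ShiftedHom.comp_precomp {X Y Y' Z : C} {a b c : ℤ} (α : ShiftedHom X Y a) (s : Y ⟶ Y')
    (β : ShiftedHom Y' Z b) (h : b + a = c) :
    ShiftedHom.comp α (s ≫ β : Y ⟶ Z⟦b⟧) h = ShiftedHom.comp (α ≫ s⟦a⟧' : X ⟶ Y'⟦a⟧) β h := by
  simp [ShiftedHom.comp]

lemma ShiftedHom.map_precomp {X' X Y : C} {a : ℤ} (s : X' ⟶ X) (α : ShiftedHom X Y a) :
    ShiftedHom.map (s ≫ α : X' ⟶ Y⟦a⟧) T = T.map s ≫ α.map T := by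
  simp [ShiftedHom.map]

lemma ShiftedHom.map_postcomp {X Y Y' : C} {a : ℤ} (α : ShiftedHom X Y a) (s : Y ⟶ Y') :
    ShiftedHom.map (α ≫ s⟦a⟧' : X ⟶ Y'⟦a⟧) T = α.map T ≫ (T.map s)⟦a⟧' := by
  simp [ShiftedHom.map]

namespace RoofRel

/-- The roof is unchanged; only the relation `s ≫ α = t ≫ β` is composed with `γ`. With `γ` a
connecting morphism this gives invariance under stabilization; with `γ` the bimodule map of a
cocycle it is one half of multiplicativity. -/
lemma postcomp {X Y : C} {V V' : D} {m n p r n' p' : ℤ} {h : p + m = n}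
    {φ : ShiftedHom (Q.obj X) (Q.obj Y) m} {α : ShiftedHom (T.obj X) V n}
    {β : ShiftedHom (T.obj Y) V p} (H : RoofRel W T Q h φ α β) (γ : ShiftedHom V V' r)
    (hn : r + n = n') (hp : r + p = p') (h' : p' + m = n') :
    RoofRel W T Q h' φ (α.comp γ hn) (β.comp γ hp) := by
  obtain ⟨X', s, t, hs, h₁, h₂⟩ := H
  refine ⟨X', s, t, hs, h₁, ?_⟩
  rw [← ShiftedHom.precomp_comp, h₂, ShiftedHom.comp_assoc']

lemma map [W.ContainsIdentities] {X Y : C} {V : D} {m n p : ℤ} (h : p + m = n)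
    (t : ShiftedHom X Y m) (β : ShiftedHom (T.obj Y) V p) :
    RoofRel W T Q h (t.map Q) ((t.map T).comp β h) β :=
  ⟨X, 𝟙 X, t, W.id_mem X, by simp, by simp⟩

lemma smul [Preadditive C] [Preadditive D] [Preadditive E] {k : Type*} [Ring k] [Linear k C]
    [Linear k D] [Linear k E] [T.Linear k] [Q.Linear k]
    {X Y : C} {V : D} {m n p : ℤ} {h : p + m = n}
    {φ : ShiftedHom (Q.obj X) (Q.obj Y) m} {α : ShiftedHom (T.obj X) V n}
    {β : ShiftedHom (T.obj Y) V p} (r : k) (H : RoofRel W T Q h φ α β) :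
    RoofRel W T Q h (r • φ) (r • α) β := by
  obtain ⟨X', s, t, hs, h₁, h₂⟩ := H
  refine ⟨X', s, r • t, hs, ?_, ?_⟩
  · rw [ShiftedHom.map_smul, ← h₁, Linear.comp_smul]
  · rw [ShiftedHom.map_smul, ShiftedHom.smul_comp, ← h₂, Linear.comp_smul]

variable [W.HasRightCalculusOfFractions]

/-- Composition of fractions: the middle morphism `β` is the target datum of the first roof and the
source datum of the second, so the two relations chain together. -/
lemma comp [W.IsCompatibleWithShift ℤ] {X Y Z : C} {V : D}
    {a b c n p q : ℤ} {h : p + a = n} {h' : q + b = p}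
    {φ : ShiftedHom (Q.obj X) (Q.obj Y) a} {ψ : ShiftedHom (Q.obj Y) (Q.obj Z) b}
    {α : ShiftedHom (T.obj X) V n} {β : ShiftedHom (T.obj Y) V p}
    {γ : ShiftedHom (T.obj Z) V q} (H : RoofRel W T Q h φ α β) (H' : RoofRel W T Q h' ψ β γ)
    (hc : b + a = c) (h'' : q + c = n) : RoofRel W T Q h'' (φ.comp ψ hc) α γ := by
  obtain ⟨X', s, t, hs, h₁, h₂⟩ := H
  obtain ⟨Y', s', t', hs', h₁', h₂'⟩ := H'
  -- The Ore condition gives `u ≫ t = v ≫ s'[a]` with `u` a denominator; the composite fraction has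
  -- denominator `u ≫ s` and numerator `v` followed by `t'`.
  obtain ⟨⟨u, hu, v⟩, hφ'⟩ :=
    (MorphismProperty.LeftFraction.mk t (s'⟦a⟧') (W.shift hs' a)).exists_rightFraction
  dsimp at hφ' u hu v
  refine ⟨_, u ≫ s, ShiftedHom.comp v t' hc, W.comp_mem _ _ hu hs, ?_, ?_⟩
  · rw [Functor.map_comp, Category.assoc, ← ShiftedHom.precomp_comp, h₁, ← ShiftedHom.precomp_comp,
      ← ShiftedHom.map_precomp, hφ', ShiftedHom.map_postcomp, ← ShiftedHom.comp_precomp, h₁',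
      ShiftedHom.map_comp]
  · rw [Functor.map_comp, Category.assoc, h₂, ← ShiftedHom.precomp_comp, ← ShiftedHom.map_precomp,
      hφ', ShiftedHom.map_postcomp, ← ShiftedHom.comp_precomp, h₂', ShiftedHom.map_comp,
      ShiftedHom.comp_assoc']

lemma exists_roof [Q.IsLocalization W] {X Y : C} {m : ℤ}
    (φ : ShiftedHom (Q.obj X) (Q.obj Y) m) :
    ∃ (X' : C) (s : X' ⟶ X) (t : ShiftedHom X' Y m), W s ∧ Q.map s ≫ φ = t.map Q := by
  obtain ⟨ψ, hψ⟩ := Localization.exists_rightFraction Q W (φ ≫ (Q.commShiftIso m).inv.app Y)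
  refine ⟨ψ.X', ψ.s, ψ.f, ψ.hs, ?_⟩
  rw [ShiftedHom.map, ← MorphismProperty.RightFraction.map_s_comp_map ψ Q
    (Localization.inverts Q W),
    ← hψ]
  simp

variable [Preadditive C] [Preadditive D] [Preadditive E] [T.Additive] [Q.Additive]

/-- A numerator that vanishes after localization is killed by a further denominator `u`, and then `u
≫ s` kills `α`. This is the source of injectivity of the comparison. -/
lemma exists_of_zero [Q.IsLocalization W] {X Y : C} {V : D}
    {m n p : ℤ} {h : p + m = n} {α : ShiftedHom (T.obj X) V n} {β : ShiftedHom (T.obj Y) V p}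
    (H : RoofRel W T Q h 0 α β) : ∃ (X' : C) (s : X' ⟶ X), W s ∧ T.map s ≫ α = 0 := by
  obtain ⟨X', s, t, hs, h₁, h₂⟩ := H
  rw [Limits.comp_zero, ShiftedHom.map] at h₁
  have h₀ : Q.map t = Q.map 0 := by
    rw [Q.map_zero, ← cancel_mono ((Q.commShiftIso m).hom.app Y), ← h₁, Limits.zero_comp]
  obtain ⟨X'', u, hu, hu'⟩ := (MorphismProperty.map_eq_iff_precomp Q W t 0).1 h₀
  refine ⟨X'', u ≫ s, W.comp_mem _ _ hu hs, ?_⟩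
  rw [Functor.map_comp, Category.assoc, h₂, ← ShiftedHom.precomp_comp, ← ShiftedHom.map_precomp,
    hu', Limits.comp_zero, ShiftedHom.map_zero, ShiftedHom.zero_comp]

lemma add {X Y : C} {V : D} {m n p : ℤ} {h : p + m = n}
    {φ φ' : ShiftedHom (Q.obj X) (Q.obj Y) m} {α α' : ShiftedHom (T.obj X) V n}
    {β : ShiftedHom (T.obj Y) V p} (H : RoofRel W T Q h φ α β) (H' : RoofRel W T Q h φ' α' β) :
    RoofRel W T Q h (φ + φ') (α + α') β := by
  obtain ⟨X', s, t, hs, h₁, h₂⟩ := H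
  obtain ⟨Y', s', t', hs', h₁', h₂'⟩ := H'
  -- Common denominator `u ≫ s = v ≫ s'` of the two fractions.
  obtain ⟨⟨u, hu, v⟩, hφ'⟩ := (MorphismProperty.LeftFraction.mk s s' hs').exists_rightFraction
  dsimp at hφ' u hu v
  have hQ : Q.map (u ≫ s) ≫ φ' = Q.map v ≫ Q.map s' ≫ φ' := by rw [hφ', Q.map_comp, Category.assoc]
  have hT : T.map (u ≫ s) ≫ α' = T.map v ≫ T.map s' ≫ α' := by rw [hφ', T.map_comp, Category.assoc]
  refine ⟨_, u ≫ s, (u ≫ t + v ≫ t' : _ ⟶ Y⟦m⟧), W.comp_mem _ _ hu hs, ?_, ?_⟩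
  · rw [ShiftedHom.map_add, ShiftedHom.map_precomp, ShiftedHom.map_precomp, ← h₁, ← h₁',
      Preadditive.comp_add, hQ, Functor.map_comp, Category.assoc]
  · rw [ShiftedHom.map_add, ShiftedHom.add_comp, ShiftedHom.map_precomp, ShiftedHom.map_precomp,
      ShiftedHom.precomp_comp, ShiftedHom.precomp_comp, ← h₂, ← h₂',
      Preadditive.comp_add, hT, Functor.map_comp, Category.assoc]

end RoofRel

end Roofs

/-! ### Morphisms that are injective or surjective up to denominators -/

section Local

variable {C D : Type*} [Category* C] [Category* D] [HasShift D ℤ]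

/-- The morphism `γ` is surjective up to denominators on morphisms from objects `T(X)`. -/
def LocallyEpi (W : MorphismProperty C) (T : C ⥤ D) {V V' : D} {r : ℤ}
    (γ : ShiftedHom V V' r) : Prop :=
  ∀ ⦃X : C⦄ ⦃n n' : ℤ⦄ (hn : r + n = n') (g : ShiftedHom (T.obj X) V' n'),
    ∃ (X' : C) (s : X' ⟶ X) (g' : ShiftedHom (T.obj X') V n), W s ∧ T.map s ≫ g = g'.comp γ hn

section

variable {W : MorphismProperty C} {T : C ⥤ D} [W.IsMultiplicative]

lemma LocallyEpi.comp {V V' V'' : D} {r r' q : ℤ} {γ : ShiftedHom V V' r}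
    {γ' : ShiftedHom V' V'' r'} (hγ : LocallyEpi W T γ) (hγ' : LocallyEpi W T γ')
    (h : r' + r = q) : LocallyEpi W T (γ.comp γ' h) := by
  intro X n n' hn g
  obtain ⟨X', s, g', hs, h₁⟩ := hγ' (n := r + n) (by lia) g
  obtain ⟨X'', s', g'', hs', h₂⟩ := hγ (n := n) rfl g'
  refine ⟨X'', s' ≫ s, g'', W.comp_mem _ _ hs' hs, ?_⟩
  rw [Functor.map_comp, Category.assoc, h₁, ← ShiftedHom.precomp_comp, h₂,
    ShiftedHom.comp_assoc']

lemma LocallyEpi.of_isIso {V V' : D} {r : ℤ} (γ : ShiftedHom V V' r)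
    [IsIso (γ : V ⟶ V'⟦r⟧)] : LocallyEpi W T γ := by
  intro X n n' hn g
  refine ⟨X, 𝟙 X, (g ≫ (shiftFunctorAdd' D r n n' hn).hom.app V' ≫
    inv ((shiftFunctor D n).map (show V ⟶ V'⟦r⟧ from γ)) : T.obj X ⟶ V⟦n⟧), W.id_mem X, ?_⟩
  rw [ShiftedHom.comp, Category.assoc, Category.assoc, IsIso.inv_hom_id_assoc]
  simp

end

variable [Preadditive D]

/-- Every morphism from `T(X)` to a shift of `V` vanishes up to denominators. -/
def LocallyZero (W : MorphismProperty C) (T : C ⥤ D) (V : D) : Prop :=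
  ∀ ⦃X : C⦄ ⦃n : ℤ⦄ (g : ShiftedHom (T.obj X) V n), ∃ (X' : C) (s : X' ⟶ X), W s ∧ T.map s ≫ g = 0

/-- The morphism `γ` is injective up to denominators on morphisms from objects `T(X)`. -/
def LocallyMono (W : MorphismProperty C) (T : C ⥤ D) {V V' : D} {r : ℤ}
    (γ : ShiftedHom V V' r) : Prop :=
  ∀ ⦃X : C⦄ ⦃n n' : ℤ⦄ (hn : r + n = n') (g : ShiftedHom (T.obj X) V n), g.comp γ hn = 0 →
    ∃ (X' : C) (s : X' ⟶ X), W s ∧ T.map s ≫ g = 0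

variable {W : MorphismProperty C} {T : C ⥤ D}

section

variable [W.IsMultiplicative]

lemma LocallyMono.comp {V V' V'' : D} {r r' q : ℤ} {γ : ShiftedHom V V' r}
    {γ' : ShiftedHom V' V'' r'} (hγ : LocallyMono W T γ) (hγ' : LocallyMono W T γ')
    (h : r' + r = q) : LocallyMono W T (γ.comp γ' h) := by
  intro X n n' hn g hg
  rw [← ShiftedHom.comp_assoc' g γ γ' (d := r + n) rfl (by lia)] at hg
  obtain ⟨X', s, hs, h₁⟩ := hγ' _ _ hg
  rw [← ShiftedHom.precomp_comp] at h₁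
  obtain ⟨X'', s', hs', h₂⟩ := hγ _ _ h₁
  exact ⟨X'', s' ≫ s, W.comp_mem _ _ hs' hs, by rw [Functor.map_comp, Category.assoc, h₂]⟩

lemma LocallyMono.of_isIso {V V' : D} {r : ℤ} (γ : ShiftedHom V V' r)
    [IsIso (γ : V ⟶ V'⟦r⟧)] : LocallyMono W T γ := by
  intro X n n' hn g hg
  rw [ShiftedHom.comp, ← Category.assoc, Preadditive.IsIso.comp_right_eq_zero,
    Preadditive.IsIso.comp_right_eq_zero] at hg
  exact ⟨X, 𝟙 X, W.id_mem X, by simp [hg]⟩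

end

open Pretriangulated

variable [Limits.HasZeroObject D] [∀ n : ℤ, (shiftFunctor D n).Additive] [Pretriangulated D]

/-- Exactness at the third term of the `n`-th shift of the triangle; the sign `(-1)^n` which its
morphisms carry is absorbed in the lift. -/
lemma exists_lift_shift {Y₁ Y₂ Y₃ : D} {f₁ : Y₁ ⟶ Y₂} {f₂ : Y₂ ⟶ Y₃} {f₃ : Y₃ ⟶ Y₁⟦(1 : ℤ)⟧}
    (hΔ : Triangle.mk f₁ f₂ f₃ ∈ distTriang D) {X : D} (n : ℤ)
    (g : X ⟶ Y₃⟦n⟧) (hg : g ≫ f₃⟦n⟧' = 0) : ∃ g' : X ⟶ Y₂⟦n⟧, g = g' ≫ f₂⟦n⟧' := by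
  obtain ⟨g', hg'⟩ : ∃ g' : X ⟶ Y₂⟦n⟧, g = g' ≫ (n.negOnePow • f₂⟦n⟧') :=
    Triangle.coyoneda_exact₃ _ (Triangle.shift_distinguished _ hΔ n) g (by
      change g ≫ (n.negOnePow • f₃⟦n⟧' ≫ (shiftFunctorComm D 1 n).hom.app Y₁) = 0
      rw [Linear.comp_units_smul, reassoc_of% hg, Limits.zero_comp, smul_zero])
  exact ⟨n.negOnePow • g', by rw [hg', Linear.comp_units_smul, Linear.units_smul_comp]⟩

variable {Y₁ Y₂ Y₃ : D} {f₁ : Y₁ ⟶ Y₂} {f₂ : Y₂ ⟶ Y₃} {f₃ : Y₃ ⟶ Y₁⟦(1 : ℤ)⟧}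

/-- A morphism killed by the connecting morphism `f₃` lifts to a shift of the middle term, and the
lift dies on a denominator. -/
lemma LocallyZero.locallyMono (h : LocallyZero W T Y₂)
    (hΔ : Triangle.mk f₁ f₂ f₃ ∈ distTriang D) : LocallyMono W T (r := 1) f₃ := by
  intro X n n' hn g hg
  rw [ShiftedHom.comp, ← Category.assoc, Preadditive.IsIso.comp_right_eq_zero] at hg
  obtain ⟨g', rfl⟩ := exists_lift_shift hΔ n g hg
  obtain ⟨X', s, hs, hs'⟩ := h g'
  exact ⟨X', s, hs, by rw [reassoc_of% hs', Limits.zero_comp]⟩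

/-- The obstruction to lifting `g` through `f₃` is `g ≫ f₁`, which takes values in a shift of the
middle term and so dies on a denominator. The lift comes from the rotated triangle. -/
lemma LocallyZero.locallyEpi (h : LocallyZero W T Y₂)
    (hΔ : Triangle.mk f₁ f₂ f₃ ∈ distTriang D) : LocallyEpi W T (r := 1) f₃ := by
  intro X n n' hn g
  obtain ⟨X', s, hs, hs'⟩ := h (n := n') (g ≫ f₁⟦n'⟧')
  have hΔ' : Triangle.mk f₂ f₃ (-f₁⟦1⟧') ∈ distTriang D := rot_of_distTriang _ hΔ
  obtain ⟨g', hg'⟩ := exists_lift_shift hΔ' n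
    (T.map s ≫ g ≫ (shiftFunctorAdd' D 1 n n' hn).hom.app Y₁) (by
      have := (shiftFunctorAdd' D 1 n n' hn).hom.naturality f₁
      dsimp at this
      rw [Functor.map_neg, Preadditive.comp_neg, neg_eq_zero, Category.assoc, Category.assoc,
        ← this, reassoc_of% hs', Limits.zero_comp])
  refine ⟨X', s, g', hs, ?_⟩
  rw [ShiftedHom.comp, ← reassoc_of% hg']
  simp

end Local

/-! ### Existence and uniqueness of the fraction attached to a morphism -/

section Fractions

variable {C D E : Type*} [Category* C] [Category* D] [Category* E]
  [HasShift C ℤ] [HasShift D ℤ] [HasShift E ℤ]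
  {W : MorphismProperty C} {T : C ⥤ D} {Q : C ⥤ E} [T.CommShift ℤ] [Q.CommShift ℤ]
  [Q.IsLocalization W]

/-- On a denominator `s`, `α` factors through `β`; the first factor is a morphism between objects in
the image of `T` (up to the shift isomorphism), so by fullness it comes from a numerator `t` in `C`.
-/
lemma RoofRel.exists_of_locallyEpi [T.Full] {X Y : C} {V : D} {m n p : ℤ} (h : p + m = n)
    (α : ShiftedHom (T.obj X) V n) {β : ShiftedHom (T.obj Y) V p} (hβ : LocallyEpi W T β) :
    ∃ φ : ShiftedHom (Q.obj X) (Q.obj Y) m, RoofRel W T Q h φ α β := by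
  obtain ⟨X', s, g, hs, hg⟩ := hβ h α
  obtain ⟨t, ht⟩ := T.map_surjective (g ≫ (T.commShiftIso m).inv.app Y)
  have := Localization.inverts Q W s hs
  refine ⟨inv (Q.map s) ≫ ShiftedHom.map t Q, X', s, t, hs, by simp, ?_⟩
  rw [hg, ShiftedHom.map, ht]
  simp

variable [Preadditive C] [Preadditive D] [Preadditive E] [T.Additive] [Q.Additive]

/-- For `α = 0` the numerator satisfies `t ≫ β = 0`, so `T(t)` dies on a denominator, and by
faithfulness so does `t`. By additivity of the relation this is uniqueness of the fraction. -/
lemma RoofRel.eq_zero [T.Faithful] {X Y : C} {V : D} {m n p : ℤ} {h : p + m = n}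
    {φ : ShiftedHom (Q.obj X) (Q.obj Y) m} {β : ShiftedHom (T.obj Y) V p}
    (H : RoofRel W T Q h φ 0 β) (hβ : LocallyMono W T β) : φ = 0 := by
  obtain ⟨X', s, t, hs, h₁, h₂⟩ := H
  rw [Limits.comp_zero] at h₂
  obtain ⟨X'', s', hs', h₃⟩ := hβ _ _ h₂.symm
  have h₄ : s' ≫ t = 0 := by
    apply T.map_injective
    rw [← cancel_mono ((T.commShiftIso m).hom.app Y), T.map_zero, Limits.zero_comp, ← h₃,
      T.map_comp, ShiftedHom.map, Category.assoc]
  have := Localization.inverts Q W s hs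
  have := Localization.inverts Q W s' hs'
  rw [← cancel_epi (Q.map s), h₁, ← cancel_epi (Q.map s'), ← ShiftedHom.map_precomp, h₄,
    ShiftedHom.map_zero, Limits.comp_zero, Limits.comp_zero]

end Fractions

/-! ### Projective resolutions of complexes of finitely generated modules -/

section Resolutions

attribute [local instance] HasDerivedCategory.standard

open DerivedCategory Pretriangulated ZeroObject Triangulated

variable {R : Type u} [Ring R] [IsNoetherianRing R]

instance : EnoughProjectives (FGModuleCat.{u} R) where
  presentation M := by
    obtain ⟨n, f, hf⟩ := Module.Finite.exists_fin' R M
    let P : FGModuleCat.{u} R := FGModuleCat.of R (Fin n → R)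
    have : Module.Projective R P := inferInstanceAs (Module.Projective R (Fin n → R))
    have hP : Projective P := projective_of_module_projective P
    have he : Epi (FGModuleCat.ofHom f : P ⟶ M) := by
      have : Epi ((forget₂ (FGModuleCat.{u} R) (ModuleCat.{u} R)).map
          (FGModuleCat.ofHom f : P ⟶ M)) := (ModuleCat.epi_iff_surjective _).2 hf
      exact (forget₂ (FGModuleCat.{u} R) (ModuleCat.{u} R)).epi_of_epi_map this
    exact ⟨⟨P, FGModuleCat.ofHom f⟩⟩

lemma module_projective_of_projective (P : FGModuleCat.{u} R) [Projective P] :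
    Module.Projective R P := by
  obtain ⟨n, f, hf⟩ := Module.Finite.exists_fin' R P
  let g : FGModuleCat.of R (Fin n → R) ⟶ P := FGModuleCat.ofHom f
  have : Epi g := by
    have : Epi ((forget₂ (FGModuleCat.{u} R) (ModuleCat.{u} R)).map g) :=
      (ModuleCat.epi_iff_surjective _).2 hf
    exact (forget₂ (FGModuleCat.{u} R) (ModuleCat.{u} R)).epi_of_epi_map this
  have hs : Projective.factorThru (𝟙 P) g ≫ g = 𝟙 P := Projective.factorThru_comp _ _
  refine Module.Projective.of_split (Projective.factorThru (𝟙 P) g).hom.hom f ?_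
  refine LinearMap.ext fun x => ?_
  exact congrArg (fun t : P ⟶ P => t.hom.hom x) hs

variable (R) in
/-- The objects of the derived category which are represented by a bounded above complex of
finitely generated projective modules. -/
def resolvable : ObjectProperty (DerivedCategory (FGModuleCat.{u} R)) := fun X =>
  ∃ (K : CochainComplex (FGModuleCat.{u} R) ℤ) (b : ℤ), K.IsStrictlyLE b ∧
    (∀ i, Projective (K.X i)) ∧ Nonempty (X ≅ Q.obj K)

instance : (resolvable R).IsClosedUnderIsomorphisms where
  of_iso := by
    rintro X Y e ⟨K, b, hb, hK, ⟨e'⟩⟩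
    exact ⟨K, b, hb, hK, ⟨e.symm ≪≫ e'⟩⟩

instance : (resolvable R).IsStableUnderShift ℤ where
  isStableUnderShiftBy n :=
    { le_shift := by
        rintro X ⟨K, b, hb, hK, ⟨e⟩⟩
        exact ⟨(shiftFunctor _ n).obj K, b - n, K.isStrictlyLE_shift b n _ (by lia),
          fun i => hK _, ⟨(shiftFunctor _ n).mapIso e ≪≫ (Q.commShiftIso n).symm.app K⟩⟩ }

lemma resolvable_mappingCone {K L : CochainComplex (FGModuleCat.{u} R) ℤ} (f : K ⟶ L)
    (hK : ∀ i, Projective (K.X i)) (hL : ∀ i, Projective (L.X i)) (i : ℤ) :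
    Projective ((CochainComplex.mappingCone f).X i) := by
  have := mappingCone_projective f (fun i => have := hK i; module_projective_of_projective _)
    (fun i => have := hL i; module_projective_of_projective _) i
  exact projective_of_module_projective _

/-- Bounded above complexes of projectives are K-projective, so a morphism between two of them in
the derived category is a chain map, and its mapping cone is again of this kind. -/
instance : (resolvable R).IsTriangulatedClosed₃ := .mk' (by
  rintro T hT ⟨K, b, hb, hK, ⟨e⟩⟩ ⟨L, b', hb', hL, ⟨e'⟩⟩
  have := K.isKProjective_of_projective b
  obtain ⟨f, hf⟩ := (CochainComplex.IsKProjective.Qh_map_bijective K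
    ((HomotopyCategory.quotient _ _).obj L)).2 (e.inv ≫ T.mor₁ ≫ e'.hom)
  obtain ⟨f, rfl⟩ := (HomotopyCategory.quotient _ _).map_surjective f
  have hf' : Q.map f = e.inv ≫ T.mor₁ ≫ e'.hom := hf
  refine ⟨CochainComplex.mappingCone f, max b b', ?_, resolvable_mappingCone f hK hL, ?_⟩
  · rw [CochainComplex.isStrictlyLE_iff]
    intro i hi
    rw [CochainComplex.mappingCone.isZero_X_iff]
    exact ⟨K.isZero_of_isStrictlyLE b _ (by lia), L.isZero_of_isStrictlyLE b' _ (by lia)⟩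
  · refine ⟨Triangle.π₃.mapIso (isoTriangleOfIso₁₂ _ _ hT
      (mappingCone_triangle_distinguished f) e e' ?_)⟩
    change T.mor₁ ≫ e'.hom = e.hom ≫ Q.map f
    rw [hf']
    simp)

instance : (resolvable R).IsTriangulatedClosed₂ := .of_isTriangulatedClosed₃

lemma resolvable_singleFunctor_zero (M : FGModuleCat.{u} R) :
    resolvable R ((singleFunctor (FGModuleCat.{u} R) 0).obj M) := by
  let P : ProjectiveResolution M := (HasProjectiveResolution.out (Z := M)).some
  exact ⟨P.cochainComplex, 0, inferInstance, inferInstance,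
    ⟨(singleFunctorIsoCompQ _ 0).app M ≪≫ (asIso (Q.map P.π')).symm⟩⟩

lemma resolvable_singleFunctor (M : FGModuleCat.{u} R) (n : ℤ) :
    resolvable R ((singleFunctor (FGModuleCat.{u} R) n).obj M) :=
  (resolvable R).prop_of_iso
    (((singleFunctors (FGModuleCat.{u} R)).shiftIso (-n) n 0 (by lia)).app M)
    ((resolvable R).le_shift (-n) _ (resolvable_singleFunctor_zero M))

/-- Dévissage along the truncation triangle at `a + d`: the lower part has amplitude `d`, and the
upper part is a single module in degree `a + d + 1`, which has a projective resolution. -/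
lemma resolvable_of_isGE_of_isLE (a : ℤ) (d : ℕ) (X : DerivedCategory (FGModuleCat.{u} R))
    [X.IsGE a] [X.IsLE (a + d)] : resolvable R X := by
  induction d generalizing X with
  | zero =>
    have : X.IsLE a := by simpa using ‹X.IsLE (a + (0 : ℕ))›
    obtain ⟨M, ⟨e⟩⟩ := exists_iso_singleFunctor_obj_of_isGE_of_isLE X a
    exact (resolvable R).prop_of_iso e.symm (resolvable_singleFunctor M a)
  | succ d ih =>
    have hT := TStructure.t.triangleLEGT_distinguished (a + d) X
    refine (resolvable R).ext_of_isTriangulatedClosed₂ _ hT ?_ ?_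
    · have : TStructure.t.IsGE ((TStructure.t.truncLE (a + d)).obj X) a := inferInstance
      exact ih ((TStructure.t.truncLE (a + d)).obj X)
    · have h₁ : (((TStructure.t.truncGT (a + d)).obj X)).IsLE (a + d + 1) := by
        have : TStructure.t.IsLE X (a + d + 1) := by
          simpa [add_assoc] using ‹X.IsLE (a + (d + 1 : ℕ))›
        infer_instance
      obtain ⟨M, ⟨e⟩⟩ := exists_iso_singleFunctor_obj_of_isGE_of_isLE
        ((TStructure.t.truncGT (a + d)).obj X) (a + d + 1)
      exact (resolvable R).prop_of_iso e.symm (resolvable_singleFunctor M _)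

lemma resolvable_bounded (X : DbMod R) : resolvable R X.obj := by
  obtain ⟨⟨a, ha⟩, ⟨b, hb⟩⟩ := X.property
  have := TStructure.t.isLE_of_le X.obj b (a + (b - a).toNat) (by lia)
  exact resolvable_of_isGE_of_isLE a (b - a).toNat X.obj

/-! ### Comparison with the derived category of all modules -/

variable (R) in
/-- The inclusion of the finitely generated modules in all modules. -/
abbrev incl : FGModuleCat.{u} R ⥤ ModuleCat.{u} R := forget₂ (FGModuleCat.{u} R) (ModuleCat.{u} R)

instance (P : FGModuleCat.{u} R) [Projective P] : Projective ((incl R).obj P) := by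
  have := module_projective_of_projective P
  have : Module.Projective R ((incl R).obj P) := this
  infer_instance

lemma isKProjective_incl (K : CochainComplex (FGModuleCat.{u} R) ℤ) (b : ℤ) [K.IsStrictlyLE b]
    [∀ i, Projective (K.X i)] :
    CochainComplex.IsKProjective (((incl R).mapHomologicalComplex (.up ℤ)).obj K) := by
  have h₁ : CochainComplex.IsStrictlyLE (((incl R).mapHomologicalComplex (.up ℤ)).obj K) b := by
    rw [CochainComplex.isStrictlyLE_iff]
    exact fun i hi => (incl R).map_isZero (K.isZero_of_isStrictlyLE b i hi)
  have h₂ (i : ℤ) : Projective ((((incl R).mapHomologicalComplex (.up ℤ)).obj K).X i) :=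
    inferInstanceAs (Projective ((incl R).obj (K.X i)))
  exact CochainComplex.isKProjective_of_projective _ b

/-- Both `K` and its image among all modules are bounded above complexes of projectives. Hence
morphisms out of them in either derived category are homotopy classes of chain maps, and these agree
because `incl R` is fully faithful. -/
lemma mapDerivedCategory_bijective (K : CochainComplex (FGModuleCat.{u} R) ℤ) (b : ℤ)
    [K.IsStrictlyLE b] [∀ i, Projective (K.X i)] (Y : DerivedCategory (FGModuleCat.{u} R)) :
    Function.Bijective ((incl R).mapDerivedCategory.map : (Q.obj K ⟶ Y) → _) := by
  have hK := K.isKProjective_of_projective b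
  have hK' := isKProjective_incl K b
  obtain ⟨L, ⟨e⟩⟩ : ∃ L, Nonempty (Qh.obj L ≅ Y) := ⟨_, ⟨Qh.objObjPreimageIso Y⟩⟩
  let G := (incl R).mapDerivedCategory
  let K' := (HomotopyCategory.quotient (FGModuleCat.{u} R) (.up ℤ)).obj K
  let η := (incl R).mapDerivedCategoryFactorsh
  have h₁ := CochainComplex.IsKProjective.Qh_map_bijective K L
  have h₂ : Function.Bijective
      (Qh.map : (((incl R).mapHomotopyCategory (.up ℤ)).obj K' ⟶
        ((incl R).mapHomotopyCategory (.up ℤ)).obj L) → _) :=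
    CochainComplex.IsKProjective.Qh_map_bijective
      (((incl R).mapHomologicalComplex (.up ℤ)).obj K) _
  have h₃ : Function.Bijective (((incl R).mapHomotopyCategory (.up ℤ)).map :
      (K' ⟶ L) → _) := ⟨Functor.map_injective _, Functor.map_surjective _⟩
  have h₄ : Function.Bijective (fun f : K' ⟶ L => G.map (Qh.map f)) := by
    have : (fun f : K' ⟶ L => G.map (Qh.map f)) =
        (fun f => η.hom.app K' ≫ f ≫ η.inv.app L) ∘ Qh.map ∘
          ((incl R).mapHomotopyCategory (.up ℤ)).map := by
      funext f
      have := η.hom.naturality f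
      dsimp at this
      simp only [Function.comp_apply]
      rw [← Category.assoc]
      erw [← this]
      simp [G]
    rw [this]
    refine Function.Bijective.comp ⟨fun f g h => ?_, fun f => ⟨η.inv.app K' ≫ f ≫ η.hom.app L, ?_⟩⟩
      (h₂.comp h₃)
    · simpa using h
    · simp only [Category.assoc, Iso.hom_inv_id_app_assoc]
      rw [Iso.hom_inv_id_app]
      exact Category.comp_id f
  have h₅ : Function.Bijective (G.map : (Qh.obj K' ⟶ Qh.obj L) → _) :=
    -- `Qh` is bijective on morphisms out of `K'`, so it can be cancelled from the bijective
    -- composite `h₄`.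
    (Function.Bijective.of_comp_iff _ h₁).1 h₄
  have h₆ : Function.Bijective (G.map : (Qh.obj K' ⟶ Y) → _) := by
    refine ⟨fun f g h => ?_, fun g => ?_⟩
    · rw [← cancel_mono e.inv]
      apply h₅.1
      rw [G.map_comp, G.map_comp, h]
    · obtain ⟨f, hf⟩ := h₅.2 (g ≫ G.map e.inv)
      exact ⟨f ≫ e.hom, by rw [Functor.map_comp, hf, Category.assoc, ← G.map_comp, e.inv_hom_id,
        G.map_id, Category.comp_id]⟩
  exact h₆

lemma toBig_bijective (X Y : DbMod R) :
    Function.Bijective ((toBig R).map : (X ⟶ Y) → _) := by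
  obtain ⟨K, b, hb, hK, ⟨e⟩⟩ := resolvable_bounded X
  have h := mapDerivedCategory_bijective K b Y.obj
  let G := (incl R).mapDerivedCategory
  have h' : Function.Bijective (G.map : (X.obj ⟶ Y.obj) → _) := by
    refine ⟨fun f g hfg => ?_, fun g => ?_⟩
    · rw [← cancel_epi e.inv]
      apply h.1
      rw [Functor.map_comp, Functor.map_comp]
      exact congrArg (G.map e.inv ≫ ·) hfg
    · obtain ⟨f, hf⟩ := h.2 (G.map e.inv ≫ g)
      refine ⟨e.hom ≫ f, ?_⟩
      rw [Functor.map_comp, hf, ← G.map_comp_assoc, e.hom_inv_id, G.map_id, Category.id_comp]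
  exact h'.comp ⟨Functor.map_injective _, Functor.map_surjective _⟩

instance : (toBig R).Full where
  map_surjective := (toBig_bijective _ _).2

instance : (toBig R).Faithful where
  map_injective {_ _} := by exact fun _ _ h => (toBig_bijective _ _).1 h

end Resolutions

/-! ### Morphisms from bounded complexes of finitely generated modules to shifted modules -/

section Vanishing

attribute [local instance] HasDerivedCategory.standard

open DerivedCategory Pretriangulated ZeroObject Triangulated

variable {R : Type u} [Ring R]

/-- Morphisms to a shifted module, as morphisms to the module in the corresponding degree. -/
abbrev toSingle {X : DerivedCategory (ModuleCat.{u} R)} {M : ModuleCat.{u} R} {n : ℤ}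
    (g : ShiftedHom X ((singleFunctor (ModuleCat.{u} R) 0).obj M) n) :
    X ⟶ Q.obj ((CochainComplex.singleFunctor (ModuleCat.{u} R) (-n)).obj M) :=
  g ≫ ((singleFunctors (ModuleCat.{u} R)).shiftIso n (-n) 0 (by lia)).hom.app M

lemma toSingle_eq_zero {X : DerivedCategory (ModuleCat.{u} R)} {M : ModuleCat.{u} R} {n : ℤ}
    (g : ShiftedHom X ((singleFunctor (ModuleCat.{u} R) 0).obj M) n) (h : toSingle g = 0) :
    g = 0 := by
  let e := ((singleFunctors (ModuleCat.{u} R)).shiftIso n (-n) 0 (by lia)).app M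
  have h' : g ≫ e.hom = 0 := h
  exact e.eq_comp_inv.2 h' |>.trans Limits.zero_comp

/-- A linear map from a finitely generated module to a projective module factors through a
finitely generated free module, in such a way that it has the same kernel as the first factor. -/
lemma exists_factor_free {M P : Type u} [AddCommGroup M] [Module R M] [Module.Finite R M]
    [AddCommGroup P] [Module R P] [Module.Projective R P] (f : M →ₗ[R] P) :
    ∃ (n : ℕ) (v : M →ₗ[R] (Fin n → R)) (w : (Fin n → R) →ₗ[R] P), w ∘ₗ v = f ∧
      LinearMap.ker f ≤ LinearMap.ker v := by
  classical
  obtain ⟨σ, hσ⟩ := Module.projective_def'.1 ‹Module.Projective R P›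
  obtain ⟨s, hs⟩ := (Module.finite_def (R := R) (M := M)).1 inferInstance
  -- The basis vectors occurring in `σ ∘ f`: finitely many, since `M` is generated by the finite set
  -- `s`. They index the free module through which `f` factors.
  let S : Finset P := s.biUnion fun x => (σ (f x)).support
  have hS (x : M) : (σ (f x)).support ⊆ S := by
    have : LinearMap.range (σ ∘ₗ f) ≤ Finsupp.supported R R (S : Set P) := by
      rw [LinearMap.range_eq_map, ← hs, Submodule.map_span, Submodule.span_le]
      rintro _ ⟨y, hy, rfl⟩
      rw [SetLike.mem_coe, Finsupp.mem_supported]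
      exact_mod_cast Finset.subset_biUnion_of_mem (fun x => (σ (f x)).support) hy
    have := this ⟨x, rfl⟩
    rw [Finsupp.mem_supported] at this
    exact_mod_cast this
  let e := S.equivFin
  refine ⟨S.card, LinearMap.pi fun i => Finsupp.lapply (e.symm i : P) ∘ₗ σ ∘ₗ f,
    Fintype.linearCombination R (fun i => (e.symm i : P)), LinearMap.ext fun x => ?_,
    fun x hx => ?_⟩
  · have h := LinearMap.congr_fun hσ (f x)
    rw [LinearMap.comp_apply, Finsupp.linearCombination_apply, LinearMap.id_apply,
      Finsupp.sum_of_support_subset _ (hS x) _ (by simp)] at h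
    rw [LinearMap.comp_apply, Fintype.linearCombination_apply]
    refine Eq.trans ?_ h
    rw [← Finset.sum_coe_sort S]
    exact e.symm.sum_comp (fun p : S => (σ (f x)) (p : P) • (p : P))
  · rw [LinearMap.mem_ker] at hx ⊢
    ext i
    simp [hx]

variable [IsNoetherianRing R]

lemma exists_Q_map_eq {C : Type*} [Category* C] [Abelian C] [HasDerivedCategory C]
    (K L : CochainComplex C ℤ) [K.IsKProjective] (g : Q.obj K ⟶ Q.obj L) :
    ∃ γ : K ⟶ L, Q.map γ = g := by
  obtain ⟨f, hf⟩ := (CochainComplex.IsKProjective.Qh_map_bijective K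
    ((HomotopyCategory.quotient _ _).obj L)).2 g
  obtain ⟨f, rfl⟩ := (HomotopyCategory.quotient _ _).map_surjective f
  exact ⟨f, hf⟩

lemma exists_chainMap (K : CochainComplex (FGModuleCat.{u} R) ℤ) (b : ℤ) [K.IsStrictlyLE b]
    [∀ i, Projective (K.X i)] (L : CochainComplex (ModuleCat.{u} R) ℤ)
    (g : (incl R).mapDerivedCategory.obj (Q.obj K) ⟶ Q.obj L) :
    ∃ γ : ((incl R).mapHomologicalComplex (.up ℤ)).obj K ⟶ L,
      g = (incl R).mapDerivedCategoryFactors.hom.app K ≫ Q.map γ := by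
  have hK' := isKProjective_incl K b
  obtain ⟨γ, hγ⟩ := exists_Q_map_eq _ L ((incl R).mapDerivedCategoryFactors.inv.app K ≫ g)
  exact ⟨γ, by rw [hγ]; simp⟩

/-- A morphism from a perfect complex to a module in a sufficiently negative degree vanishes. -/
lemma perf_hom_eq_zero (N : DbMod R) (hN : perfBounded R N) : ∃ c : ℤ, ∀ (n : ℤ), c < n →
    ∀ (M : ModuleCat.{u} R)
      (g : ShiftedHom ((toBig R).obj N) ((singleFunctor (ModuleCat.{u} R) 0).obj M) n), g = 0 := by
  obtain ⟨K, a, b, ha, hb, hK, ⟨e⟩⟩ := hN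
  have hK' (i : ℤ) : Projective (K.X i) := by
    have := hK i
    exact projective_of_module_projective _
  -- For `n > -a` the degree `-n` lies below the bound `a` of the complex `K`, so every chain map to
  -- a module in degree `-n` is zero.
  refine ⟨-a, fun n hn M g => ?_⟩
  obtain ⟨γ, hγ⟩ := exists_chainMap K b _ ((incl R).mapDerivedCategory.map e.inv ≫ toSingle g)
  have hγ₀ : γ = 0 := HomologicalComplex.to_single_hom_ext
    (((incl R).map_isZero (K.isZero_of_isStrictlyGE a (-n) (by lia))).eq_of_src _ _)
  rw [hγ₀, Functor.map_zero, Limits.comp_zero, Preadditive.IsIso.comp_left_eq_zero] at hγ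
  exact toSingle_eq_zero g hγ

/-- The kernel and the cokernel of precomposition with `s` are controlled by morphisms from the cone
`N` and from `N[-1]`, which vanish in large degrees. The bound `c` depends on `s` only and not on
`M`; this lets `M = Ω^p(A)` vary together with `n`. -/
lemma trW_precomp_bijective {X' X : DbMod R} (s : X' ⟶ X) (hs : (perfBounded R).trW s) :
    ∃ c : ℤ, ∀ (n : ℤ), c < n → ∀ (M : ModuleCat.{u} R), Function.Bijective
      (fun g : ShiftedHom ((toBig R).obj X) ((singleFunctor (ModuleCat.{u} R) 0).obj M) n =>
        ((toBig R).map s ≫ g : ShiftedHom _ _ n)) := by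
  obtain ⟨N, f, h, hT, hN⟩ := hs
  obtain ⟨c, hc⟩ := perf_hom_eq_zero N hN
  obtain ⟨c', hc'⟩ := perf_hom_eq_zero (N⟦(-1 : ℤ)⟧) ((perfBounded R).le_shift (-1) _ hN)
  have hT₁ := (toBig R).map_distinguished _ hT
  have hT₂ := (toBig R).map_distinguished _ (inv_rot_of_distTriang _ hT)
  refine ⟨max c c', fun n hn M => ⟨fun g g' hg => ?_, fun g => ?_⟩⟩
  · have h₀ : (toBig R).map s ≫ (g - g') = 0 := by
      rw [Preadditive.comp_sub]
      exact sub_eq_zero.2 hg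
    obtain ⟨g₁, hg₁⟩ := Triangle.yoneda_exact₂ _ hT₁ (g - g') h₀
    have h₁ : g₁ = 0 := hc n (by lia) M g₁
    rw [h₁, Limits.comp_zero] at hg₁
    exact sub_eq_zero.1 hg₁
  · obtain ⟨g₁, hg₁⟩ := Triangle.yoneda_exact₂ _ hT₂ g (hc' n (by lia) M _)
    exact ⟨g₁, hg₁.symm⟩

lemma comp_cancel_middle {C : Type*} [Category* C] {X Y Y' Z Z' : C} {a : X ⟶ Y} {i : Y ⟶ Y'}
    {i' : Y' ⟶ Y} {j : Y ⟶ Z} {j' : Z ⟶ Y} {w : Y ⟶ Z'} (hi : i ≫ i' = 𝟙 Y) (hj : j ≫ j' = 𝟙 Y) :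
    (a ≫ i) ≫ (i' ≫ j) ≫ j' ≫ w = a ≫ w := by
  simp only [Category.assoc, reassoc_of% hi, reassoc_of% hj]

open HomologicalComplex in
-- A chain map to a module in one degree is a linear map on `K^j` killing the boundaries. Factoring
-- it through a finitely generated free module gives chain maps again, provided that the first
-- factor still kills them.
lemma exists_factor_single (K : CochainComplex (FGModuleCat.{u} R) ℤ) (j : ℤ) (P : ModuleCat.{u} R)
    [Module.Projective R P]
    (γ : ((incl R).mapHomologicalComplex (.up ℤ)).obj K ⟶ (single _ (.up ℤ) j).obj P) :
    ∃ (N : FGModuleCat.{u} R) (_ : Module.Projective R N) (φ : K ⟶ (single _ (.up ℤ) j).obj N)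
      (w : (incl R).obj N ⟶ P), γ = ((incl R).mapHomologicalComplex (.up ℤ)).map φ ≫
        (singleMapHomologicalComplex (incl R) (.up ℤ) j).hom.app N ≫ (single _ (.up ℤ) j).map w := by
  let γ₀ : (incl R).obj (K.X j) ⟶ P := γ.f j ≫ (singleObjXSelf (.up ℤ) j P).hom
  have : Module.Finite R ((incl R).obj (K.X j)) := inferInstanceAs (Module.Finite R (K.X j))
  obtain ⟨r, v, w, hvw, hker⟩ := exists_factor_free γ₀.hom
  let N : FGModuleCat.{u} R := FGModuleCat.of R (Fin r → R)
  let v' : K.X j ⟶ N := FGModuleCat.ofHom v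
  let w' : (incl R).obj N ⟶ P := ModuleCat.ofHom w
  have hvw' : (incl R).map v' ≫ w' = γ₀ := ModuleCat.hom_ext hvw
  -- Here it matters that `v` has no smaller kernel than `γ₀`.
  have hv' (i : ℤ) : K.d i j ≫ v' = 0 := by
    have h₁ : (incl R).map (K.d i j) ≫ γ₀ = 0 := by
      have h := γ.comm i j
      rw [single_obj_d, Limits.comp_zero] at h
      exact (Category.assoc _ _ _).symm.trans
        ((congrArg (· ≫ (singleObjXSelf (.up ℤ) j P).hom) h.symm).trans Limits.zero_comp)
    refine FGModuleCat.hom_ext (LinearMap.ext fun x => hker ?_)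
    exact congrArg (fun t : (incl R).obj (K.X i) ⟶ P => t.hom x) h₁
  refine ⟨N, inferInstanceAs (Module.Projective R (Fin r → R)),
    mkHomToSingle v' (fun i _ => hv' i), w', to_single_hom_ext ?_⟩
  rw [← cancel_mono (singleObjXSelf (.up ℤ) j P).hom]
  refine hvw'.symm.trans ?_
  have h : (((incl R).mapHomologicalComplex (.up ℤ)).map
      (mkHomToSingle v' (fun i _ => hv' i))).f j =
        (incl R).map v' ≫ (incl R).map (singleObjXSelf (.up ℤ) j N).inv :=
    (congrArg (incl R).map (mkHomToSingle_f ..)).trans ((incl R).map_comp ..)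
  rw [comp_f, comp_f, Category.assoc, Category.assoc, singleMapHomologicalComplex_hom_app_self,
    single_map_f_self, h]
  simp only [Category.assoc, Iso.inv_hom_id, Category.comp_id]
  exact (comp_cancel_middle ((incl R).mapIso (singleObjXSelf (.up ℤ) j N)).inv_hom_id
    (Iso.inv_hom_id _)).symm

instance (N : FGModuleCat.{u} R) [Module.Projective R N] (i j : ℤ) :
    Module.Projective R ((((CochainComplex.singleFunctor (FGModuleCat.{u} R) j).obj N).X i)) := by
  have := projective_of_module_projective N
  by_cases h : i = j
  · subst h
    have : Projective (((CochainComplex.singleFunctor (FGModuleCat.{u} R) i).obj N).X i) :=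
      Projective.of_iso (HomologicalComplex.singleObjXSelf (.up ℤ) i N).symm this
    exact module_projective_of_projective _
  · have : Projective (((CochainComplex.singleFunctor (FGModuleCat.{u} R) j).obj N).X i) :=
      (HomologicalComplex.isZero_single_obj_X (.up ℤ) j N i h).projective
    exact module_projective_of_projective _

lemma mapDerivedCategoryFactors_app_Q_map {K K' : CochainComplex (FGModuleCat.{u} R) ℤ}
    (φ : K ⟶ K') {L : CochainComplex (ModuleCat.{u} R) ℤ}
    (ψ : ((incl R).mapHomologicalComplex (.up ℤ)).obj K' ⟶ L) :
    (incl R).mapDerivedCategoryFactors.hom.app K ≫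
      Q.map (((incl R).mapHomologicalComplex (.up ℤ)).map φ ≫ ψ) =
    (incl R).mapDerivedCategory.map (Q.map φ) ≫
      (incl R).mapDerivedCategoryFactors.hom.app K' ≫ Q.map ψ := by
  have h := (incl R).mapDerivedCategoryFactors.hom.naturality φ
  rw [Q.map_comp]
  refine (Category.assoc _ _ _).symm.trans ?_
  exact (congrArg (· ≫ Q.map ψ) h.symm).trans (Category.assoc _ _ _)

lemma comp_eq_zero_of_factor {C : Type*} [Category* C] [Preadditive C] {X' X X₀ Y Z : C}
    {s : X' ⟶ X} {g : X ⟶ Z} {e : X ⟶ X₀} {e' : X₀ ⟶ X} (he : e ≫ e' = 𝟙 X) {a : X₀ ⟶ Y}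
    {b : Y ⟶ Z} (h : e' ≫ g = a ≫ b) (h₀ : s ≫ e ≫ a = 0) : s ≫ g = 0 := by
  have h₁ : g = e ≫ a ≫ b := by rw [← h, reassoc_of% he]
  rw [h₁, ← Category.assoc e, ← Category.assoc, h₀, Limits.zero_comp]

/-- A morphism from a bounded complex of finitely generated modules to a projective module
vanishes up to perfect complexes. -/
lemma locallyZero_of_projective (P : ModuleCat.{u} R) [Module.Projective R P] :
    LocallyZero (perfBounded R).trW (toBig R) ((singleFunctor (ModuleCat.{u} R) 0).obj P) := by
  intro X n g
  obtain ⟨K, b, hb, hK, ⟨e⟩⟩ := resolvable_bounded X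
  let G := (incl R).mapDerivedCategory
  obtain ⟨γ, hγ⟩ := exists_chainMap K b _ (G.map e.inv ≫ toSingle g)
  obtain ⟨N, hN, φ, w, rfl⟩ := exists_factor_single K (-n) P γ
  let Nb : DbMod R := ⟨Q.obj ((CochainComplex.singleFunctor (FGModuleCat.{u} R) (-n)).obj N),
    ⟨-n, inferInstance⟩, ⟨-n, inferInstance⟩⟩
  have hNb : perfBounded R Nb :=
    ⟨_, -n, -n, inferInstance, inferInstance, fun i => inferInstance, ⟨Iso.refl _⟩⟩
  let h : X ⟶ Nb := ObjectProperty.homMk (e.hom ≫ Q.map φ)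
  -- The denominator is the fibre of `h : X → N[n]`: its cone is the perfect complex `Nb`, and `s ≫
  -- h = 0` kills everything factoring through `h`.
  obtain ⟨X', s, h', hT⟩ := distinguished_cocone_triangle₁ h
  refine ⟨X', s, ⟨Nb, h, h', hT, hNb⟩, toSingle_eq_zero _ ?_⟩
  have h₁ : (toBig R).map s ≫ G.map e.hom ≫ G.map (Q.map φ) = 0 := by
    have h₂ : s ≫ h = 0 := comp_distTriang_mor_zero₁₂ _ hT
    have h₃ := (toBig R).map_comp s h
    rw [h₂, Functor.map_zero] at h₃
    exact (congrArg ((toBig R).map s ≫ ·) (G.map_comp _ _)).symm.trans h₃.symm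
  exact (Category.assoc _ _ _).trans (comp_eq_zero_of_factor ((G.mapIso e).hom_inv_id)
    (hγ.trans (mapDerivedCategoryFactors_app_Q_map φ _)) h₁)

end Vanishing

/-! ### The bar resolution -/

section BarAlgebra

variable {k A : Type u} [Field k] [Ring A] [Algebra k A]

instance (n : ℕ) : Module.Free k (Tens k A n) := by
  induction n with
  | zero => exact Module.Free.of_equiv (TensorPower.algebraMap₀ (R := k) (M := Red k A))
  | succ n ih => exact Module.Free.of_equiv (Tens.snoc k A n)

lemma Forms.tmul_smul (p : ℕ) (a : A) (b : Aᵐᵒᵖ) (y : Forms k A p) :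
    ((a ⊗ₜ b : Env k A) • y) = a • rightAct p y b.unop := rfl

namespace BarTerm

lemma tmul_smul (n : ℕ) (a : A) (b : Aᵐᵒᵖ) (y : BarTerm k A n) :
    ((a ⊗ₜ b : Env k A) • y) = a • b • y := rfl

lemma tmul_smul_mk (n : ℕ) (a : A) (b : Aᵐᵒᵖ) (y : Forms k A n) (c : A) :
    ((a ⊗ₜ b : Env k A) • mk n y c) = mk n (a • y) (c * b.unop) := rfl

/-- The identification of the free bimodule on `Ā^{⊗ n}` with `Bar_n(A)`. -/
def freeEquiv (k A : Type u) [Field k] [Ring A] [Algebra k A] (n : ℕ) :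
    Env k A ⊗[k] Tens k A n ≃ₗ[k] BarTerm k A n :=
  (TensorProduct.rightComm k A Aᵐᵒᵖ (Tens k A n)).trans
    (TensorProduct.congr (LinearEquiv.refl k (Forms k A n)) (MulOpposite.opLinearEquiv k).symm)

lemma freeEquiv_tmul (n : ℕ) (a : A) (b : Aᵐᵒᵖ) (x : Tens k A n) :
    freeEquiv k A n ((a ⊗ₜ b) ⊗ₜ x) = mk n (Forms.mk n a x) b.unop := rfl

lemma freeEquiv_smul (n : ℕ) (r : Env k A) (z : Env k A ⊗[k] Tens k A n) :
    freeEquiv k A n (r • z) = r • freeEquiv k A n z := by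
  induction z using TensorProduct.induction_on with
  | zero => rw [smul_zero, map_zero, smul_zero]
  | add z z' h h' => rw [smul_add, map_add, map_add, smul_add, h, h']
  | tmul s x =>
    induction s using TensorProduct.induction_on with
    | zero => rw [zero_tmul, smul_zero, map_zero, smul_zero]
    | add s s' h h' => rw [add_tmul, smul_add, map_add, map_add, smul_add, h, h']
    | tmul a b =>
      induction r using TensorProduct.induction_on with
      | zero =>
        exact ((congrArg _ (zero_smul (Env k A) _)).trans (freeEquiv k A n).map_zero).trans
          (zero_smul (Env k A) _).symm
      | add r r' h h' => rw [add_smul, map_add, add_smul, h, h']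
      | tmul c d =>
        rw [TensorProduct.smul_tmul', smul_eq_mul, Algebra.TensorProduct.tmul_mul_tmul,
          freeEquiv_tmul, freeEquiv_tmul, tmul_smul_mk, Forms.smul_mk, MulOpposite.unop_mul]

instance (n : ℕ) : Module.Projective (Env k A) (BarTerm k A n) :=
  Module.Projective.of_equiv (M := Env k A ⊗[k] Tens k A n) (LinearEquiv.ofBijective
    ({ toFun := freeEquiv k A n
       map_add' := map_add _
       map_smul' := freeEquiv_smul n } : Env k A ⊗[k] Tens k A n →ₗ[Env k A] BarTerm k A n)
    (freeEquiv k A n).bijective)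

/-- The map `Ω^{n+1}(A) → Bar_n(A)`, `y ⊗ c̄ ↦ y ⊗ c - (y ◂ c) ⊗ 1`. -/
def ofForms (n : ℕ) : Forms k A (n + 1) →ₗ[k] BarTerm k A n :=
  Forms.liftSnoc n (mk n - (Forms.rightAct n).compr₂ ((mk n).flip 1)) (fun y => by
    change mk n y 1 - mk n (Forms.rightAct n y 1) 1 = 0
    rw [Forms.rightAct_one, sub_self])

lemma ofForms_snoc (n : ℕ) (y : Forms k A n) (c : A) :
    ofForms n (Forms.snoc n (y ⊗ₜ bar c)) = mk n y c - mk n (Forms.rightAct n y c) 1 := by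
  rw [ofForms, Forms.liftSnoc_snoc]
  rfl

lemma ofForms_smul (n : ℕ) (a : A) (y : Forms k A (n + 1)) :
    ofForms n (a • y) = a • ofForms n y := by
  induction y using Forms.induction_snoc with
  | hmk y c =>
    rw [Forms.smul_snoc, ofForms_snoc, ofForms_snoc, smul_sub, smul_mk, smul_mk,
      Forms.rightAct_smul]
  | hadd y z hy hz => simp only [smul_add, map_add, hy, hz]

lemma ofForms_op_smul (n : ℕ) (a : Aᵐᵒᵖ) (y : Forms k A (n + 1)) :
    ofForms n (a • y) = a • ofForms n y := by
  induction y using Forms.induction_snoc with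
  | hmk y c =>
    rw [Forms.op_smul_def, Forms.rightAct_snoc, map_sub, ofForms_snoc, ofForms_snoc,
      ofForms_snoc, smul_sub, op_smul_mk, op_smul_mk, Forms.rightAct_mul, one_mul]
    abel
  | hadd y z hy hz => simp only [smul_add, map_add, hy, hz]

/-- The projection `Bar_n(A) → Ω^n(A)`, `y ⊗ a ↦ y ◂ a`. -/
def toForms (n : ℕ) : BarTerm k A n →ₗ[k] Forms k A n := ofCochain (Cochain.unit n)

lemma toForms_mk (n : ℕ) (y : Forms k A n) (a : A) :
    toForms n (mk n y a) = Forms.rightAct n y a := by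
  rw [toForms, ofCochain_mk, Cochain.ext_unit, LinearMap.id_apply]

/-- The `k`-linear retraction `y ⊗ a ↦ y ⊗ ā` of the inclusion `Ω^{n+1}(A) → Bar_n(A)`. -/
def retract (n : ℕ) : BarTerm k A n →ₗ[k] Forms k A (n + 1) :=
  (Forms.snoc n).toLinearMap ∘ₗ bar.lTensor (Forms k A n)

lemma retract_mk (n : ℕ) (y : Forms k A n) (a : A) :
    retract n (mk n y a) = Forms.snoc n (y ⊗ₜ bar a) := rfl

lemma retract_ofForms (n : ℕ) (y : Forms k A (n + 1)) : retract n (ofForms n y) = y := by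
  induction y using Forms.induction_snoc with
  | hmk y c =>
    rw [ofForms_snoc, map_sub, retract_mk, retract_mk, Forms.bar_one, tmul_zero, map_zero,
      sub_zero]
  | hadd y z hy hz => rw [map_add, map_add, hy, hz]

lemma toForms_ofForms (n : ℕ) (y : Forms k A (n + 1)) : toForms n (ofForms n y) = 0 := by
  induction y using Forms.induction_snoc with
  | hmk y c =>
    rw [ofForms_snoc, map_sub, toForms_mk, toForms_mk, Forms.rightAct_one, sub_self]
  | hadd y z hy hz => rw [map_add, map_add, hy, hz, add_zero]

/-- The `k`-linear splitting of `Ω^{n+1}(A) → Bar_n(A) → Ω^n(A)`, with section `y ↦ y ⊗ 1` of the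
projection. All exactness statements about the bar complex follow from it. -/
lemma ofForms_retract (n : ℕ) (y : BarTerm k A n) :
    ofForms n (retract n y) + mk n (toForms n y) 1 = y := by
  induction y using BarTerm.induction with
  | hmk y a => rw [retract_mk, ofForms_snoc, toForms_mk, sub_add_cancel]
  | hadd y z hy hz =>
    nth_rw 3 [← hy, ← hz]
    simp only [map_add, LinearMap.add_apply]
    abel

lemma toForms_mk_one (n : ℕ) (y : Forms k A n) : toForms n (mk n y 1) = y := by
  rw [toForms_mk, Forms.rightAct_one]

/-- The bar complex is spliced from the syzygy sequences. The sign `(-1)^{n+1}` is the one that a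
connecting morphism introduces on cocycles of a resolution, so that no sign remains in
`kappa_unit_succ`. -/
lemma d_eq (n : ℕ) (y : BarTerm k A (n + 1)) :
    d n y = (-1 : k) ^ (n + 1) • ofForms n (toForms (n + 1) y) := by
  induction y using BarTerm.induction_snoc with
  | hmk y c b =>
    rw [d_mk, toForms_mk, Forms.rightAct_snoc, map_sub, ofForms_snoc, ofForms_snoc,
      Forms.rightAct_mul]
    congr 1
    abel
  | hadd y z hy hz => simp only [map_add, hy, hz, smul_add]

lemma exists_ofForms_eq (n : ℕ) {y : BarTerm k A n} (hy : toForms n y = 0) :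
    ∃ z, ofForms n z = y :=
  ⟨retract n y, by simpa [hy] using ofForms_retract n y⟩

lemma exists_d_eq (n : ℕ) {y : BarTerm k A n} (hy : toForms n y = 0) : ∃ z, d n z = y := by
  obtain ⟨z, rfl⟩ := exists_ofForms_eq n hy
  -- `z ⊗ 1` is a preimage of `z` under `toForms`; the scalar cancels the sign in `d_eq`.
  refine ⟨(-1 : k) ^ (n + 1) • mk (n + 1) z 1, ?_⟩
  rw [map_smul, d_eq, toForms_mk_one, smul_smul, ← mul_pow]
  simp

lemma toForms_eq_zero (n : ℕ) {y : BarTerm k A (n + 1)} (hy : d n y = 0) :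
    toForms (n + 1) y = 0 := by
  rw [d_eq, smul_eq_zero_iff_right (by simp)] at hy
  rw [← retract_ofForms n (toForms (n + 1) y), hy, map_zero]

lemma toForms_zero (y : BarTerm k A 0) :
    toForms 0 y = Forms.mk 0 (aug y) (TensorPower.algebraMap₀ (1 : k)) := by
  induction y using BarTerm.induction_zero with
  | hmk a b => rw [toForms_mk, aug_one, Forms.rightAct_zero]
  | hadd y z hy hz => rw [map_add, map_add, hy, hz, map_add, LinearMap.add_apply]

lemma aug_surjective : Function.Surjective (aug (k := k) (A := A)) := fun a =>
  ⟨mk 0 (Forms.mk 0 a (TensorPower.algebraMap₀ (1 : k))) 1, by rw [aug_one, mul_one]⟩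

end BarTerm

/-- A map of bimodules `Bar_n(A) → Ω^p(A)` is given by a cochain. -/
lemma exists_ofCochain_eq {n p : ℕ} (F : BarTerm k A n →ₗ[Env k A] Forms k A p) :
    ∃ f : Cochain k A n p, ∀ y, BarTerm.ofCochain f y = F y := by
  have hF (r : k) (y : BarTerm k A n) : F (r • y) = r • F y := by
    have h := F.map_smul ((algebraMap k A r) ⊗ₜ 1) y
    rw [BarTerm.tmul_smul, Forms.tmul_smul, one_smul, MulOpposite.unop_one, Forms.rightAct_one,
      algebraMap_smul, algebraMap_smul] at h
    exact h
  refine ⟨{ toFun x := F (BarTerm.mk n (Forms.mk n 1 x) 1)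
            map_add' x y := by simp only [map_add, LinearMap.add_apply]
            map_smul' r x := by
              simp only [map_smul, LinearMap.smul_apply, hF, RingHom.id_apply] }, fun y => ?_⟩
  induction y using BarTerm.induction with
  | hmk y b =>
    induction y using Forms.induction with
    | hmk a x =>
      have h := F.map_smul (a ⊗ₜ MulOpposite.op b) (BarTerm.mk n (Forms.mk n 1 x) 1)
      rw [BarTerm.tmul_smul_mk, Forms.smul_mk, mul_one, one_mul, MulOpposite.unop_op,
        Forms.tmul_smul] at h
      rw [h, BarTerm.ofCochain_mk, Cochain.ext_mk, Forms.rightAct_smul]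
      rfl
    | hadd y z hy hz => simp only [map_add, LinearMap.add_apply, hy, hz]
  | hadd y z hy hz => simp only [map_add, hy, hz]

lemma Cochain.ext_eq_ofCochain {n p : ℕ} (f : Cochain k A n p) (y : Forms k A n) :
    ext f y = BarTerm.ofCochain f (BarTerm.mk n y 1) := by
  rw [BarTerm.ofCochain_mk, Forms.rightAct_one]

/-- Composition with the bar differential is the Hochschild differential up to a sign: `(-1)^{n+1}`
comes from `d` and `(-1)^p` from `delta`. -/
lemma BarTerm.ofCochain_d_mk {n p : ℕ} (f : Cochain k A n p) (y : Forms k A (n + 1)) :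
    ofCochain f (d n (mk (n + 1) y 1)) =
      (-1 : k) ^ (n + 1 + p) • Cochain.ext (Cochain.delta f) y := by
  induction y using Forms.induction_snoc with
  | hmk y c =>
    rw [d_mk, map_smul, map_sub, ofCochain_mk, ofCochain_mk, Forms.rightAct_one, mul_one,
      Cochain.ext_delta_snoc, smul_smul, pow_add _ (n + 1), mul_assoc, ← mul_pow]
    simp
  | hadd y z hy hz => simp only [map_add, LinearMap.add_apply, hy, hz, smul_add]

lemma Cochain.delta_eq_zero {n p : ℕ} (f : Cochain k A n p)
    (hf : ∀ y, BarTerm.ofCochain f (BarTerm.d n y) = 0) : delta f = 0 := by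
  refine ext_inj fun y => ?_
  have h := hf (BarTerm.mk (n + 1) y 1)
  rw [BarTerm.ofCochain_d_mk, smul_eq_zero_iff_right (by simp)] at h
  rw [h, show (0 : Cochain k A (n + 1) p) = (0 : k) • 0 by simp, ext_ksmul, zero_smul,
    LinearMap.zero_apply]

lemma Cochain.exists_delta_eq {n p : ℕ} (f : Cochain k A (n + 1) p) (g : Cochain k A n p)
    (h : ∀ y, BarTerm.ofCochain f y = BarTerm.ofCochain g (BarTerm.d n y)) :
    ∃ g', delta g' = f := by
  refine ⟨(-1 : k) ^ (n + 1 + p) • g, ext_inj fun y => ?_⟩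
  rw [ext_eq_ofCochain f, h, BarTerm.ofCochain_d_mk, delta_smul, ext_ksmul, LinearMap.smul_apply]

end BarAlgebra

/-! ### Exactness of the bar complex -/

section BarResolution

attribute [local instance] HasDerivedCategory.standard

variable (k A : Type u) [Field k] [Ring A] [Algebra k A]

instance (n : ℕ) : Projective ((barChain k A).X n) :=
  ModuleCat.projective_of_categoryTheory_projective (ModuleCat.of (Env k A) (BarTerm k A n))

instance : (barCochain k A).IsKProjective := by
  dsimp [barCochain]
  infer_instance

lemma barChain_exactAt_succ (n : ℕ) : (barChain k A).ExactAt (n + 1) := by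
  rw [HomologicalComplex.exactAt_iff' _ (n + 1 + 1) (n + 1) n (by simp) (by simp),
    ShortComplex.moduleCat_exact_iff]
  intro y hy
  have h₁ : (barChain k A).d (n + 1) n y = 0 := hy
  rw [barChain_d] at h₁
  obtain ⟨z, hz⟩ := BarTerm.exists_d_eq (n + 1) (BarTerm.toForms_eq_zero n h₁)
  refine ⟨z, ?_⟩
  change (barChain k A).d (n + 1 + 1) (n + 1) z = y
  rw [barChain_d]
  exact hz

/-- The augmentation `Bar_0(A) → A` as a morphism. -/
abbrev barAugZero : ModuleCat.of (Env k A) (BarTerm k A 0) ⟶ ModuleCat.of (Env k A) A :=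
  ModuleCat.ofHom (bimodMap BarTerm.aug BarTerm.aug_smul BarTerm.aug_op_smul)

lemma barChain_d_comp_aug : (barChain k A).d 1 0 ≫ barAugZero k A = 0 := by
  rw [barChain_d]
  ext y
  exact BarTerm.aug_d y

lemma barAugZero_exact :
    (ShortComplex.mk _ _ (barChain_d_comp_aug k A)).Exact ∧ Epi (barAugZero k A) := by
  refine ⟨?_, (ModuleCat.epi_iff_surjective _).2 BarTerm.aug_surjective⟩
  rw [ShortComplex.moduleCat_exact_iff]
  intro y hy
  have hy' : BarTerm.aug (k := k) (A := A) y = 0 := hy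
  obtain ⟨z, hz⟩ := BarTerm.exists_d_eq (k := k) (A := A) 0 (y := y)
    ((BarTerm.toForms_zero _).trans (by rw [hy', map_zero, LinearMap.zero_apply]))
  refine ⟨z, ?_⟩
  change (barChain k A).d (0 + 1) 0 z = y
  rw [barChain_d]
  exact hz

/-- The normalized bar resolution, as a projective resolution. -/
def barResolution : ProjectiveResolution (ModuleCat.of (Env k A) A) where
  complex := barChain k A
  π := (ChainComplex.toSingle₀Equiv _ _).symm ⟨barAugZero k A, barChain_d_comp_aug k A⟩
  quasiIso := ⟨fun n => by
    cases n
    · rw [ChainComplex.quasiIsoAt₀_iff, ShortComplex.quasiIso_iff_of_zeros']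
      · refine (ShortComplex.exact_and_epi_g_iff_of_iso ?_).2 (barAugZero_exact k A)
        exact ShortComplex.isoMk (Iso.refl _) (Iso.refl _) (Iso.refl _)
          ((Category.id_comp _).trans (Category.comp_id _).symm)
          ((Category.id_comp _).trans (Eq.trans
            (ChainComplex.toSingle₀Equiv_symm_apply_f_zero _ (barChain_d_comp_aug k A)).symm
            (Category.comp_id _).symm))
      all_goals rfl
    · rw [quasiIsoAt_iff_exactAt']
      · apply barChain_exactAt_succ
      · apply ChainComplex.exactAt_succ_single_obj⟩

end BarResolution

lemma ShiftedHom.comp_conj {D : Type*} [Category* D] [HasShift D ℤ] {X Y Z V U U' : D} {n m l : ℤ}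
    (a : X ⟶ Y) (z : ShiftedHom Y Z n) (e : V ≅ Z) (δ : ShiftedHom Z U m) (c : U ⟶ U')
    (h : m + n = l) (h' : m + n = l) :
    ((ShiftedHom.mk₀ (0 : ℤ) rfl a).comp (z.comp (.mk₀ 0 rfl e.inv) (zero_add _))
      (add_zero _)).comp (e.hom ≫ δ ≫ c⟦m⟧' : V ⟶ U'⟦m⟧) h =
      (ShiftedHom.mk₀ 0 rfl a).comp ((z.comp δ h').comp (.mk₀ 0 rfl c) (zero_add _))
        (add_zero _) := by
  subst h
  simp only [ShiftedHom.mk₀_comp, ShiftedHom.comp_mk₀]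
  rw [ShiftedHom.precomp_comp, ← ShiftedHom.comp_precomp]
  simp only [ShiftedHom.comp, Functor.map_comp, Category.assoc, Iso.map_inv_hom_id_assoc]
  congr 3
  exact (shiftFunctorAdd' D m n (m + n) h').inv.naturality c

/-! ### Ext classes given by cocycles on a projective resolution, and connecting morphisms -/

section Connecting

universe w w' v

open CochainComplex CochainComplex.HomComplex

section

variable {C : Type*} [Category* C] [Preadditive C]

/-- The composition of shifted morphisms of complexes corresponds to the composition of cocycles. -/
lemma equivHomShift_symm_comp {K L M : CochainComplex C ℤ} {n m l : ℤ} (z : Cocycle K L n)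
    (z' : Cocycle L M m) (h : m + n = l) (y : Cocycle K M l)
    (hy : y.1 = z.1.comp z'.1 (by lia)) :
    ShiftedHom.comp (Cocycle.equivHomShift.symm z : ShiftedHom K L n)
      (Cocycle.equivHomShift.symm z' : ShiftedHom L M m) h =
        (Cocycle.equivHomShift.symm y : ShiftedHom K M l) := by
  subst h
  ext i
  have h₁ : (Cocycle.equivHomShift.symm z).f i = z.1.v i (i + n) rfl := by
    simp [Cocycle.equivHomShift_symm_apply, Cochain.rightShift_v _ _ _ _ i i _ (i + n) rfl]
    exact Category.comp_id _
  have h₂ : (Cocycle.equivHomShift.symm z').f (i + n) = z'.1.v (i + n) (i + n + m) rfl := by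
    simp [Cocycle.equivHomShift_symm_apply,
      Cochain.rightShift_v _ _ _ _ (i + n) (i + n) _ (i + n + m) rfl]
    exact Category.comp_id _
  have h₃ : (Cocycle.equivHomShift.symm y).f i = y.1.v i (i + n + m) (by lia) ≫
      (M.shiftFunctorObjXIso (m + n) i (i + n + m) (by lia)).inv := by
    simp [Cocycle.equivHomShift_symm_apply,
      Cochain.rightShift_v _ (m + n) 0 (zero_add _) i i (by lia) (i + n + m) (by lia)]
    rfl
  rw [h₃, hy, Cochain.comp_v _ _ _ i (i + n) (i + n + m) rfl rfl]
  dsimp [ShiftedHom.comp]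
  rw [shiftFunctorAdd'_inv_app_f', h₁, h₂]
  simp
  rfl

/-- Compares a degree `n` cocycle with values in `X` in degree `0` with a chain map to `X` placed in
degree `p = -n`. All identifications are transports along equalities of objects, so no sign appears.
-/
lemma equivHomShift_symm_toSingleMk_shiftIso [Limits.HasZeroObject C] (K : CochainComplex C ℤ)
    {X : C} {n p : ℤ} (f : K.X p ⟶ X) (h : p + n = 0) (p' : ℤ) (hp' : p' + 1 = p)
    (hf : K.d p' p ≫ f = 0) (hf' : ∀ i, (ComplexShape.up ℤ).Rel i p → K.d i p ≫ f = 0) :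
    Cocycle.equivHomShift.symm (Cocycle.toSingleMk f h p' hp' hf) ≫
        ((singleFunctors C).shiftIso n p 0 (by lia)).hom.app X =
      HomologicalComplex.mkHomToSingle f hf' := by
  refine HomologicalComplex.to_single_hom_ext ?_
  rw [HomologicalComplex.mkHomToSingle_f]
  have h₁ : (Cocycle.equivHomShift.symm (Cocycle.toSingleMk f h p' hp' hf)).f p =
      (f ≫ (HomologicalComplex.singleObjXSelf (.up ℤ) 0 X).inv) ≫
      (((singleFunctor C 0).obj X).shiftFunctorObjXIso n p 0 (by lia)).inv := by
    simp [Cocycle.equivHomShift_symm_apply,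
      Cochain.rightShift_v _ n 0 (zero_add n) p p (by lia) 0 (by lia)]
    rfl
  have h₂ : ∀ (e : ((singleFunctor C 0).obj X).X 0 = (((singleFunctor C 0).obj X)⟦n⟧).X p)
      (e' : (((singleFunctor C 0).obj X)⟦n⟧).X p = ((singleFunctor C p).obj X).X p),
      eqToHom e ≫ eqToHom e' = eqToHom (e.trans e') := fun _ _ => eqToHom_trans _ _
  have e : ((singleFunctor C 0).obj X).X 0 = (((singleFunctor C 0).obj X)⟦n⟧).X p := by
    rw [← h]; rfl
  have e' : (((singleFunctor C 0).obj X)⟦n⟧).X p = ((singleFunctor C p).obj X).X p := by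
    rw [← e]
    exact (HomologicalComplex.single_obj_X_self (.up ℤ) 0 X).trans
      (HomologicalComplex.single_obj_X_self (.up ℤ) p X).symm
  refine (congrArg (· ≫ _) h₁).trans ?_
  refine (Category.assoc _ _ _).trans ((congrArg (_ ≫ ·) (h₂ e e')).trans ?_)
  refine (Category.assoc _ _ _).trans (congrArg (f ≫ ·) ?_)
  exact eqToHom_trans (HomologicalComplex.single_obj_X_self (.up ℤ) 0 X).symm (e.trans e')

end

variable {C : Type u} [Category.{v} C] [Abelian C] [HasDerivedCategory.{w} C]

open DerivedCategory

/-- The snake lemma on cocycles: lift `z` to a cochain `β` in `S.X₂`; its coboundary comes from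
`S.X₁`, and this `w` represents the image of `z` under the connecting morphism. -/
lemma map_comp_triangleOfSESδ {S : ShortComplex (CochainComplex C ℤ)} (hS : S.ShortExact)
    {K : CochainComplex C ℤ} {n m : ℤ} (h : n + 1 = m) (β : HomComplex.Cochain K S.X₂ n)
    (w : Cocycle K S.X₁ m) (z : Cocycle K S.X₃ n)
    (hz : z.1 = β.comp (Cochain.ofHom S.g) (add_zero n))
    (hw : δ n m β = w.1.comp (Cochain.ofHom S.f) (add_zero m)) :
    (ShiftedHom.map (Cocycle.equivHomShift.symm z : ShiftedHom K S.X₃ n) Q).comp (b := 1)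
        (triangleOfSESδ hS) (by lia) =
      ShiftedHom.map (Cocycle.equivHomShift.symm w : ShiftedHom K S.X₁ m) Q := by
  -- The pair `(-w, β)` is a cocycle in the mapping cone lying over `z`. The third morphism of the
  -- standard triangle is minus the first projection, which turns `-w` back into `w`.
  let l : Cocycle K (mappingCone S.f) n := mappingCone.liftCocycle S.f (-w) β h (by simp [hw])
  have h₁ : (Cocycle.equivHomShift.symm z : ShiftedHom K S.X₃ n) =
      Cocycle.equivHomShift.symm l ≫ (mappingCone.descShortComplex S)⟦n⟧' := by
    rw [← Cocycle.equivHomShift_symm_postcomp]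
    congr 1
    ext1
    simp [l, hz, mappingCone.descShortComplex]
  let γ : ShiftedHom (mappingCone S.f) S.X₁ (1 : ℤ) := (mappingCone.triangle S.f).mor₃
  have h₂ : (Cocycle.equivHomShift.symm w : ShiftedHom K S.X₁ m) =
      ShiftedHom.comp (Cocycle.equivHomShift.symm l : ShiftedHom K (mappingCone S.f) n)
        γ (by lia) := by
    refine (equivHomShift_symm_comp l (-mappingCone.fst S.f) (by lia) w ?_).symm
    simp [l]
  rw [h₁, h₂, ShiftedHom.map_comp]
  refine (congrArg (fun x => ShiftedHom.comp (b := 1) x _ _)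
    (ShiftedHom.map_postcomp _ _)).trans ?_
  refine (ShiftedHom.comp_precomp _ _ _ _).symm.trans ?_
  congr 1
  exact descShortComplex_triangleOfSESδ hS

lemma singleδ_eq {S : ShortComplex C} (hS : S.ShortExact) :
    hS.singleδ = (singleFunctorIsoCompQ C 0).hom.app S.X₃ ≫
      triangleOfSESδ (hS.map_of_exact (HomologicalComplex.single C (ComplexShape.up ℤ) 0)) ≫
        ((singleFunctorIsoCompQ C 0).inv.app S.X₁)⟦(1 : ℤ)⟧' := by
  have h₁ := congrArg (NatTrans.app · S.X₃) (singleFunctorsPostcompQIso_hom_hom C 0)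
  have h₂ := congrArg (NatTrans.app · S.X₁) (singleFunctorsPostcompQIso_inv_hom C 0)
  refine (congrArg (· ≫ _) h₁).trans ?_
  refine congrArg (_ ≫ _ ≫ ·) ?_
  exact congrArg (fun f => (CategoryTheory.shiftFunctor (DerivedCategory C) (1 : ℤ)).map f) h₂

/-- The previous computation for a resolution `R` and a sequence of objects. The sign `(-1)^q` in
`h` is that of the differential of the Hom complex in degree `q`. -/
lemma extMk_hom_comp_singleδ [HasExt.{w'} C] {X : C} (R : ProjectiveResolution X)
    {S : ShortComplex C}
    (hS : S.ShortExact) {p q : ℕ} (hq : p + 1 = q) (β : R.complex.X p ⟶ S.X₂)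
    (w : R.complex.X q ⟶ S.X₁)
    (h : R.complex.d q p ≫ β = (q : ℤ).negOnePow • w ≫ S.f)
    (h₁ : R.complex.d q p ≫ β ≫ S.g = 0) (h₂ : R.complex.d (q + 1) q ≫ w = 0) :
    (R.extMk (β ≫ S.g) q hq h₁).hom.comp (b := 1) hS.singleδ (c := (q : ℤ)) (by lia) =
      (R.extMk w (q + 1) rfl h₂).hom := by
  set T := hS.map_of_exact (HomologicalComplex.single C (ComplexShape.up ℤ) 0)
  have hd : R.cochainComplex.d (-(q : ℤ)) (-(p : ℤ)) =
      (R.cochainComplexXIso (-q) q rfl).hom ≫ R.complex.d q p ≫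
        (R.cochainComplexXIso (-p) p rfl).inv := R.cochainComplex_d _ _ _ _ rfl rfl
  have hd' : R.cochainComplex.d (-((q + 1 : ℕ) : ℤ)) (-(q : ℤ)) =
      (R.cochainComplexXIso (-((q + 1 : ℕ) : ℤ)) (q + 1) rfl).hom ≫ R.complex.d (q + 1) q ≫
        (R.cochainComplexXIso (-q) q rfl).inv := R.cochainComplex_d _ _ _ _ rfl rfl
  have key := map_comp_triangleOfSESδ T (K := R.cochainComplex) (n := p) (m := q) (by lia)
    (Cochain.toSingleMk ((R.cochainComplexXIso (-p) p rfl).hom ≫ β) (by simp))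
    (Cocycle.toSingleMk ((R.cochainComplexXIso (-q) q rfl).hom ≫ w) (by simp)
      (-((q + 1 : ℕ) : ℤ)) (by lia) (by rw [hd']; simp [h₂]))
    (Cocycle.toSingleMk ((R.cochainComplexXIso (-p) p rfl).hom ≫ β ≫ S.g) (by simp)
      (-(q : ℤ)) (by lia) (by simp [hd, h₁])) (by
      refine (congrArg (fun f => Cochain.toSingleMk f (neg_add_cancel (p : ℤ)))
        (Category.assoc _ _ _).symm).trans ?_
      exact Cochain.toSingleMk_postcomp _ _ _) (by
      refine (Cochain.δ_toSingleMk _ _ (q : ℤ) (-(q : ℤ)) (by lia)).trans ?_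
      rw [hd]
      refine Eq.trans ?_ (Cochain.toSingleMk_postcomp _ (neg_add_cancel (q : ℤ)) S.f)
      simp only [Category.assoc, Iso.inv_hom_id_assoc, h]
      rcases Int.units_eq_one_or (q : ℤ).negOnePow with hq | hq <;> simp [hq])
  rw [ProjectiveResolution.extMk_hom, ProjectiveResolution.extMk_hom, singleδ_eq]
  refine (ShiftedHom.comp_conj _ _ ((singleFunctorIsoCompQ C 0).app S.X₃) _ _ _
    (by lia)).trans ?_
  exact congrArg (fun x => (ShiftedHom.mk₀ (0 : ℤ) rfl _).comp
    (ShiftedHom.comp x (.mk₀ (0 : ℤ) rfl _) (zero_add _)) (add_zero _)) key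

lemma Q_map_shiftIso_comp (X : C) (n a a' : ℤ) (h : n + a = a') :
    Q.map (((CochainComplex.singleFunctors C).shiftIso n a a' h).hom.app X) ≫
        (singleFunctorIsoCompQ C a).inv.app X =
      (Q.commShiftIso n).hom.app _ ≫ ((singleFunctorIsoCompQ C a').inv.app X)⟦n⟧' ≫
        ((DerivedCategory.singleFunctors C).shiftIso n a a' h).hom.app X := by
  have h₁ := congrArg (fun t => t.app X) ((singleFunctorsPostcompQIso C).inv.comm n a a' h)
  have h₂ := congrArg (NatTrans.app · X) (singleFunctorsPostcompQIso_inv_hom C a)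
  have h₃ := congrArg (NatTrans.app · X) (singleFunctorsPostcompQIso_inv_hom C a')
  have h₄ : ((Q.commShiftIso n).inv.app _ ≫
      Q.map (((CochainComplex.singleFunctors C).shiftIso n a a' h).hom.app X)) ≫
        (singleFunctorIsoCompQ C a).inv.app X = ((singleFunctorIsoCompQ C a').inv.app X)⟦n⟧' ≫
        ((DerivedCategory.singleFunctors C).shiftIso n a a' h).hom.app X := by
    refine (congrArg (_ ≫ ·) h₂.symm).trans (Eq.trans ?_ (h₁.trans (congrArg (fun t =>
      (CategoryTheory.shiftFunctor (DerivedCategory C) n).map t ≫ _) h₃)))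
    exact congrArg (· ≫ _) (SingleFunctors.postcomp_shiftIso_hom_app _ _ _ _ _ _ _).symm
  rw [← h₄, Category.assoc, Iso.hom_inv_id_app_assoc]

/-- Shows that the Ext class `extMk f` is the morphism obtained by inverting the augmentation and
applying the chain map `f`, as `IsClassOf` requires. -/
lemma Q_map_comp_extMk_hom [HasExt.{w'} C] {X Y : C} (R : ProjectiveResolution X) {n m : ℕ}
    (hm : n + 1 = m)
    (f : R.complex.X n ⟶ Y) (hf : R.complex.d m n ≫ f = 0)
    (hf' : ∀ i, (ComplexShape.up ℤ).Rel i (-(n : ℤ)) → R.cochainComplex.d i (-(n : ℤ)) ≫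
      (R.cochainComplexXIso (-n) n rfl).hom ≫ f = 0) :
    Q.map R.π' ≫ (singleFunctorIsoCompQ C 0).inv.app X ≫ (R.extMk f m hm hf).hom ≫
        ((DerivedCategory.singleFunctors C).shiftIso n (-n) 0 (by lia)).hom.app Y =
      Q.map (HomologicalComplex.mkHomToSingle ((R.cochainComplexXIso (-n) n rfl).hom ≫ f) hf') ≫
        (singleFunctorIsoCompQ C (-n)).inv.app Y := by
  have h₁ := equivHomShift_symm_toSingleMk_shiftIso R.cochainComplex
    ((R.cochainComplexXIso (-n) n rfl).hom ≫ f) (n := n) (by simp) (-(m : ℤ)) (by lia)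
    (hf' _ (by simp; lia)) hf'
  have : IsIso (Q.map R.π') := by
    rw [isIso_Q_map_iff_quasiIso]
    infer_instance
  refine Eq.trans ?_ (congrArg (fun t : R.cochainComplex ⟶
    (CochainComplex.singleFunctor C (-(n : ℤ))).obj Y => Q.map t ≫
      (singleFunctorIsoCompQ C (-n)).inv.app Y) h₁)
  rw [Functor.map_comp, Category.assoc, Q_map_shiftIso_comp, ProjectiveResolution.extMk_hom,
    ShiftedHom.mk₀_comp, ShiftedHom.comp_mk₀, ShiftedHom.map]
  simp only [Category.assoc, Iso.inv_hom_id_app_assoc, IsIso.hom_inv_id_assoc]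

end Connecting

/-! ### The classes of Hochschild cocycles in the derived category of bimodules -/

section Kappa

attribute [local instance] HasDerivedCategory.standard envModule

open DerivedCategory

variable {k A : Type u} [Field k] [Ring A] [Algebra k A]

variable (k A) in
/-- The bimodule `A`, as an object of the derived category. -/
abbrev regularObj : DerivedCategory (ModuleCat.{u} (Env k A)) :=
  (singleFunctor (ModuleCat.{u} (Env k A)) 0).obj (ModuleCat.of (Env k A) A)

variable (k A) in
/-- The bimodule `Ω^p(A)`. -/
abbrev formsMod (p : ℕ) : ModuleCat.{u} (Env k A) := ModuleCat.of (Env k A) (Forms k A p)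

variable (k A) in
/-- The bimodule `Ω^p(A)`, as an object of the derived category. -/
abbrev formsObj (p : ℕ) : DerivedCategory (ModuleCat.{u} (Env k A)) :=
  (singleFunctor (ModuleCat.{u} (Env k A)) 0).obj (formsMod k A p)

/-- The Hochschild differential measures the failure of right linearity, so cocycles are bimodule
maps `Ω^n(A) → Ω^p(A)`. -/
lemma Cochain.ext_rightAct {n p : ℕ} {f : Cochain k A n p} (hf : Cochain.delta f = 0)
    (y : Forms k A n) (c : A) :
    Cochain.ext f (Forms.rightAct n y c) = Forms.rightAct p (Cochain.ext f y) c := by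
  have h := Cochain.ext_delta_snoc f y c
  rw [hf, show (0 : Cochain k A (n + 1) p) = (0 : k) • 0 by simp, Cochain.ext_ksmul, zero_smul,
    LinearMap.zero_apply, eq_comm, smul_eq_zero_iff_right (by simp), sub_eq_zero] at h
  exact h.symm

lemma BarTerm.ofCochain_add {n p : ℕ} (f g : Cochain k A n p) (y : BarTerm k A n) :
    ofCochain (f + g) y = ofCochain f y + ofCochain g y := by
  induction y using BarTerm.induction with
  | hmk y b => simp only [BarTerm.ofCochain_mk, Cochain.ext_add, LinearMap.add_apply, map_add]
  | hadd y z hy hz =>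
    simp only [map_add, hy, hz]
    abel

lemma BarTerm.ofCochain_ksmul {n p : ℕ} (r : k) (f : Cochain k A n p) (y : BarTerm k A n) :
    ofCochain (r • f) y = r • ofCochain f y := by
  induction y using BarTerm.induction with
  | hmk y b => simp only [BarTerm.ofCochain_mk, Cochain.ext_ksmul, LinearMap.smul_apply, map_smul]
  | hadd y z hy hz => simp only [map_add, hy, hz, smul_add]

lemma BarTerm.ext_ofCochain {l n p : ℕ} {f : Cochain k A n p} (hf : Cochain.delta f = 0)
    (g : Cochain k A l n) (y : BarTerm k A l) :
    Cochain.ext f (ofCochain g y) = ofCochain (Cochain.comp rfl f g) y := by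
  induction y using BarTerm.induction with
  | hmk y b =>
    rw [BarTerm.ofCochain_mk, BarTerm.ofCochain_mk, Cochain.ext_comp, Cochain.ext_rightAct hf]
  | hadd y z hy hz => simp only [map_add, hy, hz]

lemma Forms.algebraMap_env_smul {p : ℕ} (r : k) (y : Forms k A p) :
    algebraMap k (Env k A) r • y = r • y := by
  have h : algebraMap k (Env k A) r = (algebraMap k A r) ⊗ₜ 1 := rfl
  rw [h, Forms.tmul_smul, MulOpposite.unop_one, Forms.rightAct_one, algebraMap_smul]

/-- The map of bimodules `Bar_n(A) → Ω^p(A)` defined by a cochain. -/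
def ofCochainHom {n p : ℕ} (f : Cochain k A n p) :
    (barResolution k A).complex.X n ⟶ formsMod k A p :=
  ModuleCat.ofHom (bimodMap (BarTerm.ofCochain f) (BarTerm.ofCochain_smul f)
      (BarTerm.ofCochain_op_smul f))

lemma barResolution_d (n : ℕ) : (barResolution k A).complex.d (n + 1) n =
    ModuleCat.ofHom (bimodMap (BarTerm.d n) (BarTerm.d_smul n) (BarTerm.d_op_smul n)) :=
  barChain_d k A n

lemma barResolution_d_comp {n p : ℕ} {f : Cochain k A n p} (hf : Cochain.delta f = 0) :
    (barResolution k A).complex.d (n + 1) n ≫ ofCochainHom f = 0 := by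
  rw [barResolution_d]
  ext y
  exact BarTerm.ofCochain_d f hf y

/-- The class `A → Ω^p(A)[n]` of a cocycle. -/
def kappa {n p : ℕ} (f : Cochain k A n p) (hf : Cochain.delta f = 0) :
    ShiftedHom (regularObj k A) (formsObj k A p) (n : ℤ) :=
  ((barResolution k A).extMk (ofCochainHom f) (n + 1) rfl (barResolution_d_comp hf)).hom

lemma barAug_eq : barAug k A = (barResolution k A).π' := by
  refine HomologicalComplex.to_single_hom_ext ?_
  refine Eq.trans ?_ ((barResolution k A).π'_f_zero).symm
  refine (HomologicalComplex.mkHomToSingle_f ..).trans ?_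
  refine (Category.assoc _ _ _).trans (congrArg (_ ≫ · ≫ _) ?_)
  exact (ChainComplex.toSingle₀Equiv_symm_apply_f_zero _ (barChain_d_comp_aug k A)).symm

/-- The augmentation is a quasi-isomorphism, so the class is determined by its defining equation;
`kappa f` satisfies it. -/
lemma isClassOf_iff {n p : ℕ} (f : Cochain k A n p) (hf : Cochain.delta f = 0)
    (κ : (singleFunctor (ModuleCat.{u} (Env k A)) 0).obj (ModuleCat.of (Env k A) A) ⟶
      (singleFunctor (ModuleCat.{u} (Env k A)) (-n)).obj (ModuleCat.of (Env k A) (Forms k A p))) :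
    IsClassOf f hf κ ↔ κ = kappa f hf ≫ ((DerivedCategory.singleFunctors
      (ModuleCat.{u} (Env k A))).shiftIso n (-n) 0 (by lia)).hom.app (formsMod k A p) := by
  have h := Q_map_comp_extMk_hom (barResolution k A) rfl (ofCochainHom f)
    (barResolution_d_comp hf) (fun i hi => by
      rw [(barResolution k A).cochainComplex_d i (-n) (n + 1) n (by simp at hi; lia) rfl]
      simp [barResolution_d_comp hf])
  have : IsIso (Q.map (barAug k A)) := by
    rw [isIso_Q_map_iff_quasiIso, barAug_eq]
    exact inferInstanceAs (QuasiIso (barResolution k A).π')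
  have h' : IsClassOf f hf (kappa f hf ≫ ((DerivedCategory.singleFunctors
      (ModuleCat.{u} (Env k A))).shiftIso n (-n) 0 (by lia)).hom.app (formsMod k A p)) := by
    rw [IsClassOf, barAug_eq]
    exact h
  refine ⟨fun h₁ => ?_, fun h₁ => h₁ ▸ h'⟩
  have h₂ := h₁.trans h'.symm
  rwa [cancel_epi, cancel_epi] at h₂

lemma kappa_add {n p : ℕ} (f g : Cochain k A n p) (hf : Cochain.delta f = 0)
    (hg : Cochain.delta g = 0) (h : Cochain.delta (f + g) = 0) :
    kappa (f + g) h = kappa f hf + kappa g hg := by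
  have h₁ : ofCochainHom (f + g) = ofCochainHom f + ofCochainHom g := by
    refine ModuleCat.hom_ext (LinearMap.ext fun y => ?_)
    exact BarTerm.ofCochain_add f g y
  rw [kappa, kappa, kappa, ← Abelian.Ext.add_hom, ProjectiveResolution.add_extMk]
  simp only [h₁]

lemma exists_kappa_eq {n p : ℕ} (κ : ShiftedHom (regularObj k A) (formsObj k A p) (n : ℤ)) :
    ∃ (f : Cochain k A n p) (hf : Cochain.delta f = 0), kappa f hf = κ := by
  obtain ⟨α, rfl⟩ : ∃ α : Abelian.Ext (ModuleCat.of (Env k A) A) (formsMod k A p) n, α.hom = κ :=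
    Abelian.Ext.homEquiv.surjective κ
  obtain ⟨F, hF, rfl⟩ := (barResolution k A).extMk_surjective α (n + 1) rfl
  obtain ⟨f, hf⟩ := exists_ofCochain_eq (k := k) (A := A) F.hom
  obtain rfl : ofCochainHom f = F := ModuleCat.hom_ext (LinearMap.ext hf)
  refine ⟨f, Cochain.delta_eq_zero f fun y => ?_, rfl⟩
  rw [barResolution_d] at hF
  exact congrArg (fun t => t.hom y) hF

lemma exists_delta_eq_of_kappa_eq_zero {n p : ℕ} (f : Cochain k A (n + 1) p)
    (hf : Cochain.delta f = 0) (h : kappa f hf = 0) : ∃ g, Cochain.delta g = f := by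
  rw [kappa, ← Abelian.Ext.zero_hom] at h
  obtain ⟨G, hG⟩ := ((barResolution k A).extMk_eq_zero_iff _ _ _ _ n rfl).1
    (Abelian.Ext.homEquiv.injective h)
  obtain ⟨g, hg⟩ := exists_ofCochain_eq (k := k) (A := A) G.hom
  refine Cochain.exists_delta_eq f g fun y => ?_
  rw [hg]
  rw [barResolution_d] at hG
  exact congrArg (fun t => t.hom y) hG.symm

/-- The map of bimodules `Ω^n(A) → Ω^p(A)` defined by a cocycle. -/
def extHom {n p : ℕ} (f : Cochain k A n p) (hf : Cochain.delta f = 0) :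
    formsMod k A n ⟶ formsMod k A p :=
  ModuleCat.ofHom (bimodMap (Cochain.ext f) (Cochain.ext_smul f)
    (fun _ _ => Cochain.ext_rightAct hf _ _))

lemma kappa_comp_single_map {n p q : ℕ} {f : Cochain k A n p} (hf : Cochain.delta f = 0)
    {g : Cochain k A n q} (hg : Cochain.delta g = 0) (F : formsMod k A p ⟶ formsMod k A q)
    (h : ofCochainHom f ≫ F = ofCochainHom g) :
    (kappa f hf).comp (.mk₀ (0 : ℤ) rfl ((singleFunctor (ModuleCat.{u} (Env k A)) 0).map F))
      (zero_add _) = kappa g hg := by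
  have h₁ := congrArg Abelian.Ext.hom
    ((barResolution k A).extMk_comp_mk₀ (ofCochainHom f) (n + 1) rfl (barResolution_d_comp hf) F)
  simp only [h] at h₁
  rw [kappa, kappa, ← h₁, Abelian.Ext.comp_hom, Abelian.Ext.mk₀_hom]
  rfl

lemma kappa_comp {l n p : ℕ} (f : Cochain k A n p) (hf : Cochain.delta f = 0)
    (g : Cochain k A l n) (hg : Cochain.delta g = 0)
    (h : Cochain.delta (Cochain.comp rfl f g) = 0) :
    kappa (Cochain.comp rfl f g) h = (kappa g hg).comp (.mk₀ (0 : ℤ) rfl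
      ((singleFunctor (ModuleCat.{u} (Env k A)) 0).map (extHom f hf))) (zero_add _) := by
  refine (kappa_comp_single_map hg h _ (ModuleCat.hom_ext (LinearMap.ext fun y => ?_))).symm
  exact BarTerm.ext_ofCochain hf g y

lemma Cochain.comp_unit {n p : ℕ} (f : Cochain k A n p) :
    Cochain.comp rfl f (Cochain.unit n) = f :=
  Cochain.ext_inj fun y => by rw [Cochain.ext_comp, Cochain.ext_unit, LinearMap.id_apply]

/-- Every class is the universal class `ν_n` followed by a bimodule map. This is what makes
stabilization and products natural. -/
lemma kappa_eq {n p : ℕ} (f : Cochain k A n p) (hf : Cochain.delta f = 0) :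
    kappa f hf = (kappa (Cochain.unit n) (Cochain.delta_unit n)).comp (.mk₀ (0 : ℤ) rfl
      ((singleFunctor (ModuleCat.{u} (Env k A)) 0).map (extHom f hf))) (zero_add _) := by
  rw [← kappa_comp f hf _ _ (by rwa [Cochain.comp_unit])]
  simp only [Cochain.comp_unit]

lemma kappa_smul {n p : ℕ} (r : k) (f : Cochain k A n p) (hf : Cochain.delta f = 0)
    (h : Cochain.delta (r • f) = 0) :
    kappa (r • f) h = r • kappa f hf := by
  have : ((singleFunctor (ModuleCat.{u} (Env k A)) 0)).Linear k := inferInstance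
  -- The scalar is realized as the endomorphism `r • 𝟙` of the bimodule `Ω^p(A)`.
  rw [← kappa_comp_single_map hf h (r • 𝟙 _)]
  · rw [ShiftedHom.comp_mk₀, Functor.map_smul, Functor.map_smul]
    simp
  · refine ModuleCat.hom_ext (LinearMap.ext fun y => ?_)
    exact (Forms.algebraMap_env_smul r _).trans (BarTerm.ofCochain_ksmul r f y).symm

variable (k A) in
/-- The short exact sequence `0 → Ω^{p+1}(A) → Bar_p(A) → Ω^p(A) → 0`. -/
def syzygy (p : ℕ) : ShortComplex (ModuleCat.{u} (Env k A)) where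
  X₁ := formsMod k A (p + 1)
  X₂ := ModuleCat.of (Env k A) (BarTerm k A p)
  X₃ := formsMod k A p
  f := ModuleCat.ofHom (bimodMap (BarTerm.ofForms p) (BarTerm.ofForms_smul p)
    (BarTerm.ofForms_op_smul p))
  g := ofCochainHom (Cochain.unit p)
  zero := by
    ext y
    exact BarTerm.toForms_ofForms p y

lemma syzygy_shortExact (p : ℕ) : (syzygy k A p).ShortExact where
  exact := by
    rw [ShortComplex.moduleCat_exact_iff]
    intro y hy
    exact BarTerm.exists_ofForms_eq p hy
  mono_f := (ModuleCat.mono_iff_injective _).2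
    (Function.LeftInverse.injective (BarTerm.retract_ofForms p))
  epi_g := (ModuleCat.epi_iff_surjective _).2
    (Function.RightInverse.surjective (BarTerm.toForms_mk_one p))

variable (k A) in
/-- The connecting morphism `Ω^p(A) → Ω^{p+1}(A)[1]`. -/
def chi (p : ℕ) : ShiftedHom (formsObj k A p) (formsObj k A (p + 1)) (1 : ℤ) :=
  (syzygy_shortExact (k := k) (A := A) p).singleδ

lemma Cochain.delta_theta_eq_zero {n p : ℕ} {f : Cochain k A n p} (hf : Cochain.delta f = 0) :
    Cochain.delta (Cochain.theta f) = 0 := by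
  rw [Cochain.delta_theta, hf]
  simpa using Cochain.theta_smul (0 : k) (0 : Cochain k A (n + 1) p)

/-- The map `F ⊗ id_A : Bar_n(A) → Bar_p(A)` for the bimodule map `F` defined by a cocycle. -/
def BarTerm.mapExt {n p : ℕ} (f : Cochain k A n p) : BarTerm k A n →ₗ[k] BarTerm k A p :=
  TensorProduct.map (Cochain.ext f) LinearMap.id

lemma BarTerm.mapExt_mk {n p : ℕ} (f : Cochain k A n p) (y : Forms k A n) (a : A) :
    mapExt f (mk n y a) = mk p (Cochain.ext f y) a := rfl

lemma BarTerm.mapExt_smul {n p : ℕ} (f : Cochain k A n p) (a : A) (y : BarTerm k A n) :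
    mapExt f (a • y) = a • mapExt f y := by
  induction y using BarTerm.induction with
  | hmk y b => rw [smul_mk, mapExt_mk, mapExt_mk, smul_mk, Cochain.ext_smul]
  | hadd y z hy hz => simp only [smul_add, map_add, hy, hz]

lemma BarTerm.mapExt_op_smul {n p : ℕ} (f : Cochain k A n p) (a : Aᵐᵒᵖ) (y : BarTerm k A n) :
    mapExt f (a • y) = a • mapExt f y := by
  induction y using BarTerm.induction with
  | hmk y b => rw [op_smul_mk, mapExt_mk, mapExt_mk, op_smul_mk]
  | hadd y z hy hz => simp only [smul_add, map_add, hy, hz]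

lemma BarTerm.mapExt_ofForms {n p : ℕ} {f : Cochain k A n p} (hf : Cochain.delta f = 0)
    (y : Forms k A (n + 1)) :
    mapExt f (ofForms n y) = ofForms p (Cochain.ext (Cochain.theta f) y) := by
  induction y using Forms.induction_snoc with
  | hmk y c =>
    rw [Cochain.ext_theta_snoc, BarTerm.ofForms_snoc, BarTerm.ofForms_snoc, map_sub,
      BarTerm.mapExt_mk, BarTerm.mapExt_mk, Cochain.ext_rightAct hf]
  | hadd y z hy hz => simp only [map_add, hy, hz]

lemma BarTerm.toForms_mapExt {n p : ℕ} {f : Cochain k A n p} (hf : Cochain.delta f = 0)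
    (y : BarTerm k A n) : toForms p (mapExt f y) = Cochain.ext f (toForms n y) := by
  induction y using BarTerm.induction with
  | hmk y c =>
    rw [BarTerm.mapExt_mk, BarTerm.toForms_mk, BarTerm.toForms_mk, Cochain.ext_rightAct hf]
  | hadd y z hy hz => simp only [map_add, hy, hz]

/-- The morphism of short exact sequences defined by a cocycle. -/
def syzygyMap {n p : ℕ} (f : Cochain k A n p) (hf : Cochain.delta f = 0) :
    syzygy k A n ⟶ syzygy k A p where
  τ₁ := extHom (Cochain.theta f) (Cochain.delta_theta_eq_zero hf)
  τ₂ := ModuleCat.ofHom (bimodMap (BarTerm.mapExt f) (BarTerm.mapExt_smul f)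
    (BarTerm.mapExt_op_smul f))
  τ₃ := extHom f hf
  comm₁₂ := ModuleCat.hom_ext (LinearMap.ext fun y => (BarTerm.mapExt_ofForms hf y).symm)
  comm₂₃ := ModuleCat.hom_ext (LinearMap.ext fun y => BarTerm.toForms_mapExt hf y)

/-- The bimodule map `F` extends to a morphism of syzygy sequences, `F ⊗ id` on the bar terms, whose
restriction to the kernels is the map defined by `theta f`. -/
lemma chi_naturality {n p : ℕ} (f : Cochain k A n p) (hf : Cochain.delta f = 0) :
    (chi k A n).comp (.mk₀ (0 : ℤ) rfl ((singleFunctor (ModuleCat.{u} (Env k A)) 0).map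
      (extHom (Cochain.theta f) (Cochain.delta_theta_eq_zero hf)))) (zero_add _) =
    (ShiftedHom.mk₀ (0 : ℤ) rfl ((singleFunctor (ModuleCat.{u} (Env k A)) 0).map
      (extHom f hf))).comp (chi k A p) (add_zero _) := by
  rw [ShiftedHom.comp_mk₀, ShiftedHom.mk₀_comp]
  exact (ShortComplex.ShortExact.singleTriangle.map (syzygy_shortExact n) (syzygy_shortExact p)
    (syzygyMap f hf)).comm₃

/-- The identity of `Bar_n(A)` lifts the projection to `Ω^n(A)`, and its composite with the
differential is, up to sign, the projection of `Bar_{n+1}(A)` to `Ω^{n+1}(A)`. -/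
lemma kappa_unit_succ (n : ℕ) :
    kappa (k := k) (A := A) (Cochain.unit (n + 1)) (Cochain.delta_unit _) =
      (kappa (Cochain.unit n) (Cochain.delta_unit n)).comp (chi k A n) (by push_cast; ring) := by
  have h := extMk_hom_comp_singleδ (barResolution k A) (syzygy_shortExact n) rfl
    (𝟙 _) (ofCochainHom (Cochain.unit (n + 1))) (by
      refine (Category.comp_id _).trans ((barResolution_d n).trans ?_)
      refine ModuleCat.hom_ext (LinearMap.ext fun y => (BarTerm.d_eq n y).trans ?_)
      rcases Nat.even_or_odd (n + 1) with h | h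
      · rw [h.neg_one_pow, one_smul, Int.negOnePow_even _ (by exact_mod_cast h), one_smul]
        rfl
      · rw [h.neg_one_pow, neg_one_smul, Int.negOnePow_odd _ (by exact_mod_cast h),
          Units.neg_smul, one_smul]
        rfl) (barResolution_d_comp (Cochain.delta_unit n))
    (barResolution_d_comp (Cochain.delta_unit _))
  exact h.symm

/-- Both sides are `ν_n` followed by `χ_n` and the map of `theta f`, or by the map of `f` and `χ_p`;
these agree by naturality. -/
lemma kappa_theta {n p : ℕ} (f : Cochain k A n p) (hf : Cochain.delta f = 0)
    (h : Cochain.delta (Cochain.theta f) = 0) :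
    kappa (Cochain.theta f) h = (kappa f hf).comp (chi k A p) (by push_cast; ring) := by
  rw [kappa_eq _ h, kappa_unit_succ, kappa_eq f hf, ShiftedHom.comp_assoc', chi_naturality f hf,
    ← ShiftedHom.comp_assoc' _ _ _ (zero_add _) _ (add_zero _)]
  exacts [zero_add _, by push_cast; ring]

lemma BarTerm.ofCochain_smul_d_apply {n p : ℕ} (f : Cochain k A n p) (y : BarTerm k A (n + 1)) :
    ofCochain ((-1 : k) ^ (n + 1 + p) • f) (d n y) = ofCochain (Cochain.delta f) y := by
  induction y using BarTerm.induction_snoc with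
  | hmk y c b =>
    rw [BarTerm.ofCochain_ksmul, d_mk, map_smul, map_sub, ofCochain_mk, ofCochain_mk, ofCochain_mk,
      Cochain.ext_delta_snoc, Forms.rightAct_mul, map_smul, LinearMap.smul_apply, map_sub,
      LinearMap.sub_apply, smul_smul, pow_add _ (n + 1) p, mul_right_comm, ← mul_pow, neg_one_mul,
      neg_neg, one_pow, one_mul]
  | hadd y z hy hz => simp only [map_add, hy, hz]

lemma kappa_delta {n p : ℕ} (g : Cochain k A n p)
    (hg : Cochain.delta (Cochain.delta g) = 0) : kappa (Cochain.delta g) hg = 0 := by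
  rw [kappa, ← Abelian.Ext.zero_hom]
  congr 1
  refine ((barResolution k A).extMk_eq_zero_iff _ _ _ _ n rfl).2
    ⟨ofCochainHom ((-1 : k) ^ (n + 1 + p) • g), ?_⟩
  rw [barResolution_d]
  refine ModuleCat.hom_ext (LinearMap.ext fun y => ?_)
  exact BarTerm.ofCochain_smul_d_apply g y

lemma kappa_stab_eq_zero {n p : ℕ} (f : Cochain k A n p) (hf : Cochain.delta f = 0)
    (h₀ : kappa f hf = 0) (j : ℕ) :
    ∃ h, kappa (Cochain.stab f j) h = 0 := by
  induction j with
  | zero => exact ⟨hf, h₀⟩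
  | succ j ih =>
    obtain ⟨h, hj⟩ := ih
    refine ⟨Cochain.delta_theta_eq_zero h, ?_⟩
    exact (kappa_theta _ h _).trans (by rw [hj, ShiftedHom.zero_comp])

/-- The identification of bimodules `A ≅ Ω^0(A)`. -/
def formsZeroEquiv : A ≃ₗ[k] Forms k A 0 :=
  (TensorProduct.rid k A).symm.trans
    (TensorProduct.congr (LinearEquiv.refl k A) TensorPower.algebraMap₀)

variable (k A) in
/-- The map of bimodules `A → Ω^0(A)`. -/
def toFormsZero : ModuleCat.of (Env k A) A ⟶ formsMod k A 0 :=
  ModuleCat.ofHom (bimodMap formsZeroEquiv.toLinearMap (fun _ _ => rfl) (fun _ _ => rfl))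

instance : IsIso (toFormsZero k A) :=
  (ConcreteCategory.isIso_iff_bijective _).2 (formsZeroEquiv (k := k) (A := A)).bijective

lemma barMap_unit_zero : barMap (Cochain.unit (k := k) (A := A) 0) (Cochain.delta_unit 0) =
    barAug k A ≫ (CochainComplex.singleFunctor (ModuleCat.{u} (Env k A)) 0).map
      (toFormsZero k A) := by
  refine HomologicalComplex.to_single_hom_ext ?_
  refine (HomologicalComplex.mkHomToSingle_f ..).trans ?_
  refine Eq.trans ?_ (congrArg₂ (· ≫ ·) (HomologicalComplex.mkHomToSingle_f ..)
    (HomologicalComplex.single_map_f_self ..)).symm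
  simp only [Category.assoc, Iso.inv_hom_id_assoc]
  refine congrArg (_ ≫ ·) ?_
  refine Eq.trans ?_ (Category.assoc _ _ _)
  refine congrArg (· ≫ _) (ModuleCat.hom_ext (LinearMap.ext fun y => ?_))
  exact BarTerm.toForms_zero y

lemma isIso_kappa_unit_zero :
    IsIso (kappa (k := k) (A := A) (Cochain.unit 0) (Cochain.delta_unit 0)) := by
  have h := (isClassOf_iff (Cochain.unit (k := k) (A := A) 0) (Cochain.delta_unit 0) _).2 rfl
  have : IsIso (Q.map (barAug k A)) := by
    rw [isIso_Q_map_iff_quasiIso, barAug_eq]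
    exact inferInstanceAs (QuasiIso (barResolution k A).π')
  have : IsIso (Q.map (barMap (Cochain.unit (k := k) (A := A) 0) (Cochain.delta_unit 0))) := by
    rw [barMap_unit_zero, Functor.map_comp]
    infer_instance
  rw [IsClassOf] at h
  have h₁ : IsIso (Q.map (barMap (Cochain.unit (k := k) (A := A) 0) (Cochain.delta_unit 0)) ≫
    (singleIso (Env k A) (-(0 : ℕ)) _).hom) := inferInstance
  rw [← h] at h₁
  rwa [isIso_comp_left_iff, isIso_comp_left_iff, isIso_comp_right_iff] at h₁

end Kappa

/-! ### The colimit defining the singular Hochschild complex -/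

section Colimit

variable {k A : Type u} [Field k] [Ring A] [Algebra k A]

lemma Cochain.stab_stab {n p : ℕ} (f : Cochain k A n p) (i j : ℕ) :
    Cochain.stab (Cochain.stab f i) j =
      Cochain.castEq (Nat.add_assoc n i j).symm (Nat.add_assoc p i j).symm
        (Cochain.stab f (i + j)) := by
  induction j with
  | zero => rw [stab_zero]; exact (castEq_rfl _ _ _).symm
  | succ j ih => rw [stab_succ, ih, theta_castEq]; rfl

lemma transition_eq_stab {m : ℤ} {n p j : ℕ} (h : (n : ℤ) = m + p)
    (h' : ((n + j : ℕ) : ℤ) = m + (p + j : ℕ))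
    (hij : (⟨(n, p), h⟩ : Idx m) ≤ ⟨(n + j, p + j), h'⟩) (f : Cochain k A n p) :
    transition m ⟨(n, p), h⟩ ⟨(n + j, p + j), h'⟩ hij f = Cochain.stab f j := by
  have key : ∀ (d : ℕ) (hd : d = j) (h₁ : n + d = n + j) (h₂ : p + d = p + j),
      Cochain.castEq h₁ h₂ (Cochain.stab f d) = Cochain.stab f j := by
    rintro d rfl h₁ h₂
    rw [Cochain.castEq_rfl]
  exact key (p + j - p) (by lia) (by lia) (by lia)

lemma Idx.exists_eq {m : ℤ} {n p : ℕ} {h : (n : ℤ) = m + p} {i : Idx m}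
    (hi : (⟨(n, p), h⟩ : Idx m) ≤ i) :
    ∃ (j : ℕ) (h' : ((n + j : ℕ) : ℤ) = m + (p + j : ℕ)), i = ⟨(n + j, p + j), h'⟩ := by
  obtain ⟨⟨n', p'⟩, h'⟩ := i
  obtain ⟨j, rfl⟩ := Nat.exists_eq_add_of_le (show p ≤ p' from hi.2)
  dsimp only at h'
  obtain rfl : n' = n + j := by push_cast at h'; lia
  exact ⟨j, h', rfl⟩

/-- Functoriality of the transition maps is needed to conclude that a cochain which vanishes in the
colimit vanishes after finitely many stabilizations. -/
instance (m : ℤ) : DirectedSystem (fun i : Idx m => Cochain k A i.1.1 i.1.2)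
    (fun i j hij => transition (k := k) (A := A) m i j hij) where
  map_self := by
    rintro ⟨⟨n, p⟩, h⟩ f
    exact transition_eq_stab (j := 0) h h le_rfl f
  map_map := by
    rintro ⟨⟨n₃, p₃⟩, h₃⟩ ⟨⟨n₂, p₂⟩, h₂⟩ ⟨⟨n, p⟩, h⟩ h₁₂ h₂₃ f
    obtain ⟨i, hi, e⟩ := Idx.exists_eq h₁₂
    cases e
    obtain ⟨j, hj, e⟩ := Idx.exists_eq h₂₃
    cases e
    rw [transition_eq_stab, transition_eq_stab, Cochain.stab_stab]
    have key : ∀ (n' p' : ℕ) (hn : n + (i + j) = n') (hp : p + (i + j) = p')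
        (h : (n' : ℤ) = m + p') (hij : (⟨(n, p), ‹_›⟩ : Idx m) ≤ ⟨(n', p'), h⟩),
        Cochain.castEq hn hp (Cochain.stab f (i + j)) = transition m _ _ hij f := by
      rintro _ _ rfl rfl h hij
      rw [Cochain.castEq_rfl, transition_eq_stab]
    exact key _ _ _ _ _ _

lemma Csg.of_stab {m : ℤ} {n p : ℕ} (h : (n : ℤ) = m + p) (j : ℕ)
    (h' : ((n + j : ℕ) : ℤ) = m + (p + j : ℕ)) (f : Cochain k A n p) :
    Csg.of h' (Cochain.stab f j) = Csg.of h f := by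
  have hij : (⟨(n, p), h⟩ : Idx m) ≤ ⟨(n + j, p + j), h'⟩ :=
    Prod.mk_le_mk.2 ⟨Nat.le_add_right _ _, Nat.le_add_right _ _⟩
  rw [← transition_eq_stab h h' hij]
  exact Csg.of_transition hij f

lemma Csg.exists_stab_eq_zero {m : ℤ} {n p : ℕ} {h : (n : ℤ) = m + p} {f : Cochain k A n p}
    (hf : Csg.of h f = 0) : ∃ j, Cochain.stab f j = 0 := by
  classical
  obtain ⟨i, hi, h₀⟩ := Module.DirectLimit.of.zero_exact hf
  obtain ⟨j, hj, rfl⟩ := Idx.exists_eq hi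
  exact ⟨j, (transition_eq_stab h hj hi f).symm.trans h₀⟩

lemma Cochain.delta_delta {n p : ℕ} (f : Cochain k A n p) : delta (delta f) = 0 := by
  refine ext_inj_snoc fun y c => ?_
  rw [show (0 : Cochain k A (n + 1 + 1) p) = (0 : k) • 0 by simp, ext_ksmul, zero_smul,
    LinearMap.zero_apply, ext_delta_snoc]
  induction y using Forms.induction_snoc with
  | hmk y c' =>
    simp only [Forms.rightAct_snoc, map_sub, ext_delta_snoc, map_smul, LinearMap.sub_apply,
      LinearMap.smul_apply, Forms.rightAct_mul, ← smul_sub]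
    simp
  | hadd y z hy hz =>
    simp only [map_add, LinearMap.add_apply, add_sub_add_comm, smul_add, hy, hz, add_zero]

lemma Cochain.delta_comp_eq_zero {l n n' p : ℕ} (h : n' = n) {f : Cochain k A n p}
    {g : Cochain k A l n'} (hf : delta f = 0) (hg : delta g = 0) : delta (comp h f g) = 0 := by
  have h₀ : ext (0 : Cochain k A (n + 1) p) = 0 := by
    rw [show (0 : Cochain k A (n + 1) p) = (0 : k) • 0 by simp, ext_ksmul, zero_smul]
  rw [delta_comp h f g (by rw [h]), hf, hg, comp, comp, h₀, LinearMap.zero_comp,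
    LinearMap.comp_zero, LinearMap.comp_zero, smul_zero, add_zero]

lemma Cochain.delta_stab_eq_zero {n p : ℕ} {f : Cochain k A n p} (hf : Cochain.delta f = 0)
    (j : ℕ) : Cochain.delta (Cochain.stab f j) = 0 := by
  induction j with
  | zero => exact hf
  | succ j ih => exact Cochain.delta_theta_eq_zero ih

namespace HHsg

lemma exists_cls_eq {m : ℤ} (x : HHsg k A m) :
    ∃ (n p : ℕ) (h : (n : ℤ) = m + p) (f : Cochain k A n p) (hf : Cochain.delta f = 0),
      cls h f hf = x := by
  induction x using Submodule.Quotient.induction_on with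
  | H x =>
    obtain ⟨x, hx⟩ := x
    induction x using Csg.induction with
    | hof n p h f =>
      have hx' := (mem_cocycles (m' := m + 1) rfl _).1 hx
      rw [Csg.delta_of _ h (by push_cast; lia)] at hx'
      -- The representative `f` is a cocycle in the colimit only; its coboundary vanishes after `j`
      -- stabilizations, so `stab f j` is an honest cocycle.
      obtain ⟨j, hj⟩ := Csg.exists_stab_eq_zero hx'
      have h' : ((n + j : ℕ) : ℤ) = m + (p + j : ℕ) := by push_cast; lia
      refine ⟨n + j, p + j, h', Cochain.stab f j, by rw [Cochain.delta_stab, hj, map_zero], ?_⟩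
      unfold cls
      congr 2
      exact Csg.of_stab h j h' f

lemma cls_stab {m : ℤ} {n p : ℕ} (h : (n : ℤ) = m + p) (f : Cochain k A n p)
    (hf : Cochain.delta f = 0) (j : ℕ) (h' : ((n + j : ℕ) : ℤ) = m + (p + j : ℕ)) :
    cls h' (Cochain.stab f j) (Cochain.delta_stab_eq_zero hf j) = cls h f hf := by
  unfold cls
  congr 2
  exact Csg.of_stab h j h' f

lemma cls_add {m : ℤ} {n p : ℕ} (h : (n : ℤ) = m + p) (f g : Cochain k A n p)
    (hf : Cochain.delta f = 0) (hg : Cochain.delta g = 0) (hfg : Cochain.delta (f + g) = 0) :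
    cls h (f + g) hfg = cls h f hf + cls h g hg := by
  unfold cls
  rw [← Submodule.Quotient.mk_add]
  congr 1
  ext1
  exact map_add _ _ _

lemma cls_smul {m : ℤ} {n p : ℕ} (h : (n : ℤ) = m + p) (r : k) (f : Cochain k A n p)
    (hf : Cochain.delta f = 0) (hrf : Cochain.delta (r • f) = 0) :
    cls h (r • f) hrf = r • cls h f hf := by
  unfold cls
  rw [← Submodule.Quotient.mk_smul]
  congr 1
  ext1
  exact map_smul _ _ _

lemma cls_delta {m : ℤ} {n p : ℕ} (h : ((n + 1 : ℕ) : ℤ) = m + p) (g : Cochain k A n p)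
    (hg : Cochain.delta (Cochain.delta g) = 0) : cls h (Cochain.delta g) hg = 0 := by
  refine (Submodule.Quotient.mk_eq_zero _).2 ?_
  refine (mem_coboundaries (m' := m - 1) (by lia) _).2 ⟨Csg.of (by push_cast at h; lia) g, ?_⟩
  exact Csg.delta_of _ _ h _

/-- A primitive exists in the colimit; it is represented at some finite stage, and the equation with
`f` holds after a further `j` stabilizations. -/
lemma exists_stab_eq_stab_delta {m : ℤ} {n p : ℕ} {h : (n : ℤ) = m + p} {f : Cochain k A n p}
    {hf : Cochain.delta f = 0} (h₀ : cls h f hf = 0) :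
    ∃ (i j : ℕ) (g : Cochain k A (n + i) (p + (i + 1))),
      Cochain.stab (Cochain.stab f (i + 1)) j =
        Cochain.stab (n := n + (i + 1)) (p := p + (i + 1)) (Cochain.delta g) j := by
  have h₁ : Csg.of h f ∈ coboundaries k A m := by
    unfold cls at h₀
    exact (Submodule.Quotient.mk_eq_zero
      ((coboundaries k A m).comap (cocycles k A m).subtype)).1 h₀
  obtain ⟨y, hy⟩ := (mem_coboundaries (sub_add_cancel m 1) _).1 h₁
  clear h₀ h₁
  -- The primitive is stabilized until `q ≥ p + 1`; then `l = m - 1 + q ≥ n`, and with `q = p + 1 +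
  -- i` the stage of `delta g` is reached from that of `f` by `i + 1` stabilizations.
  obtain ⟨l, q, hq, g, hpq, rfl⟩ : ∃ (l q : ℕ) (hq : (l : ℤ) = m - 1 + q) (g : Cochain k A l q),
      p + 1 ≤ q ∧ Csg.of hq g = y := by
    induction y using Csg.induction with
    | hof l q hq g =>
      exact ⟨l + (p + 1), q + (p + 1), by push_cast; lia, Cochain.stab g (p + 1), by lia,
        Csg.of_stab hq _ _ g⟩
  obtain ⟨i, rfl⟩ := Nat.exists_eq_add_of_le hpq
  obtain rfl : l = n + i := by push_cast at hq; lia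
  have h₂ : p + 1 + i = p + (i + 1) := by lia
  have hi : ((n + (i + 1) : ℕ) : ℤ) = m + (p + (i + 1) : ℕ) := by push_cast; lia
  let g' : Cochain k A (n + i) (p + (i + 1)) := Cochain.castEq rfl h₂ g
  have h₃ : Csg.of hi (Cochain.stab f (i + 1) - Cochain.delta g') = 0 := by
    rw [map_sub, Csg.of_stab h, ← hy, ← Csg.of_castEq rfl h₂ (by push_cast; lia) hq g, sub_eq_zero]
    exact Csg.delta_of _ _ hi _
  obtain ⟨j, hj⟩ := Csg.exists_stab_eq_zero h₃
  refine ⟨i, j, g', ?_⟩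
  rw [← sub_eq_zero, ← hj, sub_eq_add_neg, sub_eq_add_neg, Cochain.stab_add, ← neg_one_smul k,
    ← neg_one_smul k (Cochain.delta g'), Cochain.stab_smul]

end HHsg

end Colimit

/-! ### The isomorphism -/

section Main

attribute [local instance] HasDerivedCategory.standard envModule

open DerivedCategory

variable {k A : Type u} [Field k] [Ring A] [Algebra k A] [IsNoetherianRing (Env k A)]

instance : Functor.Linear k
    (forget₂ (FGModuleCat.{u} (Env k A)) (ModuleCat.{u} (Env k A))) where
  map_smul _ _ := rfl

/-- The class of a cocycle, as a morphism from the image of `A`. -/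
def kappaDb {n p : ℕ} (f : Cochain k A n p) (hf : Cochain.delta f = 0) :
    ShiftedHom ((toBig (Env k A)).obj (toDb (Env k A) A)) (formsObj k A p) (n : ℤ) :=
  (toBigIso (Env k A) A).hom ≫ kappa f hf

/-- The relation `Represents` in terms of shifted morphisms. -/
abbrev RepRel {n p : ℕ} {m : ℤ} (h : (p : ℤ) + m = n) (f : Cochain k A n p)
    (hf : Cochain.delta f = 0) (φ : TateHochschild k A m) : Prop :=
  RoofRel (perfBounded (Env k A)).trW (toBig (Env k A)) (Dsg.quot (Env k A)) h φ
    (kappaDb f hf) (kappaDb (Cochain.unit p) (Cochain.delta_unit p))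

lemma map_comp_shiftIso {X Y : DbMod (Env k A)} {M : ModuleCat.{u} (Env k A)} {m n p : ℤ}
    (h : p + m = n) (t : ShiftedHom X Y m)
    (β : ShiftedHom ((toBig (Env k A)).obj Y)
      ((singleFunctor (ModuleCat.{u} (Env k A)) 0).obj M) p) :
    (t.map (toBig (Env k A))).comp β h ≫
        ((singleFunctors (ModuleCat.{u} (Env k A))).shiftIso n (-n) 0 (by lia)).hom.app M =
      (toBig (Env k A)).map t ≫ ((toBig (Env k A)).commShiftIso m).hom.app Y ≫
        (β ≫ ((singleFunctors (ModuleCat.{u} (Env k A))).shiftIso p (-p) 0 (by lia)).hom.app M)⟦m⟧' ≫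
        ((singleFunctors (ModuleCat.{u} (Env k A))).shiftIso m (-n) (-p) (by lia)).hom.app M := by
  have h₁ := congrArg (fun e => e.hom.app M)
    ((singleFunctors (ModuleCat.{u} (Env k A))).shiftIso_add' m p n h (-n) (-p) 0 (by lia) (by lia))
  refine (congrArg (_ ≫ ·) h₁).trans ?_
  simp [ShiftedHom.comp, ShiftedHom.map]

/-- The classes `κ` and `ν` are forced by `isClassOf_iff`; what remains is to move between
`Ω^p(A)[n]` and `Ω^p(A)` placed in degree `-n`. -/
lemma represents_iff {m : ℤ} {n p : ℕ} (h : (n : ℤ) = m + p) (f : Cochain k A n p)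
    (hf : Cochain.delta f = 0) (φ : TateHochschild k A m) :
    Represents h f hf φ ↔ RepRel (by lia) f hf φ := by
  have key (X : DbMod (Env k A)) (s : X ⟶ toDb (Env k A) A) (t : X ⟶ (toDb (Env k A) A)⟦m⟧) :
      (toBig (Env k A)).map s ≫ kappaDb f hf = (ShiftedHom.map t (toBig (Env k A))).comp
        (kappaDb (Cochain.unit p) (Cochain.delta_unit p)) (by lia) ↔
      (toBig (Env k A)).map s ≫ (toBigIso (Env k A) A).hom ≫ kappa f hf ≫
        ((singleFunctors (ModuleCat.{u} (Env k A))).shiftIso n (-n) 0 (by lia)).hom.app _ =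
      (toBig (Env k A)).map t ≫ ((toBig (Env k A)).commShiftIso m).hom.app (toDb (Env k A) A) ≫
        ((toBigIso (Env k A) A).hom ≫ kappa (Cochain.unit p) (Cochain.delta_unit p) ≫
        ((singleFunctors (ModuleCat.{u} (Env k A))).shiftIso p (-p) 0 (by lia)).hom.app _)⟦m⟧' ≫
        ((singleFunctors (ModuleCat.{u} (Env k A))).shiftIso m (-n) (-p) (by lia)).hom.app _ := by
    have h₁ := map_comp_shiftIso (n := n) (by lia) t
      (kappaDb (Cochain.unit p) (Cochain.delta_unit p))
    rw [← cancel_mono (((singleFunctors (ModuleCat.{u} (Env k A))).shiftIso n (-n) 0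
      (by lia)).hom.app _), h₁]
    simp only [kappaDb, Category.assoc]
  constructor
  · rintro ⟨X, s, t, κ, ν, hs, hφ, hκ, hν, e⟩
    rw [isClassOf_iff] at hκ hν
    subst hκ hν
    exact ⟨X, s, t, hs, hφ, (key X s t).2 e⟩
  · rintro ⟨X, s, t, hs, hφ, e⟩
    exact ⟨X, s, t, _, _, hs, hφ, (isClassOf_iff _ _ _).2 rfl, (isClassOf_iff _ _ _).2 rfl,
      (key X s t).1 e⟩

lemma kappaDb_comp {n p q : ℕ} {r l : ℤ} (f : Cochain k A n p) (hf : Cochain.delta f = 0)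
    (γ : ShiftedHom (formsObj k A p) (formsObj k A q) r) (h : r + n = l) :
    (kappaDb f hf).comp γ h = (toBigIso (Env k A) A).hom ≫ (kappa f hf).comp γ h :=
  ShiftedHom.precomp_comp _ _ _ _

lemma kappaDb_theta {n p : ℕ} (f : Cochain k A n p) (hf : Cochain.delta f = 0) :
    kappaDb (Cochain.theta f) (Cochain.delta_theta_eq_zero hf) =
      (kappaDb f hf).comp (chi k A p) (by push_cast; ring) := by
  rw [kappaDb_comp, kappaDb, kappa_theta f hf]

lemma kappaDb_unit_succ (p : ℕ) :
    kappaDb (k := k) (A := A) (Cochain.unit (p + 1)) (Cochain.delta_unit _) =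
      (kappaDb (Cochain.unit p) (Cochain.delta_unit _)).comp (chi k A p) (by push_cast; ring) := by
  rw [kappaDb_comp, kappaDb, kappa_unit_succ]

instance : IsIso (kappaDb (k := k) (A := A) (Cochain.unit 0) (Cochain.delta_unit 0)) := by
  have := isIso_kappa_unit_zero (k := k) (A := A)
  unfold kappaDb
  infer_instance

lemma locallyMono_chi (p : ℕ) :
    LocallyMono (perfBounded (Env k A)).trW (toBig (Env k A)) (chi k A p) :=
  (locallyZero_of_projective (ModuleCat.of (Env k A) (BarTerm k A p))).locallyMono
    (syzygy_shortExact p).singleTriangle_distinguished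

lemma locallyEpi_chi (p : ℕ) :
    LocallyEpi (perfBounded (Env k A)).trW (toBig (Env k A)) (chi k A p) :=
  (locallyZero_of_projective (ModuleCat.of (Env k A) (BarTerm k A p))).locallyEpi
    (syzygy_shortExact p).singleTriangle_distinguished

/-- `ν_0` is an isomorphism, and each further step composes with a connecting morphism whose middle
term `Bar_p(A)` is projective. -/
lemma locallyMono_kappaDb_unit (p : ℕ) : LocallyMono (perfBounded (Env k A)).trW
    (toBig (Env k A)) (kappaDb (k := k) (A := A) (Cochain.unit p) (Cochain.delta_unit p)) := by
  induction p with
  | zero => exact LocallyMono.of_isIso _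
  | succ p ih => rw [kappaDb_unit_succ]; exact ih.comp (locallyMono_chi p) _

lemma locallyEpi_kappaDb_unit (p : ℕ) : LocallyEpi (perfBounded (Env k A)).trW
    (toBig (Env k A)) (kappaDb (k := k) (A := A) (Cochain.unit p) (Cochain.delta_unit p)) := by
  induction p with
  | zero => exact LocallyEpi.of_isIso _
  | succ p ih => rw [kappaDb_unit_succ]; exact ih.comp (locallyEpi_chi p) _

namespace RepRel

variable {m : ℤ} {n p : ℕ} {h : (p : ℤ) + m = n} {f g : Cochain k A n p}
  {hf : Cochain.delta f = 0} {hg : Cochain.delta g = 0} {φ ψ : TateHochschild k A m}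

lemma theta (H : RepRel h f hf φ) (h' : ((p + 1 : ℕ) : ℤ) + m = (n + 1 : ℕ)) :
    RepRel h' (Cochain.theta f) (Cochain.delta_theta_eq_zero hf) φ := by
  rw [RepRel, kappaDb_theta, kappaDb_unit_succ]
  exact H.postcomp _ _ _ _

lemma stab (H : RepRel h f hf φ) (j : ℕ) (h' : ((p + j : ℕ) : ℤ) + m = (n + j : ℕ)) :
    RepRel h' (Cochain.stab f j) (Cochain.delta_stab_eq_zero hf j) φ := by
  induction j with
  | zero => exact H
  | succ j ih => exact RepRel.theta (ih (by push_cast; lia)) h'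

lemma add (H : RepRel h f hf φ) (H' : RepRel h g hg ψ) (hfg : Cochain.delta (f + g) = 0) :
    RepRel h (f + g) hfg (φ + ψ) := by
  have : kappaDb (f + g) hfg = kappaDb f hf + kappaDb g hg := by
    rw [kappaDb, kappa_add f g hf hg, Preadditive.comp_add]; rfl
  rw [RepRel, this]
  exact RoofRel.add H H'

lemma smul (H : RepRel h f hf φ) (r : k) (hrf : Cochain.delta (r • f) = 0) :
    RepRel h (r • f) hrf (r • φ) := by
  have : kappaDb (r • f) hrf = r • kappaDb f hf := by
    rw [kappaDb, kappa_smul r f hf, Linear.comp_smul]; rfl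
  rw [RepRel, this]
  exact RoofRel.smul r H

lemma exists_rep (h : (p : ℤ) + m = n) (f : Cochain k A n p) (hf : Cochain.delta f = 0) :
    ∃ φ : TateHochschild k A m, RepRel h f hf φ :=
  RoofRel.exists_of_locallyEpi h _ (locallyEpi_kappaDb_unit p)

lemma eq_zero (H : RepRel h f hf φ) (h₀ : kappa f hf = 0) : φ = 0 := by
  have h₁ : kappaDb f hf = 0 := by rw [kappaDb, h₀, Limits.comp_zero]
  rw [RepRel, h₁] at H
  exact RoofRel.eq_zero H (locallyMono_kappaDb_unit p)

end RepRel

end Main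

/-! ### The comparison of the two cohomology theories -/

/-! ### Isomorphisms given by their graph -/

section LinearRelation

variable {R M N : Type*} [Ring R] [AddCommGroup M] [AddCommGroup N] [Module R M] [Module R N]
  (G : Submodule R (M × N))

lemma fst_comp_subtype_bijective (h : ∀ y, (0, y) ∈ G → y = 0) (h' : ∀ x, ∃ y, (x, y) ∈ G) :
    Function.Bijective (LinearMap.fst R M N ∘ₗ G.subtype) := by
  refine ⟨(injective_iff_map_eq_zero _).2 ?_, fun x => (h' x).elim fun y hy => ⟨⟨_, hy⟩, rfl⟩⟩
  rintro ⟨⟨x, y⟩, hxy⟩ h₀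
  obtain rfl : x = 0 := h₀
  obtain rfl := h y hxy
  rfl

lemma snd_comp_subtype_bijective (h : ∀ x, (x, 0) ∈ G → x = 0) (h' : ∀ y, ∃ x, (x, y) ∈ G) :
    Function.Bijective (LinearMap.snd R M N ∘ₗ G.subtype) := by
  refine ⟨(injective_iff_map_eq_zero _).2 ?_, fun y => (h' y).elim fun x hx => ⟨⟨_, hx⟩, rfl⟩⟩
  rintro ⟨⟨x, y⟩, hxy⟩ h₀
  obtain rfl : y = 0 := h₀
  obtain rfl := h x hxy
  rfl

variable (h₁ : ∀ y, (0, y) ∈ G → y = 0) (h₂ : ∀ x, (x, 0) ∈ G → x = 0)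
  (h₃ : ∀ x, ∃ y, (x, y) ∈ G) (h₄ : ∀ y, ∃ x, (x, y) ∈ G)

/-- The isomorphism whose graph is a given linear relation. -/
def equivOfGraph : M ≃ₗ[R] N :=
  (LinearEquiv.ofBijective _ (fst_comp_subtype_bijective G h₁ h₃)).symm.trans
    (LinearEquiv.ofBijective _ (snd_comp_subtype_bijective G h₂ h₄))

lemma equivOfGraph_eq {x : M} {y : N} (h : (x, y) ∈ G) : equivOfGraph G h₁ h₂ h₃ h₄ x = y := by
  have e : (LinearEquiv.ofBijective _ (fst_comp_subtype_bijective G h₁ h₃)).symm x = ⟨_, h⟩ :=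
    (LinearEquiv.symm_apply_eq _).2 rfl
  exact congrArg (fun z : G => z.1.2) e

end LinearRelation

/-! ### Bijectivity and multiplicativity of the comparison -/

section Comparison

attribute [local instance] HasDerivedCategory.standard envModule

open DerivedCategory

variable {k A : Type u} [Field k] [Ring A] [Algebra k A] [IsNoetherianRing (Env k A)]

namespace RepRel

variable {m : ℤ} {n p : ℕ} {h : (p : ℤ) + m = n} {f : Cochain k A n p}
  {hf : Cochain.delta f = 0} {φ : TateHochschild k A m}

/-- A stabilization of `f` is a stabilized coboundary, so its class `κ` vanishes, while it still
represents `φ`. This makes the comparison well defined on cohomology classes. -/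
lemma eq_zero_of_cls (H : RepRel h f hf φ) (h' : (n : ℤ) = m + p)
    (h₀ : HHsg.cls h' f hf = 0) : φ = 0 := by
  obtain ⟨i, j, g, hij⟩ := HHsg.exists_stab_eq_stab_delta h₀
  have hg : Cochain.delta (Cochain.delta g) = 0 := Cochain.delta_delta g
  have key : ∀ (F : Cochain k A (n + (i + 1) + j) (p + (i + 1) + j)) (hF : Cochain.delta F = 0),
      F = Cochain.stab (n := n + (i + 1)) (p := p + (i + 1)) (Cochain.delta g) j →
        kappa F hF = 0 := by
    rintro _ hF rfl
    exact (kappa_stab_eq_zero (Cochain.delta g) hg (kappa_delta g hg) j).2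
  exact ((H.stab (i + 1) (by push_cast; lia)).stab j (by push_cast; lia)).eq_zero (key _ _ hij)

lemma precomp_kappaDb_stab_eq_zero {X : DbMod (Env k A)} (s : X ⟶ toDb (Env k A) A)
    (h₀ : (toBig (Env k A)).map s ≫ kappaDb f hf = 0) (j : ℕ) :
    (toBig (Env k A)).map s ≫
      kappaDb (Cochain.stab f j) (Cochain.delta_stab_eq_zero hf j) = 0 := by
  induction j with
  | zero => exact h₀
  | succ j ih =>
    have e := kappaDb_theta (Cochain.stab f j) (Cochain.delta_stab_eq_zero hf j)
    refine (congrArg ((toBig (Env k A)).map s ≫ ·) e).trans ?_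
    refine (ShiftedHom.precomp_comp _ _ _ _).symm.trans ?_
    rw [ih, ShiftedHom.zero_comp]

lemma cls_eq_zero (H : RepRel h f hf (0 : TateHochschild k A m)) (h' : (n : ℤ) = m + p) :
    HHsg.cls h' f hf = 0 := by
  obtain ⟨X, s, hs, e⟩ := RoofRel.exists_of_zero H
  obtain ⟨c, hc⟩ := trW_precomp_bijective s hs
  -- Past the degree `c`, precomposition with `s` is injective, so the stabilized class, which `s`
  -- kills, is zero. Stabilizing `j + 1` times makes the source index a successor, as a coboundary
  -- requires.
  obtain ⟨j, hj⟩ : ∃ j : ℕ, c < j := ⟨c.toNat + 1, by lia⟩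
  have e₁ := precomp_kappaDb_stab_eq_zero s e (j + 1)
  have e₂ : kappaDb (Cochain.stab f (j + 1)) (Cochain.delta_stab_eq_zero hf (j + 1)) = 0 :=
    (hc ((n + (j + 1) : ℕ) : ℤ) (by push_cast; lia) _).1 (e₁.trans Limits.comp_zero.symm)
  rw [kappaDb, Preadditive.IsIso.comp_left_eq_zero] at e₂
  obtain ⟨g, hg⟩ := exists_delta_eq_of_kappa_eq_zero (n := n + j) (Cochain.stab f (j + 1))
    (Cochain.delta_stab_eq_zero hf (j + 1)) e₂
  have hj' : ((n + (j + 1) : ℕ) : ℤ) = m + (p + (j + 1) : ℕ) := by push_cast; lia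
  have key : ∀ (F : Cochain k A (n + j + 1) (p + (j + 1))) (hF : Cochain.delta F = 0),
      Cochain.delta g = F → HHsg.cls (m := m) hj' F hF = 0 := by
    rintro _ hF rfl
    exact HHsg.cls_delta _ g hF
  rw [← HHsg.cls_stab h' f hf (j + 1) hj']
  exact key _ _ hg

/-- For a fraction `t s⁻¹` and `p` large, `t ≫ ν_p[m]` extends uniquely along `s` to a morphism from
`A`, and every such morphism is the class of a cocycle. -/
lemma exists_cocycle (φ : TateHochschild k A m) :
    ∃ (n p : ℕ) (h : (p : ℤ) + m = n) (f : Cochain k A n p) (hf : Cochain.delta f = 0),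
      RepRel h f hf φ := by
  obtain ⟨X, s, t, hs, e⟩ := RoofRel.exists_roof (W := (perfBounded (Env k A)).trW) φ
  obtain ⟨c, hc⟩ := trW_precomp_bijective s hs
  obtain ⟨n, p, hn, h⟩ : ∃ n p : ℕ, c < n ∧ (p : ℤ) + m = n :=
    -- With `p = |c| + |m| + 1` the number `n = m + p` is at least `|c| + 1`, hence positive and
    -- larger than `c`.
    ⟨(m + (c.natAbs + m.natAbs + 1 : ℕ)).toNat, c.natAbs + m.natAbs + 1, by lia, by lia⟩
  obtain ⟨κ, hκ⟩ := (hc n hn (formsMod k A p)).2 ((ShiftedHom.map t (toBig (Env k A))).comp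
    (kappaDb (Cochain.unit p) (Cochain.delta_unit p)) h)
  obtain ⟨f, hf, hf'⟩ := exists_kappa_eq (k := k) (A := A) (n := n) (p := p)
    ((toBigIso (Env k A) A).inv ≫ κ)
  refine ⟨n, p, h, f, hf, X, s, t, hs, e, ?_⟩
  rw [kappaDb, hf', Iso.hom_inv_id_assoc]
  exact hκ

lemma comp {l n' : ℕ} {a b c : ℤ} {h : (p : ℤ) + a = n} {h' : (n' : ℤ) + b = l}
    {g : Cochain k A l n'} {hg : Cochain.delta g = 0}
    {φ : TateHochschild k A a} {ψ : TateHochschild k A b} (H : RepRel h f hf φ)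
    (H' : RepRel h' g hg ψ) (hn : n' = n) (hfg : Cochain.delta (Cochain.comp hn f g) = 0)
    (hc : a + b = c) (h'' : (p : ℤ) + c = l) :
    RepRel h'' (Cochain.comp hn f g) hfg (ψ.comp φ hc) := by
  subst hn
  have e₁ : kappaDb (Cochain.comp rfl f g) hfg = (kappaDb g hg).comp (.mk₀ (0 : ℤ) rfl
      ((singleFunctor (ModuleCat.{u} (Env k A)) 0).map (extHom f hf))) (zero_add _) := by
    rw [kappaDb_comp, kappaDb, kappa_comp f hf g hg]
  have e₂ : kappaDb f hf = (kappaDb (Cochain.unit n') (Cochain.delta_unit n')).comp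
      (.mk₀ (0 : ℤ) rfl ((singleFunctor (ModuleCat.{u} (Env k A)) 0).map (extHom f hf)))
        (zero_add _) := by
    rw [kappaDb_comp, kappaDb, ← kappa_eq f hf]
  -- Applying the bimodule map `F` of `f` to the roof of `g` replaces `κ_g` by `κ_{f ∘ g}` and `ν_n`
  -- by `κ_f`, which is the source datum of the roof of `f`.
  have H₁ := RoofRel.postcomp H' (.mk₀ (0 : ℤ) rfl
    ((singleFunctor (ModuleCat.{u} (Env k A)) 0).map (extHom f hf))) (zero_add _) (zero_add _) h'
  rw [← e₁, ← e₂] at H₁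
  exact RoofRel.comp H₁ H hc h''

lemma unit_zero {h : ((0 : ℕ) : ℤ) + 0 = (0 : ℕ)} : RepRel h (Cochain.unit (k := k) (A := A) 0)
    (Cochain.delta_unit 0) (ShiftedHom.mk₀ 0 rfl (𝟙 _)) := by
  have H := RoofRel.map (W := (perfBounded (Env k A)).trW) (T := toBig (Env k A))
    (Q := Dsg.quot (Env k A)) h (ShiftedHom.mk₀ (0 : ℤ) rfl (𝟙 (toDb (Env k A) A)))
    (kappaDb (Cochain.unit (k := k) (A := A) 0) (Cochain.delta_unit 0))
  rwa [ShiftedHom.map_mk₀, ShiftedHom.map_mk₀, CategoryTheory.Functor.map_id,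
    CategoryTheory.Functor.map_id, ShiftedHom.mk₀_id_comp] at H

end RepRel

variable (k A) in
/-- The relation between singular Hochschild classes and Tate-Hochschild classes which is
generated by `Represents`. -/
def comparison (m : ℤ) : Submodule k (HHsg k A m × TateHochschild k A m) where
  carrier := {x | ∃ (n p : ℕ) (h : (n : ℤ) = m + p) (f : Cochain k A n p)
    (hf : Cochain.delta f = 0), HHsg.cls h f hf = x.1 ∧ RepRel (by lia) f hf x.2}
  add_mem' := by
    have key : ∀ {n p n' p' : ℕ} (h : (n : ℤ) = m + p) (h' : (n' : ℤ) = m + p')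
        (f : Cochain k A n p) (hf : Cochain.delta f = 0) (f' : Cochain k A n' p')
        (hf' : Cochain.delta f' = 0) (φ φ' : TateHochschild k A m), p ≤ p' →
        RepRel (by lia) f hf φ → RepRel (by lia) f' hf' φ' →
        ∃ (g : Cochain k A n' p') (hg : Cochain.delta g = 0),
          HHsg.cls h' g hg = HHsg.cls h f hf + HHsg.cls h' f' hf' ∧
            RepRel (by lia) g hg (φ + φ') := by
      intro n p n' p' h h' f hf f' hf' φ φ' hp H H'
      -- The cocycle at the earlier stage is stabilized to the later one, where the two can be added
      -- and are measured against the same `ν_{p'}`.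
      obtain ⟨j, rfl⟩ := Nat.exists_eq_add_of_le hp
      obtain rfl : n' = n + j := by push_cast at h'; lia
      have hg : Cochain.delta (Cochain.stab f j + f') = 0 := by
        rw [Cochain.delta_add, Cochain.delta_stab_eq_zero hf, hf', add_zero]
      refine ⟨_, hg, ?_, (H.stab j (by push_cast; lia)).add H' hg⟩
      rw [HHsg.cls_add _ _ _ (Cochain.delta_stab_eq_zero hf j) hf', HHsg.cls_stab]
    rintro ⟨_, φ⟩ ⟨_, φ'⟩ ⟨n, p, h, f, hf, rfl, H⟩ ⟨n', p', h', f', hf', rfl, H'⟩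
    rcases le_total p p' with hp | hp
    · obtain ⟨g, hg, e, H''⟩ := key h h' f hf f' hf' φ φ' hp H H'
      exact ⟨_, _, h', g, hg, e, H''⟩
    · obtain ⟨g, hg, e, H''⟩ := key h' h f' hf' f hf φ' φ hp H' H
      rw [add_comm φ' φ] at H''
      exact ⟨_, _, h, g, hg, e.trans (add_comm _ _), H''⟩
  zero_mem' := by
    obtain ⟨n, p, h, f, hf, e⟩ := HHsg.exists_cls_eq (0 : HHsg k A m)
    obtain ⟨φ, H⟩ := RepRel.exists_rep (m := m) (by lia) f hf
    obtain rfl := H.eq_zero_of_cls h e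
    exact ⟨n, p, h, f, hf, e, H⟩
  smul_mem' := by
    rintro r ⟨_, φ⟩ ⟨n, p, h, f, hf, rfl, H⟩
    have hf' : Cochain.delta (r • f) = 0 := by rw [Cochain.delta_smul, hf, smul_zero]
    exact ⟨n, p, h, r • f, hf', HHsg.cls_smul h r f hf hf', H.smul r hf'⟩

lemma mem_comparison_iff {m : ℤ} (x : HHsg k A m) (φ : TateHochschild k A m) :
    (x, φ) ∈ comparison k A m ↔ ∃ (n p : ℕ) (h : (n : ℤ) = m + p) (f : Cochain k A n p)
      (hf : Cochain.delta f = 0), HHsg.cls h f hf = x ∧ RepRel (by lia) f hf φ := Iff.rfl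

lemma mem_comparison {m : ℤ} {n p : ℕ} (h : (n : ℤ) = m + p) {f : Cochain k A n p}
    {hf : Cochain.delta f = 0} {φ : TateHochschild k A m} (H : RepRel (by lia) f hf φ) :
    (HHsg.cls h f hf, φ) ∈ comparison k A m :=
  (mem_comparison_iff _ _).2 ⟨n, p, h, f, hf, rfl, H⟩

lemma eq_zero_of_mem_comparison {m : ℤ} {φ : TateHochschild k A m}
    (h : (0, φ) ∈ comparison k A m) : φ = 0 := by
  obtain ⟨n, p, h', f, hf, e, H⟩ := (mem_comparison_iff _ _).1 h
  exact H.eq_zero_of_cls h' e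

lemma eq_zero_of_mem_comparison' {m : ℤ} {x : HHsg k A m}
    (h : (x, 0) ∈ comparison k A m) : x = 0 := by
  obtain ⟨n, p, h', f, hf, rfl, H⟩ := (mem_comparison_iff _ _).1 h
  exact H.cls_eq_zero h'

lemma exists_mem_comparison {m : ℤ} (x : HHsg k A m) : ∃ φ, (x, φ) ∈ comparison k A m := by
  obtain ⟨n, p, h, f, hf, rfl⟩ := HHsg.exists_cls_eq x
  obtain ⟨φ, H⟩ := RepRel.exists_rep (m := m) (by lia) f hf
  exact ⟨φ, mem_comparison h H⟩

lemma exists_mem_comparison' {m : ℤ} (φ : TateHochschild k A m) :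
    ∃ x, (x, φ) ∈ comparison k A m := by
  obtain ⟨n, p, h, f, hf, H⟩ := RepRel.exists_cocycle φ
  exact ⟨_, mem_comparison (by lia) H⟩

variable (k A) in
/-- The isomorphism from singular Hochschild cohomology to Tate-Hochschild cohomology. -/
def comparisonEquiv (m : ℤ) : HHsg k A m ≃ₗ[k] TateHochschild k A m :=
  equivOfGraph (comparison k A m) (fun _ => eq_zero_of_mem_comparison)
    (fun _ => eq_zero_of_mem_comparison') exists_mem_comparison exists_mem_comparison'

lemma comparisonEquiv_cls_eq_iff {m : ℤ} {n p : ℕ} (h : (n : ℤ) = m + p) (f : Cochain k A n p)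
    (hf : Cochain.delta f = 0) (φ : TateHochschild k A m) :
    comparisonEquiv k A m (HHsg.cls h f hf) = φ ↔ RepRel (by lia) f hf φ := by
  have key {ψ : TateHochschild k A m} (H : RepRel (by lia) f hf ψ) :
      comparisonEquiv k A m (HHsg.cls h f hf) = ψ :=
    equivOfGraph_eq _ _ _ _ _ (mem_comparison h H)
  refine ⟨?_, key⟩
  rintro rfl
  -- Every cocycle represents some morphism, which by `key` must be the value of the isomorphism.
  obtain ⟨ψ, H⟩ := RepRel.exists_rep (m := m) (by lia) f hf
  exact (key H).symm ▸ H

lemma comparisonEquiv_one :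
    comparisonEquiv k A 0 HHsg.one = ShiftedHom.mk₀ 0 rfl (𝟙 _) :=
  (comparisonEquiv_cls_eq_iff _ _ _ _).2 RepRel.unit_zero

lemma comparisonEquiv_cup {a b c : ℤ} (h : a + b = c) (x : HHsg k A a) (y : HHsg k A b) :
    comparisonEquiv k A c (HHsg.cup h x y) =
      (comparisonEquiv k A b y).comp (comparisonEquiv k A a x) h := by
  obtain ⟨m, p, hm, f, hf, rfl⟩ := HHsg.exists_cls_eq x
  obtain ⟨n, q, hn, g, hg, rfl⟩ := HHsg.exists_cls_eq y
  have hfg : Cochain.delta (Cochain.cup f g) = 0 := Cochain.delta_comp_eq_zero (Nat.add_comm q m)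
    (Cochain.delta_stab_eq_zero hf q) (Cochain.delta_stab_eq_zero hg m)
  have hmn : ((n + m : ℕ) : ℤ) = c + (p + q : ℕ) := by push_cast; lia
  have e : HHsg.cup h (HHsg.cls hm f hf) (HHsg.cls hn g hg) =
      HHsg.cls hmn (Cochain.cup f g) hfg := by
    unfold HHsg.cls
    rw [HHsg.cup_mk]
    congr 2
    exact Csg.cup_of h hm hn hmn f g
  rw [e, comparisonEquiv_cls_eq_iff]
  have H := (comparisonEquiv_cls_eq_iff hm f hf _).1 rfl
  have H' := (comparisonEquiv_cls_eq_iff hn g hg _).1 rfl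
  -- By definition `cup f g` composes `stab f q` with `stab g m`, and stabilizing changes neither
  -- represented morphism.
  exact RepRel.comp (H.stab q (by push_cast; lia)) (H'.stab m (by push_cast; lia))
    (Nat.add_comm q m) hfg h (by push_cast; lia)

end Comparison

end TateHH

end

theorem proposition4 (k A : Type u) [Field k] [Ring A] [Algebra k A]
    [IsNoetherianRing (A ⊗[k] Aᵐᵒᵖ)] :
    ∃ Φ : ∀ m : ℤ, TateHH.HHsg k A m ≃ₗ[k] TateHH.TateHochschild k A m,
      (∀ (m : ℤ) (n p : ℕ) (h : (n : ℤ) = m + p) (f : TateHH.Cochain k A n p)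
        (hf : TateHH.Cochain.delta f = 0) (φ : TateHH.TateHochschild k A m),
        Φ m (TateHH.HHsg.cls h f hf) = φ ↔ TateHH.Represents h f hf φ) ∧
      Φ 0 TateHH.HHsg.one = ShiftedHom.mk₀ 0 rfl (𝟙 _) ∧
      ∀ (a b c : ℤ) (h : a + b = c) (x : TateHH.HHsg k A a) (y : TateHH.HHsg k A b),
        Φ c (TateHH.HHsg.cup h x y) = (Φ b y).comp (Φ a x) h :=
  ⟨TateHH.comparisonEquiv k A,
    fun _ _ _ h f hf φ => (TateHH.comparisonEquiv_cls_eq_iff h f hf φ).trans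
      (TateHH.represents_iff h f hf φ).symm,
    TateHH.comparisonEquiv_one, fun _ _ _ h x y => TateHH.comparisonEquiv_cup h x y⟩
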